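/- Let $D\subset\mathbb C$ be a bounded simply connected domain with analytic boundary. Let $\gamma>0$ and let $\Psi(w)=w+a_0+a_1w^{-1}+a_2w^{-2}+\cdots$ be the conformal map of $\{|w|>\gamma\}$ onto $\mathbb C\setminus\overline D$; analyticity of the boundary means that, for some $\delta>0$, $\Psi$ extends conformally to $\{|w|>\gamma-\delta\}$, and $\partial D=\Psi(\{|w|=\gamma\})$. Let $F_m$ be the Faber polynomials, given by $\frac{\Psi'(w)}{\Psi(w)-z}=\sum_{m\ge 0}F_m(z)w^{-m-1}$, and let $C=(c_{mn})_{m,n\ge 1}$ be the matrix of Grunsky coefficients, given by $F_m(\Psi(w))=w^m+\sum_{n\ge 1}c_{mn}w^{-n}$. For $\tau\in\mathbb R$ let $\gamma^{\tau\mathcal N}=(\gamma^{\tau n}\delta_{mn})_{m,n\ge1}$; a bar over a matrix denotes the entrywise complex conjugate. Let $\sigma_m,\sigma_c>0$ be the conductivities (the subscripts of $\sigma_m$ and $\sigma_c$ are labels, not indices). Then the semi-infinite matrix $I-\gamma^{-2\mathcal N}C\gamma^{-2\mathcal N}\overline C$ is well defined and has a unique two-sided inverse, where the matrix and its inverse are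 considered among the semi-infinite matrices $A$ for which $\gamma^{\mathcal N}A\gamma^{-\mathcal N}$ is a bounded operator on $\ell^2$. For each $m\ge1$ let $u_m$ be the field that corresponds to the background field $\Re[\alpha_mF_m]$, $\alpha_m\in\mathbb C$, that is, $$u_m(z)=\Re\Big[\sum_{n\ge1}\beta_{mn}F_n(z)\Big]\ \ (z\in D),\qquad u_m(z)=\Re\big[\alpha_mF_m(z)\big]+\Re\Big[\sum_{n\ge1}s_{mn}w^{-n}\Big]\ \ (z=\Psi(w),\ |w|>\gamma),$$ where the series converge absolutely, and suppose that $u_m$ is continuously differentiable up to $\partial D$ from either side. Put $\boldsymbol\alpha=(\alpha_m\delta_{mn})_{m,n\ge1}$, $\boldsymbol\beta=(\beta_{mn})_{m,n\ge1}$, $\boldsymbol s=(s_{mn})_{m,n\ge1}$. Then all series in the formula below converge absolutely, and the flux condition $$\sigma_m\frac{\partial u}{\partial\nu}\Big|^+=\sigma_c\frac{\partial u}{\partial\nu}\Big|^-\quad\text{on }\partial D$$ ($\nu$ the outward unit normal, $\pm$ the limits from outside and inside $D$) holds for $u=u_m$ for every $m\ge1$ if and only if $$\boldsymbol\beta=\frac{\sigma_m}{\sigma_c}\boldsymbol\alpha-\frac{\sigma_m}{\sigma_c}\big(\overline{\boldsymbol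 s}+\boldsymbol s\,\gamma^{-2\mathcal N}\overline C\big)\big(I-\gamma^{-2\mathcal N}C\gamma^{-2\mathcal N}\overline C\big)^{-1}\gamma^{-2\mathcal N}.$$ Moreover, for every finite set $J$ of positive integers, the flux condition holds for $u=\sum_{m\in J}u_m$ if and only if the sum of the rows $m\in J$ of the left-hand side equals the sum of the rows $m\in J$ of the right-hand side. -/

import Mathlib

open Filter Topology

noncomputable section

namespace FaberFlux

/-- `D` is a bounded simply connected planar domain with analytic boundary, `γ` is its conformal
radius, and `Ψ` is the conformal map of `{|w| > γ}` onto the complement of the closure of `D` with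
`Ψ w = w + a 0 + a 1 / w + a 2 / w ^ 2 + ⋯`. Analyticity of the boundary means that `Ψ` extends
conformally (holomorphically and injectively) to `{|w| > γ - δ}` for some `δ > 0`; the boundary of
`D` is then the image of the circle `{|w| = γ}`. -/
structure IsExteriorMap (D : Set ℂ) (γ : ℝ) (Ψ : ℂ → ℂ) (a : ℕ → ℂ) : Prop where
  isOpen : IsOpen D
  isBounded : Bornology.IsBounded D
  simplyConnected : SimplyConnectedSpace D
  radius_pos : 0 < γ
  conformal : ∃ δ : ℝ, 0 < δ ∧ DifferentiableOn ℂ Ψ {w | γ - δ < ‖w‖} ∧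
    Set.InjOn Ψ {w | γ - δ < ‖w‖}
  image_exterior : Ψ '' {w | γ < ‖w‖} = (closure D)ᶜ
  image_circle : Ψ '' {w | ‖w‖ = γ} = frontier D
  expansion : ∀ w : ℂ, γ < ‖w‖ → HasSum (fun n : ℕ => a n / w ^ n) (Ψ w - w)

/-! ### Faber polynomials and Grunsky coefficients -/

/-- The coefficients, in powers of `t = 1 / w`, of `Ψ'(w) = 1 - ∑ n, n * a n * t ^ (n + 1)`. -/
def derivCoeff (a : ℕ → ℂ) : ℕ → Polynomial ℂ
  | 0 => 1
  | n + 1 => -Polynomial.C ((n : ℂ) * a n)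

/-- The coefficients, in powers of `t = 1 / w`, of
`(Ψ(w) - z) / w = 1 + (a 0 - z) * t + a 1 * t ^ 2 + a 2 * t ^ 3 + ⋯`,
where `z` is the polynomial variable. -/
def shiftCoeff (a : ℕ → ℂ) : ℕ → Polynomial ℂ
  | 0 => 1
  | 1 => Polynomial.C (a 0) - Polynomial.X
  | n + 2 => Polynomial.C (a (n + 1))

/-- The Faber polynomials, given by their generating function
`Ψ'(w) / (Ψ(w) - z) = ∑ m, F_m(z) / w ^ (m + 1)`: multiplied by `w` and written in `t = 1 / w`,
this says that `F_m` is the coefficient of `t ^ m` in the quotient of the two series above. -/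
def faber (a : ℕ → ℂ) (m : ℕ) : Polynomial ℂ :=
  PowerSeries.coeff m
    (PowerSeries.mk (derivCoeff a) * PowerSeries.invOfUnit (PowerSeries.mk (shiftCoeff a)) 1)

/-- The matrix `C` of Grunsky coefficients: `c_{mn}` is the coefficient of `w ^ (-n)` in the Laurent
expansion `F_m(Ψ(w)) = w ^ m + ∑ n ≥ 1, c_{mn} w ^ (-n)`. -/
def grunsky (γ : ℝ) (Ψ : ℂ → ℂ) (a : ℕ → ℂ) : Matrix ℕ+ ℕ+ ℂ := fun m n =>
  (2 * Real.pi * Complex.I)⁻¹ *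
    ∮ w in C(0, γ), w ^ ((n : ℕ) - 1) * (faber a m).eval (Ψ w)

/-! ### Semi-infinite matrices -/

/-- The product of two semi-infinite matrices. -/
def infMul (A B : Matrix ℕ+ ℕ+ ℂ) : Matrix ℕ+ ℕ+ ℂ := fun i j => ∑' k, A i k * B k j

infixl:70 " ⊙ " => infMul

/-- All series that define the product of two semi-infinite matrices converge absolutely. -/
def MulSummable (A B : Matrix ℕ+ ℕ+ ℂ) : Prop := ∀ i j, Summable fun k => A i k * B k j

/-- The entrywise complex conjugate of a matrix. -/
def conjMat (A : Matrix ℕ+ ℕ+ ℂ) : Matrix ℕ+ ℕ+ ℂ := fun i j => (starRingEnd ℂ) (A i j)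

/-- The diagonal matrix `γ ^ (τ 𝒩)`, with entries `γ ^ (τ n)`. -/
def gammaPow (γ τ : ℝ) : Matrix ℕ+ ℕ+ ℂ :=
  Matrix.diagonal fun n : ℕ+ => ((γ ^ (τ * (n : ℝ)) : ℝ) : ℂ)

/-- The matrix `A`, normalized as `γ ^ 𝒩 A γ ^ (-𝒩)`, is the matrix of a bounded operator
on `ℓ²`. -/
def IsBoundedMat (γ : ℝ) (A : Matrix ℕ+ ℕ+ ℂ) : Prop :=
  ∃ T : lp (fun _ : ℕ+ => ℂ) 2 →L[ℂ] lp (fun _ : ℕ+ => ℂ) 2,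
    ∀ m n : ℕ+, (T (lp.single 2 n (1 : ℂ)) : ℕ+ → ℂ) m =
      (γ : ℂ) ^ (m : ℕ) * A m n / (γ : ℂ) ^ (n : ℕ)

/-- `M` is the two-sided inverse of the semi-infinite matrix `A`. Both matrices represent bounded
operators, so that the series in the products converge absolutely. -/
structure IsInfInverse (γ : ℝ) (A M : Matrix ℕ+ ℕ+ ℂ) : Prop where
  bounded : IsBoundedMat γ A
  bounded_inv : IsBoundedMat γ M
  mul_inv : A ⊙ M = 1
  inv_mul : M ⊙ A = 1

/-! ### The fields and the flux condition -/

/-- The outward unit normal vector to `∂D` at the boundary point `Ψ w`, where `|w| = γ`: the tangent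
vector `i w Ψ'(w)` of the curve `θ ↦ Ψ (γ e ^ (i θ))`, rotated clockwise by a right angle and
normalized. -/
def outwardNormal (Ψ : ℂ → ℂ) (w : ℂ) : ℂ := (w * deriv Ψ w) / (‖w * deriv Ψ w‖ : ℂ)

/-- The derivative of `u` in the direction `ν` has the limit `g` at the boundary point `x`, when `x`
is approached from within `S`. -/
def HasNormalTrace (S : Set ℂ) (u : ℂ → ℝ) (x ν : ℂ) (g : ℝ) : Prop :=
  Tendsto (fun z => fderiv ℝ u z ν) (𝓝[S] x) (𝓝 g)

/-- The flux condition `σ_m ∂u/∂ν|⁺ = σ_c ∂u/∂ν|⁻` on `∂D`. -/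
def FluxContinuous (σm σc : ℝ) (D : Set ℂ) (γ : ℝ) (Ψ : ℂ → ℂ) (u : ℂ → ℝ) : Prop :=
  ∀ w : ℂ, ‖w‖ = γ → ∃ gp gm : ℝ,
    HasNormalTrace (closure D)ᶜ u (Ψ w) (outwardNormal Ψ w) gp ∧
    HasNormalTrace D u (Ψ w) (outwardNormal Ψ w) gm ∧
    σm * gp = σc * gm

/-- `u` is continuously differentiable up to `∂D` from either side: its gradient in `D` extends
continuously to the closure of `D`, and its gradient outside the closure of `D` extends continuously
to the complement of `D`. -/
def IsC1UpToBoundary (D : Set ℂ) (u : ℂ → ℝ) : Prop :=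
  (∃ G : ℂ → (ℂ →L[ℝ] ℝ), ContinuousOn G (closure D) ∧ ∀ z ∈ D, G z = fderiv ℝ u z) ∧
  (∃ G : ℂ → (ℂ →L[ℝ] ℝ), ContinuousOn G Dᶜ ∧ ∀ z ∈ (closure D)ᶜ, G z = fderiv ℝ u z)

/-- The field `u` with background field `Re [α_m F_m]` has the expansion
`u = Re [∑ n, β_n F_n]` in `D` and, at the points `z = Ψ w` with `|w| > γ`, the expansion
`u(z) = Re [α_m F_m(z)] + Re [∑ n, s_n w ^ (-n)]`. -/
structure HasModeExpansion (D : Set ℂ) (γ : ℝ) (Ψ : ℂ → ℂ) (a : ℕ → ℂ)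
    (m : ℕ+) (αm : ℂ) (β s : ℕ+ → ℂ) (u : ℂ → ℝ) : Prop where
  summable_int : ∀ z ∈ D, Summable fun n : ℕ+ => β n * (faber a n).eval z
  eq_int : ∀ z ∈ D, u z = (∑' n : ℕ+, β n * (faber a n).eval z).re
  summable_ext : ∀ w : ℂ, γ < ‖w‖ → Summable fun n : ℕ+ => s n / w ^ (n : ℕ)
  eq_ext : ∀ w : ℂ, γ < ‖w‖ →
    u (Ψ w) = (αm * (faber a m).eval (Ψ w)).re + (∑' n : ℕ+, s n / w ^ (n : ℕ)).re

/-- The matrix `γ^{-2𝒩} C γ^{-2𝒩} C̄`. -/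
def grunskySquare (γ : ℝ) (C : Matrix ℕ+ ℕ+ ℂ) : Matrix ℕ+ ℕ+ ℂ :=
  (gammaPow γ (-2) ⊙ C) ⊙ (gammaPow γ (-2) ⊙ conjMat C)

/-- The matrix `s̄ + s γ^{-2𝒩} C̄`. -/
def sourceMat (γ : ℝ) (C s : Matrix ℕ+ ℕ+ ℂ) : Matrix ℕ+ ℕ+ ℂ :=
  conjMat s + (s ⊙ gammaPow γ (-2)) ⊙ conjMat C

/-- The right-hand side
`(σ_m/σ_c) α - (σ_m/σ_c) (s̄ + s γ^{-2𝒩} C̄) M γ^{-2𝒩}`,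
in which `M` is the inverse of `I - γ^{-2𝒩} C γ^{-2𝒩} C̄`. -/
def betaFormula (σm σc γ : ℝ) (C M : Matrix ℕ+ ℕ+ ℂ) (α : ℕ+ → ℂ) (s : Matrix ℕ+ ℕ+ ℂ) :
    Matrix ℕ+ ℕ+ ℂ :=
  ((σm / σc : ℝ) : ℂ) • Matrix.diagonal α -
    ((σm / σc : ℝ) : ℂ) • ((sourceMat γ C s ⊙ M) ⊙ gammaPow γ (-2))

end FaberFlux

end

/-!
The generating function `Ψ'(w) / (Ψ(w) - z)` of the Faber polynomials is studied in the variable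
`t = 1 / w`. At `z = Ψ v` its only singularity in the region where `Ψ` is conformal is a simple pole
at `w = v`, with the same principal part as `1 / (w - v)`. Removing it leaves the generating
function of the differences `F_m(Ψ(v)) - v ^ m`, which is holomorphic beyond the circle `|w| = γ`.
Cauchy's estimates therefore give the expansion `F_m(Ψ(v)) = v ^ m + ∑ n, c_{mn} v ^ (-n)` in a
region `|v| > ρ` with `ρ < γ`, and the geometric decay `|c_{mn}| ≤ K ρ ^ (m + n)`
(`IsConformalBeyond.exists_grunsky_bound`). All series below converge because of it.

Conjugated by `γ ^ 𝒩`, the matrix `γ ^ (-2𝒩) C` becomes `S = γ ^ (-𝒩) C γ ^ (-𝒩)`, a compact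
operator on `ℓ²` (`HasGrunskyExpansion.exists_op`), and `I - γ ^ (-2𝒩) C γ ^ (-2𝒩) C̄` becomes
`1 - S S̄`. By the Fredholm alternative the latter is invertible as soon as it is injective on row
vectors, and this reduces to the claim that `v S = v̄` forces `v = 0` (`isUnit_one_sub_mul`). If
`v S = v̄`, the function `∑ v_m γ ^ (-m) F_m` is holomorphic in `D`, continuous up to the boundary
and real there, hence real in `D`; its Fourier coefficients on a curve `Ψ({|w| = r})`, `r < γ`, then
vanish (`eq_zero_of_rowAct_eq_star`).

In the coordinate `w`, each field is on either side of the boundary the real part of a Laurent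
series with coefficients `p_n` of `w ^ n` and `q_n` of `w ^ (-n)`. Up to the factor `π n`, the
`n`-th Fourier coefficient of its derivative in the direction `w Ψ'(w)`, a positive multiple of the
outward normal, is `p_n γ ^ n - conj (q_n γ ^ (-n))`; the coefficient of order `0` vanishes. The
flux condition compares these numbers for the two sides (`fluxContinuous_sum_iff`). Outside, `p` has
the single entry `α_m` and `q_n = α_m c_{mn} + s_{mn}`; inside, `p = β_m` and `q = β_m C`. With
`κ = σ_m / σ_c`, `y = (β_m - κ α_m e_m) γ ^ 𝒩` and `σ = s_m γ ^ (-𝒩)`, where `β_m` and `s_m` are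
rows and `e_m` is the `m`-th unit vector, the condition reads `y - ȳ S̄ + κ σ̄ = 0`. Both `y` and
`σ` belong to `ℓ²`: the normal derivatives are continuous on the boundary, so that their Fourier
coefficients are bounded, and division by `n` makes them square summable. Finally, eliminating `ȳ`
by means of the conjugate equation gives `y = -κ (σ̄ + σ S̄) (1 - S S̄)⁻¹`, which is the matrix
identity; since `1 - S S̄` is injective, the elimination can be reversed (`sub_rowAct_eq_zero_iff`).
-/

namespace FaberFlux

open Metric Set

/-! ### Taylor coefficients of holomorphic functions -/

/-- The `n`-th Taylor coefficient of `f` at the origin. -/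
noncomputable def taylorCoeff (f : ℂ → ℂ) (n : ℕ) : ℂ := iteratedDeriv n f 0 / (n.factorial : ℂ)

theorem hasSum_taylorCoeff {f : ℂ → ℂ} {R : ℝ} (hf : DifferentiableOn ℂ f (ball 0 R)) {t : ℂ}
    (ht : ‖t‖ < R) : HasSum (fun n => taylorCoeff f n * t ^ n) (f t) := by
  have h := Complex.hasSum_taylorSeries_on_ball hf (z := t) (by simpa using ht)
  refine h.congr_fun ?_
  intro n
  simp only [taylorCoeff, sub_zero, smul_eq_mul]
  ring

theorem norm_taylorCoeff_le {f : ℂ → ℂ} {R R' B : ℝ} (hf : DifferentiableOn ℂ f (ball 0 R'))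
    (hR : 0 < R) (hRR : R < R') (hB : ∀ t, ‖t‖ = R → ‖f t‖ ≤ B) (n : ℕ) :
    ‖taylorCoeff f n‖ ≤ B / R ^ n := by
  have h := Complex.norm_iteratedDeriv_le_of_forall_mem_sphere_norm_le (c := 0) (R := R) (C := B)
    (f := f) n hR
    ((hf.mono (closedBall_subset_ball hRR)).diffContOnCl_ball subset_rfl)
    (fun z hz => hB z (by simpa using hz))
  have hn : (0 : ℝ) < n.factorial := by exact_mod_cast n.factorial_pos
  rw [taylorCoeff, norm_div, Complex.norm_natCast, div_le_iff₀ hn]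
  calc _ ≤ _ := h
    _ = _ := by ring

theorem hasFPowerSeriesOnBall_of_hasSum {f : ℂ → ℂ} {b : ℕ → ℂ} {ε : ℝ} (hε : 0 < ε)
    (h : ∀ t : ℂ, ‖t‖ < ε → HasSum (fun n => b n * t ^ n) (f t)) :
    HasFPowerSeriesOnBall f (FormalMultilinearSeries.ofScalars ℂ b) 0 (ENNReal.ofReal ε) := by
  refine ⟨?_, by simpa using hε, ?_⟩
  · refine ENNReal.le_of_forall_nnreal_lt fun r hr => ?_
    have hr' : (r : ℝ) < ε := by
      have := (ENNReal.lt_ofReal_iff_toReal_lt ENNReal.coe_ne_top).1 hr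
      simpa using this
    refine FormalMultilinearSeries.le_radius_of_tendsto _ (l := 0) ?_
    have := ((h (r : ℂ) (by simpa using hr')).summable.tendsto_atTop_zero).norm
    simpa [FormalMultilinearSeries.ofScalars_norm] using this
  · intro y hy
    have hy' : ‖y‖ < ε := by
      simpa [Metric.eball_ofReal] using hy
    simpa [FormalMultilinearSeries.ofScalars_apply_eq, mul_comm] using h y hy'

theorem eq_taylorCoeff_of_hasSum {f : ℂ → ℂ} {b : ℕ → ℂ} {ε : ℝ} (hε : 0 < ε)
    (h : ∀ t : ℂ, ‖t‖ < ε → HasSum (fun n => b n * t ^ n) (f t)) (n : ℕ) :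
    b n = taylorCoeff f n := by
  have h1 := hasFPowerSeriesOnBall_of_hasSum hε h
  have hd : DifferentiableOn ℂ f (ball 0 ε) := by
    have := h1.differentiableOn
    rwa [Metric.eball_ofReal] at this
  have h2 := hasFPowerSeriesOnBall_of_hasSum hε fun t ht => hasSum_taylorCoeff hd ht
  have h3 := h1.hasFPowerSeriesAt.eq_formalMultilinearSeries h2.hasFPowerSeriesAt
  exact congrFun (FormalMultilinearSeries.ofScalars_series_injective ℂ ℂ h3) n

theorem taylorCoeff_deriv (f : ℂ → ℂ) (n : ℕ) :
    taylorCoeff (deriv f) n = (n + 1) * taylorCoeff f (n + 1) := by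
  have hn : (n.factorial : ℂ) ≠ 0 := by exact_mod_cast n.factorial_ne_zero
  have hn1 : (n + 1 : ℂ) ≠ 0 := by exact_mod_cast n.succ_ne_zero
  rw [taylorCoeff, taylorCoeff, iteratedDeriv_succ', Nat.factorial_succ]
  push_cast
  field_simp

/-! ### Derivatives of injective holomorphic functions -/

/-- The inverse of an injective holomorphic function is continuous by the open mapping theorem and
holomorphic off the isolated critical values, hence holomorphic; the chain rule then rules out
critical points. -/
theorem deriv_ne_zero_of_injOn {f : ℂ → ℂ} {U : Set ℂ} (hU : IsOpen U)
    (hf : DifferentiableOn ℂ f U) (hinj : InjOn f U) {z : ℂ} (hz : z ∈ U) : deriv f z ≠ 0 := by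
  have han : AnalyticAt ℂ f z := hf.analyticAt (hU.mem_nhds hz)
  have hne : ¬ ∀ᶠ w in 𝓝 z, f w = f z := by
    intro h
    have h1 : ∀ᶠ w in 𝓝 z, w = z := by
      filter_upwards [h, hU.mem_nhds hz] with w hw hwU using hinj hwU hz hw
    have h2 : ∀ᶠ w in 𝓝[≠] z, w = z := h1.filter_mono nhdsWithin_le_nhds
    obtain ⟨w, hw1, hw2⟩ := (h2.and self_mem_nhdsWithin).exists
    exact hw2 hw1
  have hcrit : ∀ᶠ w in 𝓝[≠] z, deriv f w ≠ 0 := by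
    refine (han.deriv.eventually_eq_zero_or_eventually_ne_zero).resolve_left fun h => hne ?_
    obtain ⟨ε, hε, hb⟩ := Metric.eventually_nhds_iff_ball.1
      (h.and (hU.mem_nhds hz : ∀ᶠ w in 𝓝 z, w ∈ U))
    filter_upwards [ball_mem_nhds z hε] with w hw
    refine IsOpen.is_const_of_deriv_eq_zero isOpen_ball (convex_ball z ε).isPreconnected
      (hf.mono fun x hx => (hb x hx).2) (fun x hx => (hb x hx).1) hw (mem_ball_self hε)
  obtain ⟨ε, hε, hb⟩ := Metric.eventually_nhds_iff_ball.1
      ((eventually_nhdsWithin_iff.1 hcrit).and (hU.mem_nhds hz : ∀ᶠ w in 𝓝 z, w ∈ U))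
  set B := ball z ε with hB
  have hzB : z ∈ B := mem_ball_self hε
  have hBU : B ⊆ U := fun x hx => (hb x hx).2
  have hinjB := hinj.mono hBU
  have hopen : ∀ s ⊆ B, IsOpen s → IsOpen (f '' s) := by
    refine (AnalyticOnNhd.is_constant_or_isOpen (fun x hx => hf.analyticAt (hU.mem_nhds (hBU hx)))
      (convex_ball z ε).isPreconnected).resolve_left ?_
    rintro ⟨c, hc⟩
    refine hne ?_
    filter_upwards [ball_mem_nhds z hε] with w hw
    rw [hc w hw, hc z hzB]
  set g := Function.invFunOn f B with hg
  have hgf : ∀ w ∈ B, g (f w) = w := fun w hw => hinjB.leftInvOn_invFunOn hw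
  have hfg : ∀ y ∈ f '' B, f (g y) = y := by
    rintro _ ⟨w, hw, rfl⟩
    rw [hgf w hw]
  have hV : IsOpen (f '' B) := hopen B subset_rfl isOpen_ball
  have hgc : ∀ w ∈ B, ContinuousAt g (f w) := by
    intro w hw s hs
    rw [hgf w hw] at hs
    obtain ⟨s', hs's, hs'o, hws'⟩ := _root_.mem_nhds_iff.1 (inter_mem hs (isOpen_ball.mem_nhds hw))
    have : f '' s' ∈ 𝓝 (f w) :=
      (hopen s' (fun x hx => (hs's hx).2) hs'o).mem_nhds ⟨w, hws', rfl⟩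
    refine mem_map.2 ?_
    filter_upwards [this]
    rintro _ ⟨x, hx, rfl⟩
    rw [mem_preimage, hgf x (hs's hx).2]
    exact (hs's hx).1
  have hgd : DifferentiableOn ℂ g (f '' B \ {f z}) := by
    rintro _ ⟨⟨w, hw, rfl⟩, hwz⟩
    have hwz' : w ≠ z := fun h => hwz (by simp [h])
    have hfd : HasDerivAt f (deriv f w) (g (f w)) := by
      rw [hgf w hw]
      exact (hf.differentiableAt (hU.mem_nhds (hBU hw))).hasDerivAt
    refine (HasDerivAt.of_local_left_inverse (hgc w hw) hfd ((hb w hw).1 hwz')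
      ?_).differentiableAt.differentiableWithinAt
    filter_upwards [hV.mem_nhds ⟨w, hw, rfl⟩] with y hy using hfg y hy
  have hgd' : DifferentiableOn ℂ g (f '' B) :=
    (Complex.differentiableOn_compl_singleton_and_continuousAt_iff
      (hV.mem_nhds ⟨z, hzB, rfl⟩)).1 ⟨hgd, hgc z hzB⟩
  have h1 : HasDerivAt g (deriv g (f z)) (f z) :=
    (hgd'.differentiableAt (hV.mem_nhds ⟨z, hzB, rfl⟩)).hasDerivAt
  have h2 : HasDerivAt f (deriv f z) z := (hf.differentiableAt (hU.mem_nhds hz)).hasDerivAt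
  have h3 := (h1.comp z h2).congr_of_eventuallyEq (f₁ := id) (by
    filter_upwards [isOpen_ball.mem_nhds hzB] with w hw
    exact (hgf w hw).symm)
  have h4 := h3.unique (hasDerivAt_id z)
  intro h0
  simp [h0] at h4

/-! ### Laurent series without constant term -/

/-- The Laurent series `∑ n ≥ 1, (p n * w ^ n + q n / w ^ n)`. -/
noncomputable def laurent (p q : ℕ+ → ℂ) (w : ℂ) : ℂ :=
  ∑' n : ℕ+, (p n * w ^ (n : ℕ) + q n / w ^ (n : ℕ))

/-- Absolute convergence on the circle of radius `r` of the Laurent series with coefficients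
`p`, `q`. -/
def LaurentSummable (p q : ℕ+ → ℂ) (r : ℝ) : Prop :=
  (Summable fun n : ℕ+ => ‖p n‖ * r ^ (n : ℕ)) ∧ Summable fun n : ℕ+ => ‖q n‖ / r ^ (n : ℕ)

theorem LaurentSummable.summable_norm {p q : ℕ+ → ℂ} {r : ℝ} (h : LaurentSummable p q r) {w : ℂ}
    (hw : ‖w‖ = r) : Summable fun n : ℕ+ => ‖p n * w ^ (n : ℕ) + q n / w ^ (n : ℕ)‖ := by
  refine Summable.of_nonneg_of_le (fun _ => norm_nonneg _) (fun n => ?_) (h.1.add h.2)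
  refine (norm_add_le _ _).trans (le_of_eq ?_)
  rw [norm_mul, norm_div, norm_pow, hw]

theorem LaurentSummable.hasSum {p q : ℕ+ → ℂ} {r : ℝ} (h : LaurentSummable p q r) {w : ℂ}
    (hw : ‖w‖ = r) :
    HasSum (fun n : ℕ+ => p n * w ^ (n : ℕ) + q n / w ^ (n : ℕ)) (laurent p q w) :=
  (h.summable_norm hw).of_norm.hasSum

theorem integral_exp_int_mul (j : ℤ) :
    ∫ θ in (0 : ℝ)..2 * Real.pi, Complex.exp (j * θ * Complex.I) =
      if j = 0 then 2 * (Real.pi : ℂ) else 0 := by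
  split_ifs with h
  · simp [h]
  · have hc : (j * Complex.I : ℂ) ≠ 0 := by simp [h]
    have := integral_exp_mul_complex (a := 0) (b := 2 * Real.pi) hc
    have e : ∀ θ : ℝ, Complex.exp (j * θ * Complex.I) = Complex.exp (j * Complex.I * θ) := by
      intro θ; congr 1; ring
    simp_rw [e]
    rw [this]
    have h1 : Complex.exp (j * Complex.I * ((2 * Real.pi : ℝ) : ℂ)) = 1 := by
      rw [← Complex.exp_int_mul_two_pi_mul_I j]
      congr 1; push_cast; ring
    rw [h1]; simp

theorem circleMap_zero_pow (r θ : ℝ) (n : ℕ) :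
    circleMap 0 r θ ^ n = r ^ n * Complex.exp (n * θ * Complex.I) := by
  rw [circleMap, zero_add, mul_pow, ← Complex.exp_nat_mul]
  congr 2; ring

theorem norm_exp_int_mul (j : ℤ) (θ : ℝ) : ‖Complex.exp (-(j * θ * Complex.I))‖ = 1 := by
  have := Complex.norm_exp_ofReal_mul_I (-(j * θ))
  rw [← this]; congr 2; push_cast; ring

theorem continuous_exp_int_mul (j : ℤ) :
    Continuous fun θ : ℝ => Complex.exp (-(j * θ * Complex.I)) := by fun_prop

theorem integral_laurent {p q : ℕ+ → ℂ} {r : ℝ} (hr : 0 < r) (h : LaurentSummable p q r) (j : ℤ) :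
    ∫ θ in (0 : ℝ)..2 * Real.pi,
        laurent p q (circleMap 0 r θ) * Complex.exp (-(j * θ * Complex.I)) =
      ∑' n : ℕ+, (p n * r ^ (n : ℕ) * (if (n : ℤ) - j = 0 then 2 * (Real.pi : ℂ) else 0) +
        q n / r ^ (n : ℕ) * (if -(n : ℤ) - j = 0 then 2 * (Real.pi : ℂ) else 0)) := by
  have hrc : (r : ℂ) ≠ 0 := by exact_mod_cast hr.ne'
  have hnorm : ∀ θ : ℝ, ‖circleMap 0 r θ‖ = r := fun θ => by
    rw [norm_circleMap_zero, abs_of_pos hr]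
  have hne : ∀ θ : ℝ, circleMap 0 r θ ≠ 0 := fun θ => by
    rw [← norm_pos_iff, hnorm]; exact hr
  have hs := intervalIntegral.hasSum_integral_of_dominated_convergence
    (μ := MeasureTheory.volume) (a := 0) (b := 2 * Real.pi)
    (F := fun (n : ℕ+) (θ : ℝ) => (p n * circleMap 0 r θ ^ (n : ℕ) +
      q n / circleMap 0 r θ ^ (n : ℕ)) * Complex.exp (-(j * θ * Complex.I)))
    (f := fun θ : ℝ => laurent p q (circleMap 0 r θ) * Complex.exp (-(j * θ * Complex.I)))
    (fun n _ => ‖p n‖ * r ^ (n : ℕ) + ‖q n‖ / r ^ (n : ℕ))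
    (fun n => Continuous.aestronglyMeasurable (by
      have := continuous_circleMap 0 r
      have h1 := continuous_exp_int_mul j
      exact ((continuous_const.mul (this.pow _)).add
        (continuous_const.div (this.pow _) fun θ => pow_ne_zero _ (hne θ))).mul h1))
    (fun n => Eventually.of_forall fun θ _ => by
      rw [norm_mul, norm_exp_int_mul, mul_one]
      refine (norm_add_le _ _).trans (le_of_eq ?_)
      rw [norm_mul, norm_div, norm_pow, hnorm])
    (Eventually.of_forall fun θ _ => h.1.add h.2)
    (by simp)
    (Eventually.of_forall fun θ _ => (h.hasSum (hnorm θ)).mul_right _)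
  rw [← hs.tsum_eq]
  refine tsum_congr fun n => ?_
  have e : ∀ θ : ℝ, (p n * circleMap 0 r θ ^ (n : ℕ) +
      q n / circleMap 0 r θ ^ (n : ℕ)) * Complex.exp (-(j * θ * Complex.I)) =
      p n * r ^ (n : ℕ) * Complex.exp (((n : ℤ) - j : ℤ) * θ * Complex.I) +
      q n / r ^ (n : ℕ) * Complex.exp ((-(n : ℤ) - j : ℤ) * θ * Complex.I) := by
    intro θ
    have e1 : Complex.exp (((n : ℤ) - j : ℤ) * θ * Complex.I) =
        Complex.exp (n * θ * Complex.I) * Complex.exp (-(j * θ * Complex.I)) := by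
      rw [← Complex.exp_add]; congr 1; push_cast; ring
    have e2 : Complex.exp ((-(n : ℤ) - j : ℤ) * θ * Complex.I) =
        Complex.exp (-(j * θ * Complex.I)) / Complex.exp (n * θ * Complex.I) := by
      rw [← Complex.exp_sub]; congr 1; push_cast; ring
    rw [circleMap_zero_pow, e1, e2]
    ring
  simp_rw [e]
  have c1 : ∀ j : ℤ, Continuous fun θ : ℝ => Complex.exp (j * θ * Complex.I) := by
    intro j; fun_prop
  rw [intervalIntegral.integral_add, intervalIntegral.integral_const_mul,
    intervalIntegral.integral_const_mul, integral_exp_int_mul, integral_exp_int_mul]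
  · exact (continuous_const.mul (c1 _)).intervalIntegrable _ _
  · exact (continuous_const.mul (c1 _)).intervalIntegrable _ _

theorem integral_laurent_pos {p q : ℕ+ → ℂ} {r : ℝ} (hr : 0 < r) (h : LaurentSummable p q r)
    (k : ℕ+) :
    ∫ θ in (0 : ℝ)..2 * Real.pi,
        laurent p q (circleMap 0 r θ) * Complex.exp (-((k : ℤ) * θ * Complex.I)) =
      2 * Real.pi * (p k * r ^ (k : ℕ)) := by
  rw [integral_laurent hr h, tsum_eq_single k]
  · have : ¬ (-(k : ℤ) - (k : ℤ) = 0) := by have := k.pos; omega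
    rw [if_pos (sub_self _), if_neg this]; ring
  · intro n hn
    have h1 : ¬ ((n : ℤ) - (k : ℤ) = 0) := fun h => hn (by
      rw [← PNat.coe_inj]; omega)
    have h2 : ¬ (-(n : ℤ) - (k : ℤ) = 0) := by have := k.pos; omega
    rw [if_neg h1, if_neg h2]; ring

theorem integral_laurent_neg {p q : ℕ+ → ℂ} {r : ℝ} (hr : 0 < r) (h : LaurentSummable p q r)
    (k : ℕ+) :
    ∫ θ in (0 : ℝ)..2 * Real.pi,
        laurent p q (circleMap 0 r θ) * Complex.exp (-((-k : ℤ) * θ * Complex.I)) =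
      2 * Real.pi * (q k / r ^ (k : ℕ)) := by
  have := integral_laurent hr h (-(k : ℤ))
  push_cast at this ⊢
  rw [this, tsum_eq_single k]
  · have : ¬ ((k : ℤ) - -(k : ℤ) = 0) := by have := k.pos; omega
    rw [if_neg this, if_pos (by ring)]; ring
  · intro n hn
    have h1 : ¬ (-(n : ℤ) - -(k : ℤ) = 0) := fun h => hn (by
      rw [← PNat.coe_inj]; omega)
    have h2 : ¬ ((n : ℤ) - -(k : ℤ) = 0) := by have := k.pos; omega
    rw [if_neg h1, if_neg h2]; ring

theorem integral_laurent_zero {p q : ℕ+ → ℂ} {r : ℝ} (hr : 0 < r) (h : LaurentSummable p q r) :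
    ∫ θ in (0 : ℝ)..2 * Real.pi, laurent p q (circleMap 0 r θ) = 0 := by
  have := integral_laurent hr h 0
  simp only [Int.cast_zero, zero_mul, neg_zero, Complex.exp_zero, mul_one] at this
  rw [this]
  refine (tsum_congr fun n => ?_).trans tsum_zero
  have h1 : ¬ ((n : ℤ) - 0 = 0) := by have := n.pos; omega
  have h2 : ¬ (-(n : ℤ) - 0 = 0) := by have := n.pos; omega
  rw [if_neg h1, if_neg h2]; ring

/-! ### Faber polynomials as Taylor coefficients -/

/-- The exterior map `Ψ`, with Laurent coefficients `a` on `{|w| > γ}`, is holomorphic and injective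
on the larger region `{|w| > r₀}`. -/
structure IsConformalBeyond (Ψ : ℂ → ℂ) (a : ℕ → ℂ) (r₀ γ : ℝ) : Prop where
  pos : 0 < r₀
  lt : r₀ < γ
  diff : DifferentiableOn ℂ Ψ {w | r₀ < ‖w‖}
  inj : InjOn Ψ {w | r₀ < ‖w‖}
  expansion : ∀ w : ℂ, γ < ‖w‖ → HasSum (fun n : ℕ => a n / w ^ n) (Ψ w - w)

/-- The function `t ↦ t * Ψ (1 / t)`, extended by its limit `1` to `t = 0`. -/
noncomputable def invSeries (Ψ : ℂ → ℂ) (t : ℂ) : ℂ := if t = 0 then 1 else t * Ψ t⁻¹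

/-- The Taylor coefficients `1, a 0, a 1, …` of `invSeries Ψ`. -/
def invCoeff (a : ℕ → ℂ) : ℕ → ℂ
  | 0 => 1
  | n + 1 => a n

/-- The function `Ψ'(w)` of `t = 1 / w`, written through `invSeries Ψ`. -/
noncomputable def derivSeries (Ψ : ℂ → ℂ) (t : ℂ) : ℂ :=
  invSeries Ψ t - t * deriv (invSeries Ψ) t

theorem invSeries_zero (Ψ : ℂ → ℂ) : invSeries Ψ 0 = 1 := by simp [invSeries]

theorem invSeries_of_ne {Ψ : ℂ → ℂ} {t : ℂ} (ht : t ≠ 0) : invSeries Ψ t = t * Ψ t⁻¹ := by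
  simp [invSeries, ht]

theorem eval_shiftCoeff (a : ℕ → ℂ) (z : ℂ) (n : ℕ) :
    (shiftCoeff a n).eval z = invCoeff a n - if n = 1 then z else 0 := by
  match n with
  | 0 => simp [shiftCoeff, invCoeff]
  | 1 => simp [shiftCoeff, invCoeff]
  | n + 2 => simp [shiftCoeff, invCoeff]

theorem eval_derivCoeff (a : ℕ → ℂ) (z : ℂ) (n : ℕ) :
    (derivCoeff a n).eval z = (1 - n) * invCoeff a n := by
  match n with
  | 0 => simp [derivCoeff, invCoeff]
  | n + 1 => simp [derivCoeff, invCoeff]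

namespace IsConformalBeyond

variable {Ψ : ℂ → ℂ} {a : ℕ → ℂ} {r₀ γ : ℝ}

theorem isOpen_exterior (r : ℝ) : IsOpen {w : ℂ | r < ‖w‖} :=
  isOpen_lt continuous_const continuous_norm

theorem lt_norm_inv (h : IsConformalBeyond Ψ a r₀ γ) {t : ℂ} (h0 : t ≠ 0) (ht : ‖t‖ < r₀⁻¹) :
    r₀ < ‖t⁻¹‖ := by
  rw [norm_inv]
  exact (lt_inv_comm₀ h.pos (norm_pos_iff.2 h0)).2 ht

theorem differentiableAt (h : IsConformalBeyond Ψ a r₀ γ) {w : ℂ} (hw : r₀ < ‖w‖) :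
    DifferentiableAt ℂ Ψ w :=
  h.diff.differentiableAt ((isOpen_exterior r₀).mem_nhds hw)

theorem hasSum_invSeries (h : IsConformalBeyond Ψ a r₀ γ) {t : ℂ} (ht : ‖t‖ < γ⁻¹) :
    HasSum (fun n => invCoeff a n * t ^ n) (invSeries Ψ t) := by
  have hγ : 0 < γ := h.pos.trans h.lt
  rcases eq_or_ne t 0 with rfl | h0
  · rw [invSeries_zero]
    convert hasSum_single (f := fun n => invCoeff a n * (0 : ℂ) ^ n) 0 ?_ using 1
    · simp [invCoeff]
    · intro n hn
      simp [hn]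
  · have h1 := (h.expansion t⁻¹ (by
      rw [norm_inv]; exact (lt_inv_comm₀ hγ (norm_pos_iff.2 h0)).2 ht)).mul_left t
    rw [← hasSum_nat_add_iff' 1]
    have e : invSeries Ψ t - ∑ i ∈ Finset.range 1, invCoeff a i * t ^ i = t * (Ψ t⁻¹ - t⁻¹) := by
      rw [invSeries_of_ne h0]
      simp [invCoeff]
      field_simp
    rw [e]
    refine h1.congr_fun fun n => ?_
    simp only [invCoeff, inv_pow, div_inv_eq_mul]
    ring

theorem differentiableOn_invSeries (h : IsConformalBeyond Ψ a r₀ γ) :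
    DifferentiableOn ℂ (invSeries Ψ) (ball 0 r₀⁻¹) := by
  intro t ht
  rw [mem_ball_zero_iff] at ht
  refine DifferentiableAt.differentiableWithinAt ?_
  rcases eq_or_ne t 0 with rfl | h0
  · exact (hasFPowerSeriesOnBall_of_hasSum (inv_pos.2 (h.pos.trans h.lt))
      fun t ht => h.hasSum_invSeries ht).analyticAt.differentiableAt
  · have h1 : DifferentiableAt ℂ (fun t => t * Ψ t⁻¹) t :=
      differentiableAt_id.mul ((h.differentiableAt (h.lt_norm_inv h0 ht)).comp t
        (differentiableAt_inv h0))
    refine h1.congr_of_eventuallyEq ?_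
    filter_upwards [isOpen_ne.mem_nhds h0] with s hs using invSeries_of_ne hs

theorem taylorCoeff_invSeries (h : IsConformalBeyond Ψ a r₀ γ) (n : ℕ) :
    taylorCoeff (invSeries Ψ) n = invCoeff a n :=
  (eq_taylorCoeff_of_hasSum (inv_pos.2 (h.pos.trans h.lt))
    (fun _ ht => h.hasSum_invSeries ht) n).symm

theorem differentiableOn_derivSeries (h : IsConformalBeyond Ψ a r₀ γ) :
    DifferentiableOn ℂ (derivSeries Ψ) (ball 0 r₀⁻¹) :=
  h.differentiableOn_invSeries.sub
    (differentiableOn_id.mul (h.differentiableOn_invSeries.deriv isOpen_ball))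

theorem derivSeries_of_ne (h : IsConformalBeyond Ψ a r₀ γ) {t : ℂ} (h0 : t ≠ 0)
    (ht : ‖t‖ < r₀⁻¹) : derivSeries Ψ t = deriv Ψ t⁻¹ := by
  have h1 : HasDerivAt (fun t => t * Ψ t⁻¹) (1 * Ψ t⁻¹ + t * (deriv Ψ t⁻¹ * (-(t ^ 2)⁻¹))) t :=
    (hasDerivAt_id t).mul
      ((h.differentiableAt (h.lt_norm_inv h0 ht)).hasDerivAt.comp t (hasDerivAt_inv h0))
  have h2 : deriv (invSeries Ψ) t = 1 * Ψ t⁻¹ + t * (deriv Ψ t⁻¹ * (-(t ^ 2)⁻¹)) := by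
    refine (h1.congr_of_eventuallyEq ?_).deriv
    filter_upwards [isOpen_ne.mem_nhds h0] with s hs using invSeries_of_ne hs
  rw [derivSeries, h2, invSeries_of_ne h0]
  field_simp
  ring

theorem hasSum_derivSeries (h : IsConformalBeyond Ψ a r₀ γ) {t : ℂ} (ht : ‖t‖ < r₀⁻¹) :
    HasSum (fun n : ℕ => (1 - n) * invCoeff a n * t ^ n) (derivSeries Ψ t) := by
  have h1 := hasSum_taylorCoeff h.differentiableOn_invSeries ht
  have h2 := (hasSum_taylorCoeff (h.differentiableOn_invSeries.deriv isOpen_ball) ht).mul_left t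
  have h3 : HasSum (fun n : ℕ => (n : ℂ) * invCoeff a n * t ^ n)
      (t * deriv (invSeries Ψ) t) := by
    rw [← hasSum_nat_add_iff' 1]
    simp only [Finset.range_one, Finset.sum_singleton, CharP.cast_eq_zero, zero_mul, sub_zero]
    refine h2.congr_fun fun n => ?_
    rw [taylorCoeff_deriv, h.taylorCoeff_invSeries]
    push_cast
    ring
  refine (h1.sub h3).congr_fun fun n => ?_
  rw [h.taylorCoeff_invSeries]
  ring

/-- The generating function of the Faber polynomials, cleared of denominators: it determines their
values as Taylor coefficients. -/
theorem taylorCoeff_eq_faber (h : IsConformalBeyond Ψ a r₀ γ) {Q : ℂ → ℂ} {z : ℂ} {ε : ℝ}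
    (hε : 0 < ε) (hQ : DifferentiableOn ℂ Q (ball 0 ε))
    (hQS : ∀ t, ‖t‖ < ε → Q t * (invSeries Ψ t - z * t) = derivSeries Ψ t) (m : ℕ) :
    taylorCoeff Q m = (faber a m).eval z := by
  have hγ : 0 < γ := h.pos.trans h.lt
  set φ := PowerSeries.map (Polynomial.evalRingHom z) with hφ
  set q : PowerSeries ℂ := PowerSeries.mk (taylorCoeff Q) with hq
  have hprod : q * φ (PowerSeries.mk (shiftCoeff a)) = φ (PowerSeries.mk (derivCoeff a)) := by
    have hε' : 0 < min ε γ⁻¹ := lt_min hε (inv_pos.2 hγ)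
    have hr : γ⁻¹ < r₀⁻¹ := inv_strictAnti₀ h.pos h.lt
    have e1 := eq_taylorCoeff_of_hasSum (f := derivSeries Ψ) hε'
      (b := fun n => PowerSeries.coeff n (q * φ (PowerSeries.mk (shiftCoeff a)))) (by
        intro t ht
        have ht1 : ‖t‖ < ε := ht.trans_le (min_le_left _ _)
        have ht2 : ‖t‖ < γ⁻¹ := ht.trans_le (min_le_right _ _)
        have s1 := hasSum_taylorCoeff hQ ht1
        have s2 : HasSum (fun n => (invCoeff a n - if n = 1 then z else 0) * t ^ n)
            (invSeries Ψ t - z * t) := by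
          have := (h.hasSum_invSeries ht2).sub (hasSum_ite_eq 1 (z * t))
          refine this.congr_fun fun n => ?_
          rw [sub_mul]
          split_ifs with hn
          · simp [hn]
          · simp
        have s3 := summable_norm_sum_mul_antidiagonal_of_summable_norm s1.summable.norm
          s2.summable.norm
        have s4 := tsum_mul_tsum_eq_tsum_sum_antidiagonal_of_summable_norm s1.summable.norm
          s2.summable.norm
        rw [s1.tsum_eq, s2.tsum_eq, hQS t ht1] at s4
        rw [s4]
        refine s3.of_norm.hasSum.congr_fun fun n => ?_
        rw [PowerSeries.coeff_mul, Finset.sum_mul]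
        refine Finset.sum_congr rfl fun x hx => ?_
        have hx' : x.1 + x.2 = n := by simpa using hx
        rw [hq, PowerSeries.coeff_mk, hφ, PowerSeries.coeff_map, PowerSeries.coeff_mk,
          Polynomial.coe_evalRingHom, eval_shiftCoeff, ← hx']
        ring)
    have e2 := eq_taylorCoeff_of_hasSum (f := derivSeries Ψ) hε'
      (b := fun n => (1 - n) * invCoeff a n)
      (fun t ht => h.hasSum_derivSeries ((ht.trans_le (min_le_right _ _)).trans hr))
    ext n
    rw [e1 n, ← e2 n, hφ, PowerSeries.coeff_map, PowerSeries.coeff_mk, Polynomial.coe_evalRingHom,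
      eval_derivCoeff]
  have hinv : PowerSeries.mk (shiftCoeff a) *
      PowerSeries.invOfUnit (PowerSeries.mk (shiftCoeff a)) 1 = 1 := by
    apply PowerSeries.mul_invOfUnit
    simp [← PowerSeries.coeff_zero_eq_constantCoeff_apply, shiftCoeff]
  have hmain : q = φ (PowerSeries.mk (derivCoeff a) *
      PowerSeries.invOfUnit (PowerSeries.mk (shiftCoeff a)) 1) := by
    rw [map_mul, ← hprod, mul_assoc, ← map_mul, hinv, map_one, mul_one]
  have := congrArg (PowerSeries.coeff m) hmain
  rwa [hq, PowerSeries.coeff_mk, hφ, PowerSeries.coeff_map, Polynomial.coe_evalRingHom] at this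

/-- The denominator `(Ψ(w) - z) / w` has no zeros in the region where `Ψ` omits the value `z`. -/
theorem invSeries_sub_ne_zero {z t : ℂ} (hz : t ≠ 0 → Ψ t⁻¹ ≠ z) :
    invSeries Ψ t - z * t ≠ 0 := by
  rcases eq_or_ne t 0 with rfl | h0
  · simp [invSeries_zero]
  · rw [invSeries_of_ne h0, mul_comm z, ← mul_sub]
    exact mul_ne_zero h0 (sub_ne_zero.2 (hz h0))

theorem invSeries_sub_apply_ne_zero (h : IsConformalBeyond Ψ a r₀ γ) {v t : ℂ} (hv : r₀ < ‖v‖)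
    (ht : ‖t‖ < r₀⁻¹) (hvt : v * t ≠ 1) : invSeries Ψ t - Ψ v * t ≠ 0 := by
  refine invSeries_sub_ne_zero fun h0 he => hvt ?_
  rw [← h.inj (h.lt_norm_inv h0 ht) hv he, inv_mul_cancel₀ h0]

end IsConformalBeyond

/-! ### Faber polynomials on the boundary curves and the Grunsky coefficients -/

namespace IsConformalBeyond

variable {Ψ : ℂ → ℂ} {a : ℕ → ℂ} {r₀ γ : ℝ}

/-- Cauchy's estimate on the circle `|t| = 1 / ρ₂`, inside which the generating function at
`z = Ψ v`, `|v| = ρ₁`, has no pole. -/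
theorem exists_norm_faber_le (h : IsConformalBeyond Ψ a r₀ γ) {ρ₁ ρ₂ : ℝ} (h1 : r₀ < ρ₁)
    (h2 : ρ₁ < ρ₂) :
    ∃ K : ℝ, 0 ≤ K ∧ ∀ v : ℂ, ‖v‖ = ρ₁ → ∀ m, ‖(faber a m).eval (Ψ v)‖ ≤ K * ρ₂ ^ m := by
  have hρ1 : 0 < ρ₁ := h.pos.trans h1
  have hρ2 : 0 < ρ₂ := hρ1.trans h2
  have hi1 : ρ₁⁻¹ < r₀⁻¹ := inv_strictAnti₀ h.pos h1
  have hi2 : ρ₂⁻¹ < ρ₁⁻¹ := inv_strictAnti₀ hρ1 h2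
  have hne : ∀ v t : ℂ, ‖v‖ = ρ₁ → ‖t‖ < ρ₁⁻¹ → invSeries Ψ t - Ψ v * t ≠ 0 := by
    intro v t hv ht
    refine h.invSeries_sub_apply_ne_zero (hv ▸ h1) (ht.trans hi1) fun he => ?_
    have := congrArg norm he
    rw [norm_mul, hv, norm_one] at this
    have h3 : ρ₁ * ‖t‖ < ρ₁ * ρ₁⁻¹ := by gcongr
    rw [mul_inv_cancel₀ hρ1.ne'] at h3
    linarith
  have hcont : ContinuousOn (fun x : ℂ × ℂ => derivSeries Ψ x.1 / (invSeries Ψ x.1 - Ψ x.2 * x.1))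
      (sphere 0 ρ₂⁻¹ ×ˢ sphere 0 ρ₁) := by
    have m1 : MapsTo Prod.fst (sphere (0 : ℂ) ρ₂⁻¹ ×ˢ sphere (0 : ℂ) ρ₁) (ball 0 r₀⁻¹) := by
      rintro ⟨t, v⟩ ⟨ht, hv⟩
      simp only [mem_sphere_iff_norm, sub_zero] at ht
      simpa [ht] using hi2.trans hi1
    have m2 : MapsTo Prod.snd (sphere (0 : ℂ) ρ₂⁻¹ ×ˢ sphere (0 : ℂ) ρ₁) {w : ℂ | r₀ < ‖w‖} := by
      rintro ⟨t, v⟩ ⟨ht, hv⟩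
      simp only [mem_sphere_iff_norm, sub_zero] at hv
      simpa [hv] using h1
    refine ContinuousOn.div
      (h.differentiableOn_derivSeries.continuousOn.comp continuousOn_fst m1)
      ((h.differentiableOn_invSeries.continuousOn.comp continuousOn_fst m1).sub
        ((h.diff.continuousOn.comp continuousOn_snd m2).mul continuousOn_fst)) ?_
    rintro ⟨t, v⟩ ⟨ht, hv⟩
    simp only [mem_sphere_iff_norm, sub_zero] at ht hv
    exact hne v t hv (ht ▸ hi2)
  obtain ⟨K, hK⟩ := ((isCompact_sphere (0 : ℂ) ρ₂⁻¹).prod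
    (isCompact_sphere (0 : ℂ) ρ₁)).exists_bound_of_continuousOn hcont
  refine ⟨max K 0, le_max_right _ _, fun v hv m => ?_⟩
  have hQ : DifferentiableOn ℂ (fun t => derivSeries Ψ t / (invSeries Ψ t - Ψ v * t))
      (ball 0 ρ₁⁻¹) := by
    have hsub : ball (0 : ℂ) ρ₁⁻¹ ⊆ ball 0 r₀⁻¹ := ball_subset_ball hi1.le
    refine (h.differentiableOn_derivSeries.mono hsub).div
      ((h.differentiableOn_invSeries.mono hsub).sub (differentiableOn_id.const_mul _)) ?_
    intro t ht
    exact hne v t hv (by simpa using ht)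
  rw [← h.taylorCoeff_eq_faber (inv_pos.2 hρ1) hQ
    (fun t ht => div_mul_cancel₀ _ (hne v t hv ht)) m]
  refine (norm_taylorCoeff_le hQ (inv_pos.2 hρ2) hi2 (B := max K 0) ?_ m).trans (le_of_eq ?_)
  · intro t ht
    exact (hK (t, v) ⟨by simpa using ht, by simpa using hv⟩).trans (le_max_left _ _)
  · rw [inv_pow, div_inv_eq_mul]

/-- Subtracting the pole of the generating function at `w = v` leaves a function that is holomorphic
in `|w| > r₀`, so that `F_m(Ψ(v)) - v ^ m` can be estimated on a circle `|w| = R` with `R < |v|`. -/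
theorem norm_faber_sub_pow_le (h : IsConformalBeyond Ψ a r₀ γ) {R B : ℝ} (hR : r₀ < R) {τ : ℂ}
    (h0 : τ ≠ 0) (hτ : ‖τ‖ < R⁻¹)
    (hB : ∀ t : ℂ, ‖t‖ = R⁻¹ →
      ‖derivSeries Ψ t / (invSeries Ψ t - Ψ τ⁻¹ * t) - (1 - τ⁻¹ * t)⁻¹‖ ≤ B) (m : ℕ) :
    ‖(faber a m).eval (Ψ τ⁻¹) - τ⁻¹ ^ m‖ ≤ B * R ^ m := by
  have hRi : R⁻¹ < r₀⁻¹ := inv_strictAnti₀ h.pos hR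
  have hτU : τ ∈ ball (0 : ℂ) r₀⁻¹ := by simpa using hτ.trans hRi
  have hUo : IsOpen (ball (0 : ℂ) r₀⁻¹) := isOpen_ball
  set N := derivSeries Ψ with hN
  set S := invSeries Ψ with hS
  set f : ℂ → ℂ := fun t => τ * S t - S τ * t with hf
  have hSτ : S τ = τ * Ψ τ⁻¹ := invSeries_of_ne h0
  have hff : ∀ t, f t = τ * (S t - Ψ τ⁻¹ * t) := fun t => by simp only [hf, hSτ]; ring
  have hτr : r₀ < ‖τ⁻¹‖ := h.lt_norm_inv h0 (hτ.trans hRi)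
  have hne : ∀ t ∈ ball (0 : ℂ) r₀⁻¹, t ≠ τ → S t - Ψ τ⁻¹ * t ≠ 0 := by
    intro t ht htτ
    refine h.invSeries_sub_apply_ne_zero hτr (by simpa using ht) fun he => htτ ?_
    field_simp at he
    exact he
  have hfd : DifferentiableOn ℂ f (ball 0 r₀⁻¹) :=
    (h.differentiableOn_invSeries.const_mul _).sub (differentiableOn_id.const_mul _)
  have hfτ : f τ = 0 := by simp only [hf]; ring
  have hf' : deriv f τ = - N τ := by
    have hd := (h.differentiableOn_invSeries.differentiableAt (hUo.mem_nhds hτU)).hasDerivAt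
    have : HasDerivAt f (τ * deriv S τ - S τ * 1) τ :=
      (hd.const_mul τ).sub ((hasDerivAt_id τ).const_mul (S τ))
    rw [this.deriv, hN, derivSeries]
    ring
  have hNτ : N τ ≠ 0 := by
    rw [hN, h.derivSeries_of_ne h0 (hτ.trans hRi)]
    exact deriv_ne_zero_of_injOn (isOpen_exterior r₀) h.diff h.inj hτr
  set D := dslope f τ with hD
  have hDd : DifferentiableOn ℂ D (ball 0 r₀⁻¹) :=
    (Complex.differentiableOn_dslope (hUo.mem_nhds hτU)).2 hfd
  have hDτ : D τ = - N τ := by rw [hD, dslope_same, hf']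
  have hDt : ∀ t, t ≠ τ → D t = f t / (t - τ) := by
    intro t ht
    rw [hD, dslope_of_ne _ ht, slope_def_field, hfτ, sub_zero]
  have hDne : ∀ t ∈ ball (0 : ℂ) r₀⁻¹, D t ≠ 0 := by
    intro t ht
    rcases eq_or_ne t τ with rfl | htτ
    · rw [hDτ]; exact neg_ne_zero.2 hNτ
    · rw [hDt t htτ, hff]
      exact div_ne_zero (mul_ne_zero h0 (hne t ht htτ)) (sub_ne_zero.2 htτ)
  set g : ℂ → ℂ := fun t => τ * dslope (fun t => N t / D t) τ t with hg
  have hgd : DifferentiableOn ℂ g (ball 0 r₀⁻¹) :=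
    ((Complex.differentiableOn_dslope (hUo.mem_nhds hτU)).2
      (h.differentiableOn_derivSeries.div hDd hDne)).const_mul _
  have hgt : ∀ t ∈ ball (0 : ℂ) r₀⁻¹, t ≠ τ →
      g t = N t / (S t - Ψ τ⁻¹ * t) - (1 - τ⁻¹ * t)⁻¹ := by
    intro t ht htτ
    have e0 := hne t ht htτ
    have e1 : t - τ ≠ 0 := sub_ne_zero.2 htτ
    have e2 : τ - t ≠ 0 := sub_ne_zero.2 htτ.symm
    have e3 : (1 - τ⁻¹ * t)⁻¹ = τ / (τ - t) := by field_simp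
    have e4 : N τ / D τ = -1 := by rw [hDτ, div_neg, div_self hNτ]
    have e5 : N t / D t = N t * (t - τ) / (τ * (S t - Ψ τ⁻¹ * t)) := by
      rw [hDt t htτ, hff, div_div_eq_mul_div]
    simp only [hg]
    rw [dslope_of_ne _ htτ, slope_def_field, e4, e5, e3]
    have e6 : τ / (τ - t) = - (τ / (t - τ)) := by rw [← neg_sub t τ, div_neg]
    rw [e6]
    generalize S t - Ψ τ⁻¹ * t = x at e0
    field_simp
  have hτpos : 0 < ‖τ‖ := norm_pos_iff.2 h0
  have hsub : ball (0 : ℂ) ‖τ‖ ⊆ ball 0 r₀⁻¹ := ball_subset_ball (hτ.trans hRi).le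
  have hneτ : ∀ t : ℂ, ‖t‖ < ‖τ‖ → t ≠ τ := by rintro t ht rfl; exact lt_irrefl _ ht
  have hQd : DifferentiableOn ℂ (fun t => N t / (S t - Ψ τ⁻¹ * t)) (ball 0 ‖τ‖) := by
    refine (h.differentiableOn_derivSeries.mono hsub).div
      ((h.differentiableOn_invSeries.mono hsub).sub (differentiableOn_id.const_mul _)) ?_
    intro t ht
    exact hne t (hsub ht) (hneτ t (by simpa using ht))
  have hcoef : (faber a m).eval (Ψ τ⁻¹) - τ⁻¹ ^ m = taylorCoeff g m := by
    rw [← h.taylorCoeff_eq_faber hτpos hQd (fun t ht => div_mul_cancel₀ _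
      (hne t (hsub (by simpa using ht)) (hneτ t ht))) m]
    refine eq_taylorCoeff_of_hasSum hτpos (b := fun m => taylorCoeff
      (fun t => N t / (S t - Ψ τ⁻¹ * t)) m - τ⁻¹ ^ m) (fun t ht => ?_) m
    rw [hgt t (hsub (by simpa using ht)) (hneτ t ht)]
    have hgeo : ‖τ⁻¹ * t‖ < 1 := by
      rw [norm_mul, norm_inv, inv_mul_lt_iff₀ hτpos, mul_one]; exact ht
    refine ((hasSum_taylorCoeff hQd ht).sub (hasSum_geometric_of_norm_lt_one hgeo)).congr_fun
      fun n => ?_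
    rw [mul_pow]; ring
  have hRpos : 0 < R := h.pos.trans hR
  rw [hcoef]
  refine (norm_taylorCoeff_le hgd (inv_pos.2 hRpos) hRi (B := B) ?_ m).trans (le_of_eq ?_)
  · intro t ht
    rw [hgt t (by simpa [ht] using hRi) (by rintro rfl; exact hτ.ne ht)]
    exact hB t ht
  · rw [inv_pow, div_inv_eq_mul]

/-- `F_m(Ψ(w)) - w ^ m` tends to `0` as `w → ∞`: on a fixed circle `|t| = 1 / γ` the generating
function without its pole at `t = τ = 1 / w` tends uniformly to `0` as `τ → 0`. -/
theorem tendsto_faber_sub_pow (h : IsConformalBeyond Ψ a r₀ γ) (m : ℕ) :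
    Tendsto (fun τ : ℂ => (faber a m).eval (Ψ τ⁻¹) - τ⁻¹ ^ m) (𝓝[≠] 0) (𝓝 0) := by
  have hγ : 0 < γ := h.pos.trans h.lt
  have hγi : γ⁻¹ < r₀⁻¹ := inv_strictAnti₀ h.pos h.lt
  have hsub : sphere (0 : ℂ) γ⁻¹ ⊆ ball 0 r₀⁻¹ := fun t ht => by
    simp only [mem_sphere_iff_norm, sub_zero] at ht
    simpa [ht] using hγi
  obtain ⟨C₁, hC₁⟩ := (isCompact_sphere (0 : ℂ) γ⁻¹).exists_bound_of_continuousOn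
    (h.differentiableOn_derivSeries.continuousOn.mono hsub)
  obtain ⟨C₂, hC₂⟩ := (isCompact_sphere (0 : ℂ) γ⁻¹).exists_bound_of_continuousOn
    (h.differentiableOn_invSeries.continuousOn.mono hsub)
  have hScont : ContinuousAt (invSeries Ψ) 0 :=
    (h.differentiableOn_invSeries.differentiableAt
      (isOpen_ball.mem_nhds (by simpa using h.pos))).continuousAt
  set d₁ : ℂ → ℝ := fun τ => ‖invSeries Ψ τ‖ * γ⁻¹ - ‖τ‖ * C₂ with hd₁
  set d₂ : ℂ → ℝ := fun τ => γ⁻¹ - ‖τ‖ with hd₂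
  have hd₁c : ContinuousAt d₁ 0 :=
    (hScont.norm.mul continuousAt_const).sub (continuous_norm.continuousAt.mul continuousAt_const)
  have hd₂c : ContinuousAt d₂ 0 := continuousAt_const.sub continuous_norm.continuousAt
  have hd₁0 : d₁ 0 = γ⁻¹ := by simp [hd₁, invSeries_zero]
  have hd₂0 : d₂ 0 = γ⁻¹ := by simp [hd₂]
  have hγi0 : 0 < γ⁻¹ := inv_pos.2 hγ
  have hBt : Tendsto (fun τ : ℂ => (C₁ * ‖τ‖ / d₁ τ + ‖τ‖ / d₂ τ) * γ ^ m) (𝓝 0) (𝓝 0) := by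
    have : ContinuousAt (fun τ : ℂ => (C₁ * ‖τ‖ / d₁ τ + ‖τ‖ / d₂ τ) * γ ^ m) 0 := by
      have hn : ContinuousAt (fun τ : ℂ => ‖τ‖) 0 := continuous_norm.continuousAt
      refine ((((continuousAt_const.mul hn).div hd₁c ?_)).add (hn.div hd₂c ?_)).mul
        continuousAt_const
      · rw [hd₁0]; exact hγi0.ne'
      · rw [hd₂0]; exact hγi0.ne'
    simpa [ContinuousAt] using this
  refine squeeze_zero_norm' ?_ (hBt.mono_left nhdsWithin_le_nhds)
  have ev₁ : ∀ᶠ τ in 𝓝 (0 : ℂ), 0 < d₁ τ := hd₁c.eventually (lt_mem_nhds (by rwa [hd₁0]))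
  have ev₂ : ∀ᶠ τ in 𝓝 (0 : ℂ), 0 < d₂ τ := hd₂c.eventually (lt_mem_nhds (by rwa [hd₂0]))
  filter_upwards [ev₁.filter_mono nhdsWithin_le_nhds, ev₂.filter_mono nhdsWithin_le_nhds,
    self_mem_nhdsWithin] with τ h₁ h₂ h0
  have h0 : τ ≠ 0 := h0
  refine h.norm_faber_sub_pow_le h.lt h0 (by simpa [hd₂] using h₂) (fun t ht => ?_) m
  have hS : invSeries Ψ τ = τ * Ψ τ⁻¹ := invSeries_of_ne h0
  have e1 : derivSeries Ψ t / (invSeries Ψ t - Ψ τ⁻¹ * t) =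
      derivSeries Ψ t * τ / (τ * invSeries Ψ t - invSeries Ψ τ * t) := by
    have : τ * invSeries Ψ t - invSeries Ψ τ * t = (invSeries Ψ t - Ψ τ⁻¹ * t) * τ := by
      rw [hS]; ring
    rw [this, mul_div_mul_right _ _ h0]
  have e2 : (1 - τ⁻¹ * t)⁻¹ = τ / (τ - t) := by field_simp
  rw [e1, e2]
  refine (norm_sub_le _ _).trans (add_le_add ?_ ?_)
  · rw [norm_div, norm_mul]
    have hst : t ∈ sphere (0 : ℂ) γ⁻¹ := by simpa using ht
    have l1 : d₁ τ ≤ ‖τ * invSeries Ψ t - invSeries Ψ τ * t‖ := by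
      have := norm_sub_norm_le (invSeries Ψ τ * t) (τ * invSeries Ψ t)
      rw [norm_mul, norm_mul, ht, norm_sub_rev] at this
      have h3 : ‖τ‖ * ‖invSeries Ψ t‖ ≤ ‖τ‖ * C₂ := by gcongr; exact hC₂ t hst
      simp only [hd₁]
      linarith
    have hC1 : 0 ≤ C₁ := (norm_nonneg _).trans (hC₁ t hst)
    gcongr
    exact hC₁ t hst
  · rw [norm_div]
    have l2 : d₂ τ ≤ ‖τ - t‖ := by
      have := norm_sub_norm_le t τ
      rw [ht, norm_sub_rev] at this
      exact this
    gcongr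

/-- The Laurent expansion `F_m(Ψ(w)) = w ^ m + ∑ n ≥ 1, c_{mn} w ^ (-n)` holds in all of
`|w| > r₀`. Since `r₀ < γ`, the Grunsky coefficients decay geometrically in comparison with
`γ ^ (m + n)`. -/
theorem exists_grunsky_bound (h : IsConformalBeyond Ψ a r₀ γ) :
    ∃ ρ K : ℝ, r₀ < ρ ∧ ρ < γ ∧ 0 ≤ K ∧
      (∀ m n : ℕ+, ‖grunsky γ Ψ a m n‖ ≤ K * ρ ^ (m : ℕ) * ρ ^ (n : ℕ)) ∧
      ∀ (m : ℕ+) (v : ℂ), r₀ < ‖v‖ →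
        HasSum (fun n : ℕ+ => grunsky γ Ψ a m n / v ^ (n : ℕ))
          ((faber a m).eval (Ψ v) - v ^ (m : ℕ)) := by
  have hγ : 0 < γ := h.pos.trans h.lt
  obtain ⟨ρ₁, h1, h1'⟩ := exists_between h.lt
  obtain ⟨ρ₂, h2, h2'⟩ := exists_between h1'
  have hρ1 : 0 < ρ₁ := h.pos.trans h1
  have hρ2 : 0 < ρ₂ := hρ1.trans h2
  obtain ⟨K, hK0, hK⟩ := h.exists_norm_faber_le h1 h2
  -- `k m` is `F_m ∘ Ψ - w ^ m` as a function of `τ = 1 / w`; its Taylor coefficients at the origin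
  -- are the Grunsky coefficients
  set k : ℕ → ℂ → ℂ := fun m τ => if τ = 0 then 0 else (faber a m).eval (Ψ τ⁻¹) - τ⁻¹ ^ m with hk
  have hk0 : ∀ m τ, τ ≠ 0 → k m τ = (faber a m).eval (Ψ τ⁻¹) - τ⁻¹ ^ m := by
    intro m τ hτ; simp [hk, hτ]
  have hkd : ∀ m, DifferentiableOn ℂ (k m) (ball 0 r₀⁻¹) := by
    intro m
    refine (Complex.differentiableOn_compl_singleton_and_continuousAt_iff
      (isOpen_ball.mem_nhds (by simpa using h.pos : (0 : ℂ) ∈ ball (0 : ℂ) r₀⁻¹))).1 ⟨?_, ?_⟩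
    · rintro τ ⟨hτ, hτ0⟩
      have hτ0 : τ ≠ 0 := hτ0
      have hd : DifferentiableAt ℂ (fun τ : ℂ => (faber a m).eval (Ψ τ⁻¹) - τ⁻¹ ^ m) τ := by
        have hi : DifferentiableAt ℂ (fun τ : ℂ => τ⁻¹) τ := differentiableAt_inv hτ0
        have hΨ : DifferentiableAt ℂ (fun τ : ℂ => Ψ τ⁻¹) τ :=
          (h.differentiableAt (h.lt_norm_inv hτ0 (by simpa using hτ))).comp τ hi
        exact (((faber a m).differentiable _).comp τ hΨ).sub (hi.pow m)
      refine (hd.congr_of_eventuallyEq ?_).differentiableWithinAt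
      filter_upwards [isOpen_ne.mem_nhds hτ0] with s hs using hk0 m s hs
    · rw [continuousAt_iff_punctured_nhds]
      have : k m 0 = 0 := by simp [hk]
      rw [this]
      refine (h.tendsto_faber_sub_pow m).congr' ?_
      filter_upwards [self_mem_nhdsWithin] with τ hτ using (hk0 m τ hτ).symm
  have hkz : ∀ m, taylorCoeff (k m) 0 = 0 := by
    intro m
    simp [taylorCoeff, hk]
  have hsum : ∀ (m : ℕ) (v : ℂ), r₀ < ‖v‖ →
      HasSum (fun n : ℕ+ => taylorCoeff (k m) n / v ^ (n : ℕ))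
        ((faber a m).eval (Ψ v) - v ^ m) := by
    intro m v hv
    have hv0 : v ≠ 0 := norm_pos_iff.1 (h.pos.trans hv)
    have hvi : ‖v⁻¹‖ < r₀⁻¹ := by rw [norm_inv]; exact inv_strictAnti₀ h.pos hv
    have := hasSum_taylorCoeff (hkd m) hvi
    rw [hk0 m _ (inv_ne_zero hv0), inv_inv, ← PNat.coe_injective.hasSum_iff] at this
    · refine this.congr_fun fun n => ?_
      simp only [Function.comp, inv_pow, div_eq_mul_inv]
    · intro n hn
      have : n = 0 := by
        by_contra h0
        exact hn ⟨⟨n, Nat.pos_of_ne_zero h0⟩, rfl⟩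
      rw [this, hkz, zero_mul]
  have hbound : ∀ m n : ℕ+, ‖taylorCoeff (k m) n‖ ≤ (K + 1) * ρ₂ ^ (m : ℕ) * ρ₁ ^ (n : ℕ) := by
    intro m n
    refine (norm_taylorCoeff_le (hkd m) (inv_pos.2 hρ1) (inv_strictAnti₀ h.pos h1)
      (B := (K + 1) * ρ₂ ^ (m : ℕ)) ?_ n).trans (le_of_eq ?_)
    · intro t ht
      have ht0 : t ≠ 0 := by
        rw [← norm_pos_iff, ht]; exact inv_pos.2 hρ1
      have hti : ‖t⁻¹‖ = ρ₁ := by rw [norm_inv, ht, inv_inv]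
      rw [hk0 m t ht0, add_mul, one_mul]
      refine (norm_sub_le _ _).trans (add_le_add (hK _ hti m) ?_)
      rw [norm_pow, hti]
      gcongr
    · rw [inv_pow, div_inv_eq_mul]
  have hgr : ∀ m n : ℕ+, grunsky γ Ψ a m n = taylorCoeff (k m) n := by
    intro m n
    have hγc : (γ : ℂ) ≠ 0 := by exact_mod_cast hγ.ne'
    have hls : LaurentSummable (Pi.single m 1) (fun n => taylorCoeff (k m) n) γ := by
      constructor
      · refine summable_of_ne_finset_zero (s := {m}) fun i hi => ?_
        rw [Pi.single_eq_of_ne (by simpa using hi)]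
        simp
      · have := (hsum m (γ : ℂ) (by simpa [abs_of_pos hγ] using h.lt)).summable.norm
        simpa [abs_of_pos hγ] using this
    have hl : ∀ w : ℂ, ‖w‖ = γ →
        laurent (Pi.single m 1) (fun n => taylorCoeff (k m) n) w = (faber a m).eval (Ψ w) := by
      intro w hw
      have s1 := hsum m w (by rw [hw]; exact h.lt)
      have s2 : HasSum (fun n : ℕ+ => (Pi.single m 1 : ℕ+ → ℂ) n * w ^ (n : ℕ)) (w ^ (m : ℕ)) := by
        convert hasSum_ite_eq m (w ^ (m : ℕ)) using 1
        funext i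
        by_cases hi : i = m
        · subst hi; simp
        · simp [hi]
      rw [laurent, (s2.add s1).tsum_eq]
      ring
    have key := integral_laurent_neg hγ hls n
    rw [grunsky, circleIntegral]
    have e : ∀ θ : ℝ, deriv (circleMap 0 γ) θ • (circleMap 0 γ θ ^ ((n : ℕ) - 1) *
        (faber a m).eval (Ψ (circleMap 0 γ θ))) = (Complex.I * γ ^ (n : ℕ)) *
        (laurent (Pi.single m 1) (fun n => taylorCoeff (k m) n) (circleMap 0 γ θ) *
          Complex.exp (-((-n : ℤ) * θ * Complex.I))) := by
      intro θ
      have hw : ‖circleMap 0 γ θ‖ = γ := by rw [norm_circleMap_zero, abs_of_pos hγ]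
      rw [hl _ hw, deriv_circleMap, smul_eq_mul]
      have e1 : circleMap 0 γ θ * circleMap 0 γ θ ^ ((n : ℕ) - 1) =
          γ ^ (n : ℕ) * Complex.exp (-((-n : ℤ) * θ * Complex.I)) := by
        rw [← pow_succ', Nat.sub_add_cancel n.pos, circleMap_zero_pow]
        push_cast
        congr 2
        ring
      linear_combination (Complex.I * (faber a m).eval (Ψ (circleMap 0 γ θ))) * e1
    simp_rw [e]
    rw [intervalIntegral.integral_const_mul, key]
    have hpi : (Real.pi : ℂ) ≠ 0 := by exact_mod_cast Real.pi_ne_zero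
    have hI := Complex.I_ne_zero
    field_simp
  refine ⟨ρ₂, K + 1, h1.trans h2, h2', by linarith, fun m n => ?_, fun m v hv => ?_⟩
  · rw [hgr]
    refine (hbound m n).trans ?_
    gcongr
  · simp_rw [hgr]
    exact hsum m v hv

end IsConformalBeyond

theorem IsExteriorMap.exists_isConformalBeyond {D : Set ℂ} {Ψ : ℂ → ℂ} {a : ℕ → ℂ} {γ : ℝ}
    (hD : IsExteriorMap D γ Ψ a) : ∃ r₀, IsConformalBeyond Ψ a r₀ γ := by
  obtain ⟨δ, hδ, hd, hi⟩ := hD.conformal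
  have hsub : {w : ℂ | max (γ - δ) (γ / 2) < ‖w‖} ⊆ {w | γ - δ < ‖w‖} :=
    fun w hw => by
    rw [mem_ofPred_eq] at hw ⊢
    exact (le_max_left _ _).trans_lt hw
  have := hD.radius_pos
  exact ⟨max (γ - δ) (γ / 2), lt_max_of_lt_right (by linarith), max_lt (by linarith) (by linarith),
    hd.mono hsub, hi.mono hsub, hD.expansion⟩

/-! ### Semi-infinite matrices as operators on `ℓ²` -/

/-- The Hilbert space `ℓ²` of sequences indexed by the positive integers. -/
noncomputable abbrev EllTwo := lp (fun _ : ℕ+ => ℂ) 2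

/-- The `n`-th vector of the standard basis of `ℓ²`. -/
noncomputable abbrev basisVec (n : ℕ+) : EllTwo := lp.single 2 n (1 : ℂ)

open scoped InnerProductSpace in
theorem inner_basisVec_left (n : ℕ+) (x : EllTwo) : ⟪basisVec n, x⟫_ℂ = x n := by
  rw [lp.inner_single_left]; simp

open scoped InnerProductSpace in
theorem inner_basisVec_right (n : ℕ+) (x : EllTwo) :
    ⟪x, basisVec n⟫_ℂ = (starRingEnd ℂ) (x n) := by
  rw [lp.inner_single_right]; simp

theorem ext_of_basisVec {S T : EllTwo →L[ℂ] EllTwo}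
    (h : ∀ m n, S (basisVec n) m = T (basisVec n) m) : S = T := by
  refine lp.ext_continuousLinearMap (by simp) fun n => ?_
  ext1
  ext m
  exact h m n

/-- The action `y ↦ y T` on row vectors of the matrix of the operator `T`. -/
noncomputable def rowAct (T : EllTwo →L[ℂ] EllTwo) (y : EllTwo) : EllTwo :=
  star (ContinuousLinearMap.adjoint T (star y))

open scoped InnerProductSpace in
theorem hasSum_rowAct (T : EllTwo →L[ℂ] EllTwo) (y : EllTwo) (n : ℕ+) :
    HasSum (fun k => y k * T (basisVec n) k) (rowAct T y n) := by
  have h1 : rowAct T y n = ⟪star y, T (basisVec n)⟫_ℂ := by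
    rw [← ContinuousLinearMap.adjoint_inner_left, inner_basisVec_right, rowAct, lp.star_apply]
    rfl
  rw [h1]
  refine (lp.hasSum_inner (𝕜 := ℂ) (star y) (T (basisVec n))).congr_fun fun k => ?_
  simp [lp.star_apply, mul_comm]

open scoped InnerProductSpace in
theorem hasSum_mul_apply (S T : EllTwo →L[ℂ] EllTwo) (m n : ℕ+) :
    HasSum (fun k => S (basisVec k) m * T (basisVec n) k) ((S * T) (basisVec n) m) := by
  have h1 : (S * T) (basisVec n) m =
      ⟪ContinuousLinearMap.adjoint S (basisVec m), T (basisVec n)⟫_ℂ := by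
    rw [ContinuousLinearMap.adjoint_inner_left, inner_basisVec_left]; rfl
  rw [h1]
  refine (lp.hasSum_inner (𝕜 := ℂ) _ (T (basisVec n))).congr_fun fun k => ?_
  have h2 : ContinuousLinearMap.adjoint S (basisVec m) k = (starRingEnd ℂ) (S (basisVec k) m) := by
    rw [← inner_basisVec_left, ContinuousLinearMap.adjoint_inner_right, inner_basisVec_right]
  simp [h2, mul_comm]

theorem rowAct_mul (S T : EllTwo →L[ℂ] EllTwo) (y : EllTwo) :
    rowAct (S * T) y = rowAct T (rowAct S y) := by
  rw [rowAct, ContinuousLinearMap.mul_def, ContinuousLinearMap.adjoint_comp, rowAct, rowAct,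
    star_star]
  rfl

theorem rowAct_one (y : EllTwo) : rowAct 1 y = y := by
  have : ContinuousLinearMap.adjoint (1 : EllTwo →L[ℂ] EllTwo) = 1 := star_one _
  rw [rowAct, this, one_apply_eq_self, star_star]

theorem rowAct_one_sub (T : EllTwo →L[ℂ] EllTwo) (y : EllTwo) :
    rowAct (1 - T) y = y - rowAct T y := by
  have : ContinuousLinearMap.adjoint (1 : EllTwo →L[ℂ] EllTwo) = 1 := star_one _
  rw [rowAct, map_sub, this, sub_apply, one_apply_eq_self,
    star_sub, star_star, rowAct]

theorem rowAct_add (T : EllTwo →L[ℂ] EllTwo) (x y : EllTwo) :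
    rowAct T (x + y) = rowAct T x + rowAct T y := by
  simp only [rowAct, star_add, map_add]

theorem rowAct_smul (T : EllTwo →L[ℂ] EllTwo) (c : ℂ) (y : EllTwo) :
    rowAct T (c • y) = c • rowAct T y := by
  simp only [rowAct, star_smul, map_smul, star_star]

theorem rowAct_neg (T : EllTwo →L[ℂ] EllTwo) (y : EllTwo) : rowAct T (-y) = -rowAct T y := by
  simp only [rowAct, star_neg, map_neg]

theorem rowAct_zero (T : EllTwo →L[ℂ] EllTwo) : rowAct T 0 = 0 := by
  simp only [rowAct, star_zero, map_zero]

/-- The matrices of `S` and `T` are entrywise complex conjugates of each other. -/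
def IsConjOf (S T : EllTwo →L[ℂ] EllTwo) : Prop :=
  ∀ m n, T (basisVec n) m = (starRingEnd ℂ) (S (basisVec n) m)

theorem IsConjOf.rowAct_star {S T : EllTwo →L[ℂ] EllTwo} (h : IsConjOf S T) (y : EllTwo) :
    rowAct T (star y) = star (rowAct S y) := by
  ext n
  rw [lp.star_apply]
  refine (hasSum_rowAct T (star y) n).unique ?_
  refine ((hasSum_rowAct S y n).star).congr_fun fun k => ?_
  rw [h, lp.star_apply, star_mul']
  rfl

theorem IsConjOf.star_rowAct {S T : EllTwo →L[ℂ] EllTwo} (h : IsConjOf S T) (y : EllTwo) :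
    rowAct S (star y) = star (rowAct T y) := by
  rw [← star_star y, h.rowAct_star, star_star, star_star]

open InnerProductSpace in
/-- A matrix with absolutely summable entries is the matrix of a compact operator. -/
theorem exists_compact_of_summable {B : ℕ+ → ℕ+ → ℂ}
    (hB : Summable fun p : ℕ+ × ℕ+ => ‖B p.1 p.2‖) :
    ∃ T : EllTwo →L[ℂ] EllTwo, IsCompactOperator T ∧ ∀ m n, T (basisVec n) m = B m n := by
  set E : ℕ+ × ℕ+ → EllTwo →L[ℂ] EllTwo := fun p =>
    B p.1 p.2 • rankOne ℂ (basisVec p.1) (basisVec p.2) with hE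
  have hn : ∀ n : ℕ+, ‖basisVec n‖ = 1 := fun n => by
    rw [lp.norm_single (by simp)]; simp
  have hs : Summable E := by
    refine Summable.of_norm ?_
    simpa [hE, norm_smul, hn] using hB
  have hcE : ∀ p, IsCompactOperator (E p) := by
    intro p
    have h1 : IsCompactOperator (innerSL ℂ (basisVec p.2)) :=
      isCompactOperator_of_locallyCompactSpace_dom _
    exact (h1.clm_comp (ContinuousLinearMap.toSpanSingleton ℂ (basisVec p.1))).smul (B p.1 p.2)
  refine ⟨∑' p, E p, ?_, fun m n => ?_⟩
  · refine isCompactOperator_of_tendsto hs.hasSum (Eventually.of_forall fun s => ?_)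
    have : (∑ p ∈ s, E p) ∈ compactOperator (RingHom.id ℂ) EllTwo EllTwo :=
      Submodule.sum_mem _ fun p _ => hcE p
    exact this
  · have h1 := hs.hasSum.mapL (ContinuousLinearMap.apply ℂ EllTwo (basisVec n))
    have h2 := h1.mapL (innerSL ℂ (basisVec m))
    simp only [ContinuousLinearMap.apply_apply, innerSL_apply_apply, inner_basisVec_left] at h2
    refine h2.unique ?_
    convert hasSum_single (m, n) ?_ using 1
    · simp [hE]
    · rintro ⟨i, j⟩ hij
      simp only [hE, smul_apply, rankOne_apply, inner_basisVec_left,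
        lp.coeFn_smul, Pi.smul_apply, lp.coeFn_single]
      by_cases hj : n = j
      · have hi : m ≠ i := by rintro rfl; exact hij (by rw [hj])
        simp [hi]
      · simp [Ne.symm hj]

/-- The inhomogeneous equation `y - ȳ K̄ = -κ σ̄` and its conjugate combine to
`y (1 - K K̄) = -κ (σ̄ + σ K̄)`. Conversely the defect `e` of the first equation satisfies
`e = -ē K̄`, hence `e (1 - K K̄) = 0`. -/
theorem sub_rowAct_eq_zero_iff {K K' T : EllTwo →L[ℂ] EllTwo} (hK : IsConjOf K K')
    (h1 : (1 - K * K') * T = 1) (h2 : T * (1 - K * K') = 1) (y σ : EllTwo) (κ : ℝ) :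
    y - rowAct K' (star y) + (κ : ℂ) • star σ = 0 ↔
      y = -((κ : ℂ) • rowAct T (star σ + rowAct K' σ)) := by
  have hL : ∀ x, rowAct T (x - rowAct K' (rowAct K x)) = x := fun x => by
    rw [← rowAct_mul, ← rowAct_one_sub, ← rowAct_mul, h1, rowAct_one]
  have hL' : ∀ x, rowAct T x - rowAct K' (rowAct K (rowAct T x)) = x := fun x => by
    rw [← rowAct_mul K K', ← rowAct_one_sub, ← rowAct_mul, h2, rowAct_one]
  have hκ : star (κ : ℂ) = κ := Complex.conj_ofReal κ
  constructor
  · intro h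
    have e1 : y = rowAct K' (star y) - (κ : ℂ) • star σ := by
      rw [← sub_eq_zero, ← h]; abel
    have e2 : star y = rowAct K y - (κ : ℂ) • σ := by
      conv_lhs => rw [e1]
      rw [star_sub, star_smul, star_star, hκ, ← hK.star_rowAct, star_star]
    have e3 : y - rowAct K' (rowAct K y) = -((κ : ℂ) • (star σ + rowAct K' σ)) := by
      have : rowAct K' (star y) = rowAct K' (rowAct K y) - (κ : ℂ) • rowAct K' σ := by
        rw [e2, sub_eq_add_neg, rowAct_add, rowAct_neg, rowAct_smul, ← sub_eq_add_neg]
      rw [this] at e1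
      rw [smul_add]
      nth_rewrite 1 [e1]
      abel
    rw [← rowAct_smul, ← rowAct_neg, ← e3, hL]
  · intro h
    have e3 : y - rowAct K' (rowAct K y) = -((κ : ℂ) • (star σ + rowAct K' σ)) := by
      rw [h, ← rowAct_smul, ← rowAct_neg, hL']
    set e := y - rowAct K' (star y) + (κ : ℂ) • star σ with he
    have e4 : star e = star y - rowAct K y + (κ : ℂ) • σ := by
      rw [he, star_add, star_sub, star_smul, star_star, hκ, ← hK.star_rowAct, star_star]
    have e5 : e = -rowAct K' (star e) := by
      rw [e4, sub_eq_add_neg, rowAct_add, rowAct_add, rowAct_neg, rowAct_smul, he]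
      have : y = rowAct K' (rowAct K y) - (κ : ℂ) • star σ - (κ : ℂ) • rowAct K' σ := by
        rw [sub_eq_iff_eq_add] at e3
        rw [smul_add] at e3
        nth_rewrite 1 [e3]
        abel
      nth_rewrite 1 [this]
      abel
    have e6 : star e = -rowAct K e := by
      conv_lhs => rw [e5]
      rw [star_neg, ← hK.star_rowAct, star_star]
    have e7 : e - rowAct K' (rowAct K e) = 0 := by
      rw [sub_eq_zero]
      conv_lhs => rw [e5, e6, rowAct_neg, neg_neg]
    rw [← hL e, e7, rowAct_zero]

/-- The Fredholm alternative for `1 - K K̄`. An element `y` of its left kernel, with `z = y K`,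
gives the two solutions `y + z̄` and `i (y - z̄)` of `v K = v̄`. -/
theorem isUnit_one_sub_mul {K K' : EllTwo →L[ℂ] EllTwo} (hK : IsConjOf K K')
    (hc : IsCompactOperator (ContinuousLinearMap.adjoint (K * K')))
    (hinj : ∀ v : EllTwo, rowAct K v = star v → v = 0) : IsUnit (1 - K * K') := by
  set A := ContinuousLinearMap.adjoint (K * K') with hA
  have hA1 : IsUnit (1 - A) := by
    have hmem : (1 : ℂ) ∉ spectrum ℂ A := by
      rw [← hc.hasEigenvalue_iff_mem_spectrum one_ne_zero]
      intro hev
      obtain ⟨x, hx⟩ := hev.exists_hasEigenvector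
      have hx1 : A x = x := by simpa using hx.apply_eq_smul
      refine hx.2 ?_
      obtain ⟨y, hy⟩ : ∃ y, y = star x := ⟨_, rfl⟩
      have hy1 : rowAct K' (rowAct K y) = y := by
        rw [← rowAct_mul, rowAct, hy, star_star, ← hA, hx1]
      obtain ⟨z, hz⟩ : ∃ z, z = rowAct K y := ⟨_, rfl⟩
      have hz1 : rowAct K (star z) = star y := by rw [hK.star_rowAct, hz, hy1]
      have s1 : y + star z = 0 := hinj _ (by
        rw [rowAct_add, ← hz, hz1, star_add, star_star, add_comm])
      have s2 : Complex.I • (y - star z) = 0 := hinj _ (by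
        have hI : star Complex.I = -Complex.I := Complex.conj_I
        rw [rowAct_smul, sub_eq_add_neg, rowAct_add, rowAct_neg, ← hz, hz1, star_smul, star_add,
          star_neg, star_star, hI, neg_smul, ← smul_neg]
        congr 1
        abel)
      have s3 : y - star z = 0 := (smul_eq_zero.1 s2).resolve_left Complex.I_ne_zero
      have s4 : (2 : ℂ) • y = 0 := by
        have : (2 : ℂ) • y = (y + star z) + (y - star z) := by rw [two_smul]; abel
        rw [this, s1, s3, add_zero]
      have s5 : y = 0 := (smul_eq_zero.1 s4).resolve_left two_ne_zero
      rw [hy, star_eq_zero] at s5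
      exact s5
    have := spectrum.notMem_iff.1 hmem
    rwa [map_one] at this
  have h2 : star (1 - A) = 1 - K * K' := by
    rw [star_sub, star_one, hA]
    congr 1
    exact ContinuousLinearMap.adjoint_adjoint _
  rw [← h2]
  exact hA1.star

/-! ### Normalized matrices -/

/-- The matrix `A`, normalized as `γ ^ 𝒩 A γ ^ (-𝒩)`, is the matrix of the operator `T`. -/
def Represents (γ : ℝ) (T : EllTwo →L[ℂ] EllTwo) (A : Matrix ℕ+ ℕ+ ℂ) : Prop :=
  ∀ m n : ℕ+, T (basisVec n) m = (γ : ℂ) ^ (m : ℕ) * A m n / (γ : ℂ) ^ (n : ℕ)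

section Represents

variable {γ : ℝ} {S T : EllTwo →L[ℂ] EllTwo} {A B : Matrix ℕ+ ℕ+ ℂ}

theorem Represents.apply_eq (hγ : 0 < γ) (h : Represents γ T A) (m n : ℕ+) :
    A m n = T (basisVec n) m * (γ : ℂ) ^ (n : ℕ) / (γ : ℂ) ^ (m : ℕ) := by
  have hc : (γ : ℂ) ≠ 0 := by exact_mod_cast hγ.ne'
  rw [h m n]
  field_simp

theorem exists_represents (hγ : 0 < γ) (T : EllTwo →L[ℂ] EllTwo) : ∃ A, Represents γ T A := by
  have hc : (γ : ℂ) ≠ 0 := by exact_mod_cast hγ.ne'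
  refine ⟨fun m n => T (basisVec n) m * (γ : ℂ) ^ (n : ℕ) / (γ : ℂ) ^ (m : ℕ), fun m n => ?_⟩
  field_simp

theorem represents_one (hγ : 0 < γ) : Represents γ 1 1 := by
  have hc : (γ : ℂ) ≠ 0 := by exact_mod_cast hγ.ne'
  intro m n
  by_cases hmn : m = n
  · subst hmn; simp [hc]
  · simp [hmn]

theorem Represents.sub (h : Represents γ S A) (h' : Represents γ T B) :
    Represents γ (S - T) (A - B) := by
  intro m n
  rw [sub_apply, lp.coeFn_sub, Pi.sub_apply, h, h', Matrix.sub_apply]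
  ring

theorem Represents.hasSum_mul (hγ : 0 < γ) (h : Represents γ S A) (h' : Represents γ T B)
    (m n : ℕ+) : HasSum (fun k => A m k * B k n)
      ((S * T) (basisVec n) m * (γ : ℂ) ^ (n : ℕ) / (γ : ℂ) ^ (m : ℕ)) := by
  have hc : (γ : ℂ) ≠ 0 := by exact_mod_cast hγ.ne'
  refine (((hasSum_mul_apply S T m n).mul_right ((γ : ℂ) ^ (n : ℕ))).div_const
    ((γ : ℂ) ^ (m : ℕ))).congr_fun fun k => ?_
  rw [h.apply_eq hγ, h'.apply_eq hγ]
  field_simp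

theorem Represents.mulSummable (hγ : 0 < γ) (h : Represents γ S A) (h' : Represents γ T B) :
    MulSummable A B := fun m n => (h.hasSum_mul hγ h' m n).summable

theorem Represents.mul (hγ : 0 < γ) (h : Represents γ S A) (h' : Represents γ T B) :
    Represents γ (S * T) (A ⊙ B) := by
  have hc : (γ : ℂ) ≠ 0 := by exact_mod_cast hγ.ne'
  intro m n
  rw [infMul, (h.hasSum_mul hγ h' m n).tsum_eq]
  field_simp

theorem Represents.eq_op (h : Represents γ S A) (h' : Represents γ T A) : S = T :=
  ext_of_basisVec fun m n => by rw [h, h']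

theorem Represents.eq_mat (hγ : 0 < γ) (h : Represents γ T A) (h' : Represents γ T B) : A = B := by
  ext m n
  rw [h.apply_eq hγ, h'.apply_eq hγ]

theorem IsInfInverse.exists_op (hγ : 0 < γ) (hS : Represents γ S A) (h : IsInfInverse γ A B) :
    ∃ T, Represents γ T B ∧ S * T = 1 ∧ T * S = 1 := by
  obtain ⟨T, hT⟩ := h.bounded_inv
  have hT : Represents γ T B := hT
  have h1 := hS.mul hγ hT
  have h2 := hT.mul hγ hS
  rw [h.mul_inv] at h1
  rw [h.inv_mul] at h2
  exact ⟨T, hT, h1.eq_op (represents_one hγ), h2.eq_op (represents_one hγ)⟩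

theorem existsUnique_isInfInverse (hγ : 0 < γ) (hS : Represents γ S A) (hu : IsUnit S) :
    ∃! M, IsInfInverse γ A M := by
  obtain ⟨T, hST, hTS⟩ := isUnit_iff_exists.1 hu
  obtain ⟨M, hM⟩ := exists_represents hγ T
  refine ⟨M, ⟨⟨S, hS⟩, ⟨T, hM⟩, ?_, ?_⟩, ?_⟩
  · have := hS.mul hγ hM
    rw [hST] at this
    exact this.eq_mat hγ (represents_one hγ)
  · have := hM.mul hγ hS
    rw [hTS] at this
    exact this.eq_mat hγ (represents_one hγ)
  · intro M' hM'
    obtain ⟨T', hT', h1, h2⟩ := hM'.exists_op hγ hS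
    have : T' = T := by
      calc T' = T' * (S * T) := by rw [hST, mul_one]
        _ = T := by rw [← mul_assoc, h2, one_mul]
    rw [this] at hT'
    exact hT'.eq_mat hγ hM

end Represents

/-! ### Termwise differentiation of Laurent series -/

theorem isOpen_annulus (a b : ℝ) : IsOpen {w : ℂ | a < ‖w‖ ∧ ‖w‖ < b} :=
  (isOpen_lt continuous_const continuous_norm).inter (isOpen_lt continuous_norm continuous_const)

theorem exists_nat_mul_pow_le {x : ℝ} (h0 : 0 ≤ x) (h1 : x < 1) :
    ∃ C : ℝ, ∀ n : ℕ, n * x ^ n ≤ C := by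
  obtain ⟨C, hC⟩ := (tendsto_self_mul_const_pow_of_lt_one h0 h1).bddAbove_range
  exact ⟨C, fun n => hC ⟨n, rfl⟩⟩

/-- Absolute convergence for the coefficients of `w G'(w)`, when
`G` is the Laurent series with coefficients `p`, `q`. -/
theorem LaurentSummable.nat_mul {p q : ℕ+ → ℂ} {a b r : ℝ} (ha : 0 < a)
    (h : ∀ r ∈ Ioo a b, LaurentSummable p q r) (hr : r ∈ Ioo a b) :
    LaurentSummable (fun n => (n : ℂ) * p n) (fun n => -((n : ℂ) * q n)) r := by
  obtain ⟨r₁, h1, h1'⟩ := exists_between hr.1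
  obtain ⟨r₂, h2, h2'⟩ := exists_between hr.2
  have hr1 : 0 < r₁ := ha.trans h1
  have hr0 : 0 < r := hr1.trans h1'
  have hr2 : 0 < r₂ := hr0.trans h2
  constructor
  · obtain ⟨C, hC⟩ := exists_nat_mul_pow_le (x := r / r₂) (by positivity) ((div_lt_one hr2).2 h2)
    refine Summable.of_nonneg_of_le (fun n => by positivity) (fun n => ?_)
      ((h r₂ ⟨hr.1.trans h2, h2'⟩).1.mul_left C)
    have e : ‖(n : ℂ) * p n‖ * r ^ (n : ℕ) =
        ((n : ℕ) * (r / r₂) ^ (n : ℕ)) * (‖p n‖ * r₂ ^ (n : ℕ)) := by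
      rw [norm_mul, Complex.norm_natCast, div_pow]
      field_simp
    rw [e]
    exact mul_le_mul_of_nonneg_right (hC n) (by positivity)
  · obtain ⟨C, hC⟩ := exists_nat_mul_pow_le (x := r₁ / r) (by positivity) ((div_lt_one hr0).2 h1')
    refine Summable.of_nonneg_of_le (fun n => by positivity) (fun n => ?_)
      ((h r₁ ⟨h1, h1'.trans hr.2⟩).2.mul_left C)
    have e : ‖-((n : ℂ) * q n)‖ / r ^ (n : ℕ) =
        ((n : ℕ) * (r₁ / r) ^ (n : ℕ)) * (‖q n‖ / r₁ ^ (n : ℕ)) := by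
      rw [norm_neg, norm_mul, Complex.norm_natCast, div_pow]
      field_simp
    rw [e]
    exact mul_le_mul_of_nonneg_right (hC n) (by positivity)

theorem hasDerivAt_laurent {p q : ℕ+ → ℂ} {a b : ℝ} (ha : 0 < a)
    (h : ∀ r ∈ Ioo a b, LaurentSummable p q r) {w : ℂ} (hw : ‖w‖ ∈ Ioo a b) :
    HasDerivAt (laurent p q)
      (laurent (fun n => (n : ℂ) * p n) (fun n => -((n : ℂ) * q n)) w / w) w := by
  obtain ⟨r₁, h1, h1'⟩ := exists_between hw.1
  obtain ⟨r₂, h2, h2'⟩ := exists_between hw.2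
  have hr1 : 0 < r₁ := ha.trans h1
  set U := {w : ℂ | r₁ < ‖w‖ ∧ ‖w‖ < r₂} with hU
  have hUo : IsOpen U := isOpen_annulus r₁ r₂
  have hwU : w ∈ U := ⟨h1', h2⟩
  have hne : ∀ z ∈ U, z ≠ 0 := fun z hz => norm_pos_iff.1 (hr1.trans hz.1)
  have hw0 := hne w hwU
  have hsum : Summable fun n : ℕ+ => ‖p n‖ * r₂ ^ (n : ℕ) + ‖q n‖ / r₁ ^ (n : ℕ) :=
    (h r₂ ⟨hw.1.trans h2, h2'⟩).1.add (h r₁ ⟨h1, h1'.trans hw.2⟩).2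
  have hle : ∀ (n : ℕ+) (z : ℂ), z ∈ U → ‖p n * z ^ (n : ℕ) + q n / z ^ (n : ℕ)‖ ≤
      ‖p n‖ * r₂ ^ (n : ℕ) + ‖q n‖ / r₁ ^ (n : ℕ) := by
    intro n z hz
    refine (norm_add_le _ _).trans ?_
    rw [norm_mul, norm_div, norm_pow]
    have := hz.1.le
    have := hz.2.le
    gcongr
  have hterm : ∀ (n : ℕ+) (z : ℂ), z ∈ U → HasDerivAt
      (fun z => p n * z ^ (n : ℕ) + q n / z ^ (n : ℕ))
      (((n : ℂ) * p n * z ^ (n : ℕ) + -((n : ℂ) * q n) / z ^ (n : ℕ)) / z) z := by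
    intro n z hz
    have hz0 := hne z hz
    have d1 := (hasDerivAt_pow (n : ℕ) z).const_mul (p n)
    have d2 := ((hasDerivAt_pow (n : ℕ) z).inv (pow_ne_zero _ hz0)).const_mul (q n)
    refine (d1.add d2).congr_deriv ?_
    have e : z ^ (n : ℕ) = z ^ ((n : ℕ) - 1) * z := by
      rw [← pow_succ, Nat.sub_add_cancel n.pos]
    rw [e]
    field_simp
  have hd : ∀ n : ℕ+, DifferentiableOn ℂ (fun z => p n * z ^ (n : ℕ) + q n / z ^ (n : ℕ)) U :=
    fun n z hz => (hterm n z hz).differentiableAt.differentiableWithinAt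
  have hD : DifferentiableAt ℂ (laurent p q) w :=
    (Complex.differentiableOn_tsum_of_summable_norm hsum hd hUo hle).differentiableAt
      (hUo.mem_nhds hwU)
  have hs := Complex.hasSum_deriv_of_summable_norm hsum hd hUo hle hwU
  have hs' := ((LaurentSummable.nat_mul ha h hw).hasSum rfl).div_const w
  have : deriv (laurent p q) w =
      laurent (fun n => (n : ℂ) * p n) (fun n => -((n : ℂ) * q n)) w / w := by
    refine hs.unique (hs'.congr_fun fun n => ?_)
    exact (hterm n w hwU).deriv
  rw [← this]
  exact hD.hasDerivAt

/-! ### Fourier coefficients on circles -/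

/-- The `j`-th Fourier coefficient, without the factor `1 / (2 π)`, of the real function `h` on the
circle of radius `r`. -/
noncomputable def moment (h : ℂ → ℝ) (r : ℝ) (j : ℤ) : ℂ :=
  ∫ θ in (0 : ℝ)..2 * Real.pi, (h (circleMap 0 r θ) : ℂ) * Complex.exp (-(j * θ * Complex.I))

theorem norm_circleMap_zero_of_pos {r : ℝ} (hr : 0 < r) (θ : ℝ) : ‖circleMap 0 r θ‖ = r := by
  rw [norm_circleMap_zero, abs_of_pos hr]

theorem moment_congr {h h' : ℂ → ℝ} {r : ℝ} (hr : 0 < r) (hh : ∀ w, ‖w‖ = r → h w = h' w) (j : ℤ) :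
    moment h r j = moment h' r j := by
  unfold moment
  congr 1
  funext θ
  rw [hh _ (norm_circleMap_zero_of_pos hr θ)]

theorem moment_neg (h : ℂ → ℝ) (r : ℝ) (j : ℤ) :
    moment h r (-j) = (starRingEnd ℂ) (moment h r j) := by
  unfold moment
  rw [← intervalIntegral.intervalIntegral_conj]
  congr 1
  funext θ
  rw [map_mul, Complex.conj_ofReal, ← Complex.exp_conj]
  congr 2
  simp

theorem continuous_moment_integrand {h : ℂ → ℝ} {r : ℝ} (hr : 0 < r)
    (hh : ContinuousOn h (sphere 0 r)) (j : ℤ) :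
    Continuous fun θ : ℝ =>
      (h (circleMap 0 r θ) : ℂ) * Complex.exp (-(j * θ * Complex.I)) := by
  have h1 : Continuous fun θ : ℝ => h (circleMap 0 r θ) :=
    hh.comp_continuous (continuous_circleMap 0 r) fun θ => by
      simpa using norm_circleMap_zero_of_pos hr θ
  exact (Complex.continuous_ofReal.comp h1).mul (continuous_exp_int_mul j)

theorem moment_sum {ι : Type*} (J : Finset ι) {h : ι → ℂ → ℝ} {r : ℝ} (hr : 0 < r)
    (hh : ∀ i ∈ J, ContinuousOn (h i) (sphere 0 r)) (j : ℤ) :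
    moment (fun w => ∑ i ∈ J, h i w) r j = ∑ i ∈ J, moment (h i) r j := by
  unfold moment
  rw [← intervalIntegral.integral_finsetSum]
  · congr 1
    funext θ
    rw [Complex.ofReal_sum, Finset.sum_mul]
  · exact fun i hi => (continuous_moment_integrand hr (hh i hi) j).intervalIntegrable _ _

theorem moment_const_mul_sub {h h' : ℂ → ℝ} {r : ℝ} (hr : 0 < r)
    (hh : ContinuousOn h (sphere 0 r)) (hh' : ContinuousOn h' (sphere 0 r)) (c c' : ℝ) (j : ℤ) :
    moment (fun w => c * h w - c' * h' w) r j = c * moment h r j - c' * moment h' r j := by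
  unfold moment
  rw [← intervalIntegral.integral_const_mul, ← intervalIntegral.integral_const_mul,
    ← intervalIntegral.integral_sub]
  · congr 1
    funext θ
    push_cast
    ring
  · exact ((continuous_moment_integrand hr hh j).intervalIntegrable _ _).const_mul _
  · exact ((continuous_moment_integrand hr hh' j).intervalIntegrable _ _).const_mul _

theorem norm_moment_le {h : ℂ → ℝ} {r B : ℝ} (hr : 0 < r) (hB : ∀ w, ‖w‖ = r → ‖h w‖ ≤ B) (j : ℤ) :
    ‖moment h r j‖ ≤ B * (2 * Real.pi) := by
  have := intervalIntegral.norm_integral_le_of_norm_le_const (a := 0) (b := 2 * Real.pi) (C := B)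
    (f := fun θ : ℝ => (h (circleMap 0 r θ) : ℂ) * Complex.exp (-(j * θ * Complex.I)))
    (fun θ _ => by
      rw [norm_mul, norm_exp_int_mul, mul_one, Complex.norm_real]
      exact hB _ (norm_circleMap_zero_of_pos hr θ))
  rwa [sub_zero, abs_of_pos Real.two_pi_pos] at this

/-- On a fixed circle, where `w̄ = r ^ 2 / w`, the real part of a Laurent series is again a Laurent
series. -/
theorem re_laurent_eq {p q : ℕ+ → ℂ} {r : ℝ} (hr : 0 < r) (h : LaurentSummable p q r) :
    ∃ P Q : ℕ+ → ℂ, LaurentSummable P Q r ∧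
      (∀ n, P n = (p n + (starRingEnd ℂ) (q n / r ^ (n : ℕ)) / r ^ (n : ℕ)) / 2) ∧
      ∀ w, ‖w‖ = r → ((laurent p q w).re : ℂ) = laurent P Q w := by
  have hrc : (r : ℂ) ≠ 0 := by exact_mod_cast hr.ne'
  have hnr : ‖(r : ℂ)‖ = r := by rw [Complex.norm_real, Real.norm_of_nonneg hr.le]
  set P : ℕ+ → ℂ := fun n => (p n + (starRingEnd ℂ) (q n / r ^ (n : ℕ)) / r ^ (n : ℕ)) / 2 with hP
  set Q : ℕ+ → ℂ :=
    fun n => (q n + (starRingEnd ℂ) (p n * r ^ (n : ℕ)) * r ^ (n : ℕ)) / 2 with hQ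
  have hPQ : LaurentSummable P Q r := by
    constructor
    · refine Summable.of_nonneg_of_le (fun n => by positivity) (fun n => ?_) (h.1.add h.2)
      have : ‖P n‖ ≤ ‖p n‖ + ‖q n‖ / r ^ (n : ℕ) / r ^ (n : ℕ) := by
        rw [hP, norm_div, Complex.norm_ofNat]
        have := norm_add_le (p n) ((starRingEnd ℂ) (q n / r ^ (n : ℕ)) / r ^ (n : ℕ))
        rw [norm_div, Complex.norm_conj, norm_div, norm_pow, hnr] at this
        have h0 := norm_nonneg (p n + (starRingEnd ℂ) (q n / r ^ (n : ℕ)) / r ^ (n : ℕ))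
        linarith
      calc ‖P n‖ * r ^ (n : ℕ) ≤ (‖p n‖ + ‖q n‖ / r ^ (n : ℕ) / r ^ (n : ℕ)) * r ^ (n : ℕ) := by
            gcongr
        _ = _ := by field_simp
    · refine Summable.of_nonneg_of_le (fun n => by positivity) (fun n => ?_) (h.2.add h.1)
      have : ‖Q n‖ ≤ ‖q n‖ + ‖p n‖ * r ^ (n : ℕ) * r ^ (n : ℕ) := by
        rw [hQ, norm_div, Complex.norm_ofNat]
        have := norm_add_le (q n) ((starRingEnd ℂ) (p n * r ^ (n : ℕ)) * r ^ (n : ℕ))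
        rw [norm_mul, Complex.norm_conj, norm_mul, norm_pow, hnr] at this
        have h0 := norm_nonneg (q n + (starRingEnd ℂ) (p n * r ^ (n : ℕ)) * r ^ (n : ℕ))
        linarith
      calc ‖Q n‖ / r ^ (n : ℕ) ≤ (‖q n‖ + ‖p n‖ * r ^ (n : ℕ) * r ^ (n : ℕ)) / r ^ (n : ℕ) := by
            gcongr
        _ = _ := by field_simp
  refine ⟨P, Q, hPQ, fun n => rfl, fun w hw => ?_⟩
  have hw0 : w ≠ 0 := by rw [← norm_pos_iff, hw]; exact hr
  have hcw : (starRingEnd ℂ) w = r * r / w := by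
    rw [eq_div_iff hw0, mul_comm, Complex.mul_conj, Complex.normSq_eq_norm_sq, hw]
    push_cast; ring
  have s1 := h.hasSum hw
  have s2 := (s1.add (Complex.hasSum_conj'.2 s1)).div_const 2
  rw [Complex.re_eq_add_conj]
  refine s2.unique ((hPQ.hasSum hw).congr_fun fun n => ?_)
  simp only [hP, hQ, map_add, map_mul, map_div₀, map_pow, Complex.conj_ofReal, hcw, div_pow,
    mul_pow]
  field_simp
  ring

theorem moment_re_laurent {p q : ℕ+ → ℂ} {r : ℝ} (hr : 0 < r) (h : LaurentSummable p q r)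
    (k : ℕ+) : moment (fun w => (laurent p q w).re) r (k : ℤ) =
      Real.pi * (p k * r ^ (k : ℕ) + (starRingEnd ℂ) (q k / r ^ (k : ℕ))) := by
  have hrc : (r : ℂ) ≠ 0 := by exact_mod_cast hr.ne'
  obtain ⟨P, Q, hPQ, hP, hre⟩ := re_laurent_eq hr h
  have := integral_laurent_pos hr hPQ k
  unfold moment
  simp_rw [fun θ => hre _ (norm_circleMap_zero_of_pos hr θ)]
  rw [this, hP]
  field_simp

theorem moment_re_laurent_zero {p q : ℕ+ → ℂ} {r : ℝ} (hr : 0 < r) (h : LaurentSummable p q r) :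
    moment (fun w => (laurent p q w).re) r 0 = 0 := by
  obtain ⟨P, Q, hPQ, hP, hre⟩ := re_laurent_eq hr h
  have := integral_laurent_zero hr hPQ
  unfold moment
  simp_rw [fun θ => hre _ (norm_circleMap_zero_of_pos hr θ)]
  simpa using this

theorem continuousOn_moment {h : ℂ → ℝ} {a b : ℝ} (ha : 0 < a)
    (hh : ContinuousOn h {w | ‖w‖ ∈ Icc a b}) (j : ℤ) :
    ContinuousOn (fun r => moment h r j) (Icc a b) := by
  have hcomp : IsCompact {w : ℂ | ‖w‖ ∈ Icc a b} := by
    refine (isCompact_closedBall (0 : ℂ) b).of_isClosed_subset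
      (isClosed_Icc.preimage continuous_norm) fun w hw => ?_
    simpa using hw.2
  obtain ⟨B, hB⟩ := hcomp.exists_bound_of_continuousOn hh
  have hmem : ∀ r ∈ Icc a b, ∀ θ : ℝ, circleMap 0 r θ ∈ {w : ℂ | ‖w‖ ∈ Icc a b} := by
    intro r hr θ
    rw [mem_ofPred_eq, norm_circleMap_zero_of_pos (ha.trans_le hr.1)]
    exact hr
  intro r₀ hr₀
  refine intervalIntegral.continuousWithinAt_of_dominated_interval (bound := fun _ => B) ?_ ?_
    (by simp) ?_
  · filter_upwards [self_mem_nhdsWithin] with r hr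
    refine (continuous_moment_integrand (ha.trans_le hr.1) (hh.mono ?_) j).aestronglyMeasurable
    intro w hw
    rw [mem_sphere_zero_iff_norm] at hw
    rw [mem_ofPred_eq, hw]
    exact hr
  · filter_upwards [self_mem_nhdsWithin] with r hr
    refine Eventually.of_forall fun θ _ => ?_
    rw [norm_mul, norm_exp_int_mul, mul_one, Complex.norm_real]
    exact hB _ (hmem r hr θ)
  · refine Eventually.of_forall fun θ _ => ?_
    refine ContinuousWithinAt.mul ?_ continuousWithinAt_const
    refine Complex.continuous_ofReal.continuousAt.comp_continuousWithinAt ?_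
    refine (hh _ (hmem r₀ hr₀ θ)).comp (t := {w : ℂ | ‖w‖ ∈ Icc a b})
      (f := fun r : ℝ => circleMap 0 r θ) ?_ fun r hr => hmem r hr θ
    refine Continuous.continuousWithinAt ?_
    unfold circleMap
    fun_prop

/-- The Fourier coefficients of the boundary values of the real part of a Laurent series, computed
as limits from inside the annulus of convergence. -/
theorem moment_boundary {h : ℂ → ℝ} {p q : ℕ+ → ℂ} {a b γ : ℝ} (ha : 0 < a) (hab : a < b)
    (hγ : γ ∈ Icc a b) (hh : ContinuousOn h {w | ‖w‖ ∈ Icc a b})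
    (hs : ∀ r ∈ Ioo a b, LaurentSummable p q r)
    (heq : ∀ w : ℂ, ‖w‖ ∈ Ioo a b → h w = (laurent p q w).re) :
    (∀ k : ℕ+, moment h γ (k : ℤ) =
      Real.pi * (p k * γ ^ (k : ℕ) + (starRingEnd ℂ) (q k / γ ^ (k : ℕ)))) ∧ moment h γ 0 = 0 := by
  have hcl : Icc a b ⊆ closure (Ioo a b) := by rw [closure_Ioo hab.ne]
  have key : ∀ (j : ℤ) (c : ℝ → ℂ), ContinuousOn c (Icc a b) →
      (∀ r ∈ Ioo a b, moment (fun w => (laurent p q w).re) r j = c r) → moment h γ j = c γ := by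
    intro j c hc hj
    refine Set.EqOn.of_subset_closure (s := Ioo a b) (t := Icc a b) (fun r hr => ?_)
      (continuousOn_moment ha hh j) hc Ioo_subset_Icc_self hcl hγ
    rw [← hj r hr]
    exact moment_congr (ha.trans hr.1) (fun w hw => heq w (hw ▸ hr)) j
  refine ⟨fun k => key k (fun r : ℝ =>
    Real.pi * (p k * r ^ (k : ℕ) + (starRingEnd ℂ) (q k / r ^ (k : ℕ)))) ?_ fun r hr =>
      moment_re_laurent (ha.trans hr.1) (hs r hr) k,
    key 0 (fun _ => 0) continuousOn_const fun r hr =>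
      moment_re_laurent_zero (ha.trans hr.1) (hs r hr)⟩
  have hpow : ContinuousOn (fun r : ℝ => (r : ℂ) ^ (k : ℕ)) (Icc a b) :=
    (Complex.continuous_ofReal.pow _).continuousOn
  refine continuousOn_const.mul ((continuousOn_const.mul hpow).add
    (Complex.continuous_conj.comp_continuousOn (continuousOn_const.div hpow ?_)))
  intro r hr
  have : (r : ℂ) ≠ 0 := by exact_mod_cast (ha.trans_le hr.1).ne'
  exact pow_ne_zero _ this

/-- A continuous function on a circle whose Fourier coefficients vanish is zero. -/
theorem eq_zero_of_moment_eq_zero {h : ℂ → ℝ} {r : ℝ} (hr : 0 < r)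
    (hh : ContinuousOn h (sphere 0 r)) (hm : ∀ j, moment h r j = 0) {w : ℂ} (hw : ‖w‖ = r) :
    h w = 0 := by
  have : Fact (0 < 2 * Real.pi) := ⟨Real.two_pi_pos⟩
  have hper : Function.Periodic (fun θ : ℝ => (h (circleMap 0 r θ) : ℂ)) (2 * Real.pi) := by
    intro θ
    simp only [periodic_circleMap 0 r θ]
  have hc : Continuous fun θ : ℝ => (h (circleMap 0 r θ) : ℂ) :=
    Complex.continuous_ofReal.comp (hh.comp_continuous (continuous_circleMap 0 r) fun θ => by
      simpa using norm_circleMap_zero_of_pos hr θ)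
  set F : C(AddCircle (2 * Real.pi), ℂ) :=
    ⟨hper.lift, continuous_coinduced_dom.2 hc⟩ with hF
  have hcoef : fourierCoeff F = 0 := by
    funext j
    rw [fourierCoeff_eq_intervalIntegral F j 0, zero_add]
    have e : ∀ θ : ℝ, (fourier (-j) (θ : AddCircle (2 * Real.pi)) : ℂ) • F θ =
        (h (circleMap 0 r θ) : ℂ) * Complex.exp (-(j * θ * Complex.I)) := by
      intro θ
      have e1 : F θ = (h (circleMap 0 r θ) : ℂ) := rfl
      rw [e1, fourier_coe_apply, smul_eq_mul, mul_comm]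
      congr 2
      have : (Real.pi : ℂ) ≠ 0 := by exact_mod_cast Real.pi_ne_zero
      push_cast
      field_simp
    simp_rw [e]
    have := hm j
    unfold moment at this
    rw [this, smul_zero]
    rfl
  obtain ⟨θ, rfl⟩ : ∃ θ, circleMap 0 r θ = w := by
    have : w ∈ range (circleMap 0 r) := by
      rw [range_circleMap]
      simpa [abs_of_pos hr] using hw
    exact this
  have hs := has_pointwise_sum_fourier_series_of_summable (f := F)
    (by rw [hcoef]; exact summable_zero) (θ : AddCircle (2 * Real.pi))
  have h0 : F θ = 0 := hs.unique (by simp [hcoef])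
  have e1 : F θ = (h (circleMap 0 r θ) : ℂ) := rfl
  rw [e1] at h0
  exact_mod_cast h0

/-! ### Series of Faber polynomials -/

/-- The expansion `F_m(Ψ(w)) = w ^ m + ∑ n ≥ 1, c_{mn} w ^ (-n)` in `|w| > ρ`, where `ρ < γ`, and
the geometric decay of the Grunsky coefficients. -/
structure HasGrunskyExpansion (γ : ℝ) (Ψ : ℂ → ℂ) (a : ℕ → ℂ) (ρ K : ℝ) : Prop where
  pos : 0 < ρ
  lt : ρ < γ
  nonneg : 0 ≤ K
  diff : DifferentiableOn ℂ Ψ {w | ρ < ‖w‖}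
  inj : InjOn Ψ {w | ρ < ‖w‖}
  bound : ∀ m n : ℕ+, ‖grunsky γ Ψ a m n‖ ≤ K * ρ ^ (m : ℕ) * ρ ^ (n : ℕ)
  hasSum : ∀ (m : ℕ+) (v : ℂ), ρ < ‖v‖ →
    HasSum (fun n : ℕ+ => grunsky γ Ψ a m n / v ^ (n : ℕ))
      ((faber a m).eval (Ψ v) - v ^ (m : ℕ))

theorem IsExteriorMap.exists_hasGrunskyExpansion {D : Set ℂ} {Ψ : ℂ → ℂ} {a : ℕ → ℂ} {γ : ℝ}
    (hD : IsExteriorMap D γ Ψ a) : ∃ ρ K, HasGrunskyExpansion γ Ψ a ρ K := by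
  obtain ⟨r₀, h⟩ := hD.exists_isConformalBeyond
  obtain ⟨ρ, K, h1, h2, h3, h4, h5⟩ := h.exists_grunsky_bound
  have hsub : {w : ℂ | ρ < ‖w‖} ⊆ {w | r₀ < ‖w‖} := fun w hw => by
    rw [mem_ofPred_eq] at hw ⊢
    exact h1.trans hw
  exact ⟨ρ, K, h.pos.trans h1, h2, h3, h.diff.mono hsub, h.inj.mono hsub, h4,
    fun m v hv => h5 m v (h1.trans hv)⟩

/-- The row vector `β C`. -/
noncomputable def rowMul (β : ℕ+ → ℂ) (C : Matrix ℕ+ ℕ+ ℂ) (n : ℕ+) : ℂ := ∑' k, β k * C k n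

theorem summable_geometric_pnat {x : ℝ} (h0 : 0 ≤ x) (h1 : x < 1) :
    Summable fun n : ℕ+ => x ^ (n : ℕ) :=
  (summable_geometric_of_lt_one h0 h1).comp_injective PNat.coe_injective

namespace HasGrunskyExpansion

variable {γ : ℝ} {Ψ : ℂ → ℂ} {a : ℕ → ℂ} {ρ K : ℝ}

theorem radius_pos (h : HasGrunskyExpansion γ Ψ a ρ K) : 0 < γ := h.pos.trans h.lt

theorem summable_rowMul (h : HasGrunskyExpansion γ Ψ a ρ K) {β : ℕ+ → ℂ}
    (hβ : Summable fun k : ℕ+ => ‖β k‖ * ρ ^ (k : ℕ)) (n : ℕ+) :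
    Summable fun k => β k * grunsky γ Ψ a k n := by
  refine Summable.of_norm_bounded (hβ.mul_left (K * ρ ^ (n : ℕ))) fun k => ?_
  rw [norm_mul]
  calc ‖β k‖ * ‖grunsky γ Ψ a k n‖ ≤ ‖β k‖ * (K * ρ ^ (k : ℕ) * ρ ^ (n : ℕ)) := by
        gcongr
        exact h.bound k n
    _ = _ := by ring

theorem norm_rowMul_le (h : HasGrunskyExpansion γ Ψ a ρ K) {β : ℕ+ → ℂ}
    (hβ : Summable fun k : ℕ+ => ‖β k‖ * ρ ^ (k : ℕ)) (n : ℕ+) :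
    ‖rowMul β (grunsky γ Ψ a) n‖ ≤ K * (∑' k : ℕ+, ‖β k‖ * ρ ^ (k : ℕ)) * ρ ^ (n : ℕ) := by
  have := tsum_of_norm_bounded (f := fun k => β k * grunsky γ Ψ a k n)
    (hβ.hasSum.mul_left (K * ρ ^ (n : ℕ))) fun k => by
      rw [norm_mul]
      calc ‖β k‖ * ‖grunsky γ Ψ a k n‖ ≤ ‖β k‖ * (K * ρ ^ (k : ℕ) * ρ ^ (n : ℕ)) := by
            gcongr
            exact h.bound k n
        _ = _ := by ring
  refine this.trans (le_of_eq (by ring))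

theorem summable_mul_pow_of_le (h : HasGrunskyExpansion γ Ψ a ρ K) {β : ℕ+ → ℂ} {r : ℝ}
    (hr : ρ ≤ r) (hβ : Summable fun k : ℕ+ => ‖β k‖ * r ^ (k : ℕ)) :
    Summable fun k : ℕ+ => ‖β k‖ * ρ ^ (k : ℕ) := by
  have := h.pos
  refine Summable.of_nonneg_of_le (fun k => by positivity) (fun k => ?_) hβ
  gcongr

theorem laurentSummable_rowMul (h : HasGrunskyExpansion γ Ψ a ρ K) {β : ℕ+ → ℂ} {r : ℝ}
    (hr : ρ < r) (hβ : Summable fun k : ℕ+ => ‖β k‖ * r ^ (k : ℕ)) :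
    LaurentSummable β (rowMul β (grunsky γ Ψ a)) r := by
  have h0 := h.pos
  have hr0 := h0.trans hr
  refine ⟨hβ, ?_⟩
  have hβρ := h.summable_mul_pow_of_le hr.le hβ
  refine Summable.of_nonneg_of_le (fun k => by positivity) (fun n => ?_)
    ((summable_geometric_pnat (x := ρ / r) (by positivity) ((div_lt_one hr0).2 hr)).mul_left
      (K * ∑' k : ℕ+, ‖β k‖ * ρ ^ (k : ℕ)))
  rw [div_le_iff₀ (by positivity), div_pow, mul_assoc, div_mul_cancel₀ _ (by positivity)]
  exact h.norm_rowMul_le hβρ n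

/-- A series of Faber polynomials with coefficients `β`, composed with `Ψ`, is the Laurent series
with coefficients `β` and `β C`. -/
theorem hasSum_faber_comp (h : HasGrunskyExpansion γ Ψ a ρ K) {β : ℕ+ → ℂ} {w : ℂ}
    (hw : ρ < ‖w‖) (hβ : Summable fun k : ℕ+ => ‖β k‖ * ‖w‖ ^ (k : ℕ)) :
    HasSum (fun k : ℕ+ => β k * (faber a k).eval (Ψ w))
      (laurent β (rowMul β (grunsky γ Ψ a)) w) := by
  have h0 := h.pos
  have hw0 : 0 < ‖w‖ := h0.trans hw
  have hβρ := h.summable_mul_pow_of_le hw.le hβ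
  have hgeo := summable_geometric_pnat (x := ρ / ‖w‖) (by positivity) ((div_lt_one hw0).2 hw)
  have hdouble : Summable fun p : ℕ+ × ℕ+ =>
      β p.1 * grunsky γ Ψ a p.1 p.2 / w ^ (p.2 : ℕ) := by
    refine Summable.of_norm_bounded (g := fun p : ℕ+ × ℕ+ =>
      K * ((‖β p.1‖ * ρ ^ (p.1 : ℕ)) * (ρ / ‖w‖) ^ (p.2 : ℕ)))
      ((hβρ.mul_of_nonneg hgeo (fun k => by positivity) fun n => by positivity).mul_left K)
      fun p => ?_
    rw [norm_div, norm_mul, norm_pow, div_pow]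
    calc ‖β p.1‖ * ‖grunsky γ Ψ a p.1 p.2‖ / ‖w‖ ^ (p.2 : ℕ) ≤
        ‖β p.1‖ * (K * ρ ^ (p.1 : ℕ) * ρ ^ (p.2 : ℕ)) / ‖w‖ ^ (p.2 : ℕ) := by
          gcongr
          exact h.bound p.1 p.2
      _ = _ := by ring
  obtain ⟨T, hT⟩ := hdouble
  have s1 : HasSum (fun k : ℕ+ => β k * ((faber a k).eval (Ψ w) - w ^ (k : ℕ))) T := by
    refine hT.prod_fiberwise fun k => ?_
    refine ((h.hasSum k w hw).mul_left (β k)).congr_fun fun n => ?_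
    ring
  have s2 : HasSum (fun n : ℕ+ => rowMul β (grunsky γ Ψ a) n / w ^ (n : ℕ)) T := by
    have hsw : HasSum (fun p : ℕ+ × ℕ+ => β p.2 * grunsky γ Ψ a p.2 p.1 / w ^ (p.1 : ℕ)) T :=
      ((Equiv.prodComm ℕ+ ℕ+).hasSum_iff (f := fun p : ℕ+ × ℕ+ =>
        β p.1 * grunsky γ Ψ a p.1 p.2 / w ^ (p.2 : ℕ))).2 hT
    have hrow : ∀ n : ℕ+, HasSum (fun k : ℕ+ => β k * grunsky γ Ψ a k n / w ^ (n : ℕ))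
        (rowMul β (grunsky γ Ψ a) n / w ^ (n : ℕ)) := fun n =>
      (h.summable_rowMul hβρ n).hasSum.div_const _
    exact hsw.prod_fiberwise hrow
  have s3 : Summable fun k : ℕ+ => β k * w ^ (k : ℕ) := by
    refine Summable.of_norm ?_
    simpa [norm_mul, norm_pow] using hβ
  have e : laurent β (rowMul β (grunsky γ Ψ a)) w = (∑' k : ℕ+, β k * w ^ (k : ℕ)) + T :=
    (s3.hasSum.add s2).tsum_eq
  rw [e]
  refine (s3.hasSum.add s1).congr_fun fun k => ?_
  ring

end HasGrunskyExpansion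

/-! ### The position of the curves `Ψ({|w| = r})` -/

section Curves

variable {D : Set ℂ} {Ψ : ℂ → ℂ} {a : ℕ → ℂ} {γ ρ K : ℝ}

theorem IsExteriorMap.mem_frontier (hD : IsExteriorMap D γ Ψ a) {w : ℂ} (hw : ‖w‖ = γ) :
    Ψ w ∈ frontier D := hD.image_circle ▸ mem_image_of_mem Ψ hw

theorem IsExteriorMap.mem_exterior (hD : IsExteriorMap D γ Ψ a) {w : ℂ} (hw : γ < ‖w‖) :
    Ψ w ∈ (closure D)ᶜ := hD.image_exterior ▸ mem_image_of_mem Ψ hw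

theorem IsExteriorMap.mem_interior (hD : IsExteriorMap D γ Ψ a)
    (h : HasGrunskyExpansion γ Ψ a ρ K) {w : ℂ} (hw : ρ < ‖w‖) (hw' : ‖w‖ < γ) : Ψ w ∈ D := by
  have h1 : Ψ w ∈ closure D := by
    by_contra hc
    have hc' : Ψ w ∈ Ψ '' {w | γ < ‖w‖} := hD.image_exterior ▸ hc
    obtain ⟨v, hv, hvw⟩ := hc'
    have hv : γ < ‖v‖ := hv
    have := h.inj (h.lt.trans hv : ρ < ‖v‖) hw hvw
    rw [this] at hv
    exact lt_asymm hv hw'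
  have h2 : Ψ w ∉ frontier D := by
    intro hc
    rw [← hD.image_circle] at hc
    obtain ⟨v, hv, hvw⟩ := hc
    have hv : ‖v‖ = γ := hv
    have := h.inj (hv ▸ h.lt : ρ < ‖v‖) hw hvw
    rw [this] at hv
    exact hw'.ne hv
  by_contra hc
  exact h2 (hD.isOpen.frontier_eq ▸ ⟨h1, hc⟩)

/-- The maximum principle, with the expansion of `F_m` on the boundary. -/
theorem exists_norm_faber_le_closure (hD : IsExteriorMap D γ Ψ a)
    (h : HasGrunskyExpansion γ Ψ a ρ K) :
    ∃ B : ℝ, ∀ (m : ℕ+), ∀ z ∈ closure D, ‖(faber a m).eval z‖ ≤ B * γ ^ (m : ℕ) := by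
  have h0 := h.pos
  have hγ := h.radius_pos
  have hK := h.nonneg
  have hgeo := summable_geometric_pnat (x := ρ / γ) (by positivity) ((div_lt_one hγ).2 h.lt)
  set G := ∑' n : ℕ+, (ρ / γ) ^ (n : ℕ) with hG
  have hG0 : 0 ≤ G := tsum_nonneg fun n => by positivity
  refine ⟨K * G + 1, fun m z hz => ?_⟩
  refine Complex.norm_le_of_forall_mem_frontier_norm_le hD.isBounded
    (faber a m).differentiable.diffContOnCl (fun ζ hζ => ?_) hz
  rw [← hD.image_circle] at hζ
  obtain ⟨w, hw, rfl⟩ := hζ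
  have hw : ‖w‖ = γ := hw
  have s := h.hasSum m w (hw ▸ h.lt)
  have hb : ‖(faber a m).eval (Ψ w) - w ^ (m : ℕ)‖ ≤ K * ρ ^ (m : ℕ) * G := by
    rw [← s.tsum_eq]
    refine tsum_of_norm_bounded (hgeo.hasSum.mul_left (K * ρ ^ (m : ℕ))) fun n => ?_
    rw [norm_div, norm_pow, hw, div_pow, mul_div_assoc']
    gcongr
    exact h.bound m n
  have hb' : K * ρ ^ (m : ℕ) * G ≤ K * γ ^ (m : ℕ) * G := by
    have := h.lt.le
    gcongr
  calc ‖(faber a m).eval (Ψ w)‖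
      = ‖((faber a m).eval (Ψ w) - w ^ (m : ℕ)) + w ^ (m : ℕ)‖ := by rw [sub_add_cancel]
    _ ≤ K * γ ^ (m : ℕ) * G + γ ^ (m : ℕ) := by
        refine (norm_add_le _ _).trans (add_le_add (hb.trans hb') ?_)
        rw [norm_pow, hw]
    _ = _ := by ring

end Curves

/-! ### The normalized Grunsky operator -/

theorem gammaPow_apply {γ : ℝ} (hγ : 0 < γ) (n : ℕ+) :
    gammaPow γ (-2) n n = ((γ : ℂ) ^ (n : ℕ))⁻¹ * ((γ : ℂ) ^ (n : ℕ))⁻¹ := by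
  rw [gammaPow, Matrix.diagonal_apply_eq]
  have : γ ^ (-2 * ((n : ℕ) : ℝ)) = (γ ^ (n : ℕ))⁻¹ * (γ ^ (n : ℕ))⁻¹ := by
    rw [mul_comm, Real.rpow_mul hγ.le, Real.rpow_natCast, Real.rpow_neg (by positivity),
      Real.rpow_two]
    field_simp
  rw [this]
  push_cast
  rfl

theorem gammaPow_infMul {γ : ℝ} (hγ : 0 < γ) (A : Matrix ℕ+ ℕ+ ℂ) (m n : ℕ+) :
    (gammaPow γ (-2) ⊙ A) m n = ((γ : ℂ) ^ (m : ℕ))⁻¹ * ((γ : ℂ) ^ (m : ℕ))⁻¹ * A m n := by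
  rw [infMul, tsum_eq_single m, gammaPow_apply hγ]
  intro k hk
  rw [gammaPow, Matrix.diagonal_apply_ne _ hk.symm, zero_mul]

theorem infMul_gammaPow {γ : ℝ} (hγ : 0 < γ) (A : Matrix ℕ+ ℕ+ ℂ) (m n : ℕ+) :
    (A ⊙ gammaPow γ (-2)) m n = A m n * (((γ : ℂ) ^ (n : ℕ))⁻¹ * ((γ : ℂ) ^ (n : ℕ))⁻¹) := by
  rw [infMul, tsum_eq_single n, gammaPow_apply hγ]
  intro k hk
  rw [gammaPow, Matrix.diagonal_apply_ne _ hk, mul_zero]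

/-- The operators of the matrices `γ ^ (-𝒩) C γ ^ (-𝒩)` and of its complex conjugate. -/
theorem HasGrunskyExpansion.exists_op {Ψ : ℂ → ℂ} {a : ℕ → ℂ} {γ ρ K : ℝ}
    (h : HasGrunskyExpansion γ Ψ a ρ K) :
    ∃ S S' : EllTwo →L[ℂ] EllTwo,
      (∀ m n, S (basisVec n) m =
        grunsky γ Ψ a m n / ((γ : ℂ) ^ (m : ℕ) * (γ : ℂ) ^ (n : ℕ))) ∧
      Represents γ S (gammaPow γ (-2) ⊙ grunsky γ Ψ a) ∧
      Represents γ S' (gammaPow γ (-2) ⊙ conjMat (grunsky γ Ψ a)) ∧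
      IsConjOf S S' ∧ IsCompactOperator (ContinuousLinearMap.adjoint (S * S')) := by
  have h0 := h.pos
  have hγ := h.radius_pos
  have hγc : (γ : ℂ) ≠ 0 := by exact_mod_cast hγ.ne'
  have hnγ : ‖(γ : ℂ)‖ = γ := by rw [Complex.norm_real, Real.norm_of_nonneg hγ.le]
  set B : ℕ+ → ℕ+ → ℂ :=
    fun m n => grunsky γ Ψ a m n / ((γ : ℂ) ^ (m : ℕ) * (γ : ℂ) ^ (n : ℕ)) with hB
  have hgeo := summable_geometric_pnat (x := ρ / γ) (by positivity) ((div_lt_one hγ).2 h.lt)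
  have hsum : Summable fun p : ℕ+ × ℕ+ => ‖B p.1 p.2‖ := by
    refine Summable.of_nonneg_of_le (fun _ => norm_nonneg _) (fun p => ?_)
      ((hgeo.mul_of_nonneg hgeo (fun k => by positivity) fun n => by positivity).mul_left K)
    rw [hB, norm_div, norm_mul, norm_pow, norm_pow, hnγ, div_pow, div_pow]
    calc ‖grunsky γ Ψ a p.1 p.2‖ / (γ ^ (p.1 : ℕ) * γ ^ (p.2 : ℕ)) ≤
        (K * ρ ^ (p.1 : ℕ) * ρ ^ (p.2 : ℕ)) / (γ ^ (p.1 : ℕ) * γ ^ (p.2 : ℕ)) := by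
          gcongr
          exact h.bound p.1 p.2
      _ = _ := by field_simp
  have hsum' : Summable fun p : ℕ+ × ℕ+ => ‖(starRingEnd ℂ) (B p.1 p.2)‖ := by
    simpa using hsum
  have hsumT : Summable fun p : ℕ+ × ℕ+ => ‖(starRingEnd ℂ) (B p.2 p.1)‖ :=
    (Equiv.prodComm ℕ+ ℕ+).summable_iff.2 hsum'
  obtain ⟨S, -, hS⟩ := exists_compact_of_summable hsum
  obtain ⟨S', -, hS'⟩ := exists_compact_of_summable
    (B := fun m n => (starRingEnd ℂ) (B m n)) hsum'
  obtain ⟨T, hTc, hT⟩ := exists_compact_of_summable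
    (B := fun m n => (starRingEnd ℂ) (B n m)) hsumT
  refine ⟨S, S', hS, fun m n => ?_, fun m n => ?_, fun m n => ?_, ?_⟩
  · rw [hS, gammaPow_infMul hγ, hB]
    field_simp
  · rw [hS', gammaPow_infMul hγ, hB, conjMat]
    simp only [map_div₀, map_mul, map_pow, Complex.conj_ofReal]
    field_simp
  · rw [hS, hS']
  · have hadj : ContinuousLinearMap.adjoint S = T := by
      refine ext_of_basisVec fun m n => ?_
      rw [← inner_basisVec_left, ContinuousLinearMap.adjoint_inner_right, inner_basisVec_right,
        hS, hT]
    rw [ContinuousLinearMap.mul_def, ContinuousLinearMap.adjoint_comp, hadj]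
    exact hTc.clm_comp (ContinuousLinearMap.adjoint S')

/-! ### Injectivity -/

section Injective

variable {D : Set ℂ} {Ψ : ℂ → ℂ} {a : ℕ → ℂ} {γ ρ K : ℝ}

/-- A holomorphic function on a bounded open set, continuous up to the boundary and real there, is
real: both `exp (i f)` and `exp (-i f)` have modulus at most `1`. -/
theorem im_eq_zero_of_frontier {f : ℂ → ℂ} {U : Set ℂ} (hU : Bornology.IsBounded U)
    (hf : DiffContOnCl ℂ f U) (hr : ∀ z ∈ frontier U, (f z).im = 0) {z : ℂ} (hz : z ∈ closure U) :
    (f z).im = 0 := by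
  have key : ∀ c : ℝ, 0 ≤ c * (f z).im := by
    intro c
    have hd' : DiffContOnCl ℂ (fun z => (c * Complex.I) * f z) U :=
      hf.const_smul (c * Complex.I : ℂ)
    have hd : DiffContOnCl ℂ (fun z => Complex.exp ((c * Complex.I) * f z)) U :=
      (Complex.differentiable_exp (𝕜 := ℂ)).comp_diffContOnCl hd'
    have hn : ∀ z, ‖Complex.exp ((c * Complex.I) * f z)‖ = Real.exp (-(c * (f z).im)) := by
      intro z
      rw [Complex.norm_exp]
      congr 1
      simp
    have := Complex.norm_le_of_forall_mem_frontier_norm_le hU hd (C := 1) (fun ζ hζ => by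
      rw [hn, hr ζ hζ]; simp) hz
    rw [hn, Real.exp_le_one_iff] at this
    linarith
  have h1 := key 1
  have h2 := key (-1)
  linarith

/-- A solution `v` of `v K = v̄`, `K = γ ^ (-𝒩) C γ ^ (-𝒩)`, decays geometrically, since the columns
of `K` do. The function `∑ v_m γ ^ (-m) F_m` is therefore holomorphic in `D` and continuous up to
the boundary, where it equals `∑ (v_m e ^ (i m θ) + v̄_m e ^ (-i m θ))` and so is real. Hence it is
real throughout `D`, and its Fourier coefficients on a smaller curve show that `v = 0`. -/
theorem eq_zero_of_rowAct_eq_star (hD : IsExteriorMap D γ Ψ a)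
    (h : HasGrunskyExpansion γ Ψ a ρ K) {S : EllTwo →L[ℂ] EllTwo}
    (hS : ∀ m n, S (basisVec n) m =
        grunsky γ Ψ a m n / ((γ : ℂ) ^ (m : ℕ) * (γ : ℂ) ^ (n : ℕ)))
    {v : EllTwo} (hv : rowAct S v = star v) : v = 0 := by
  have h0 := h.pos
  have hγ := h.radius_pos
  have hlt := h.lt
  have hK := h.nonneg
  have hγc : (γ : ℂ) ≠ 0 := by exact_mod_cast hγ.ne'
  have hnγ : ‖(γ : ℂ)‖ = γ := by rw [Complex.norm_real, Real.norm_of_nonneg hγ.le]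
  have hgeo := summable_geometric_pnat (x := ρ / γ) (by positivity) ((div_lt_one hγ).2 h.lt)
  -- the Faber coefficients `v_k γ ^ (-k)`; then `p C = v̄ γ ^ 𝒩`
  set p : ℕ+ → ℂ := fun k => v k / (γ : ℂ) ^ (k : ℕ) with hp
  have hrow : ∀ n : ℕ+, HasSum (fun k => p k * grunsky γ Ψ a k n)
      ((γ : ℂ) ^ (n : ℕ) * (starRingEnd ℂ) (v n)) := by
    intro n
    have := (hasSum_rowAct S v n).mul_left ((γ : ℂ) ^ (n : ℕ))
    rw [hv, lp.star_apply] at this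
    refine this.congr_fun fun k => ?_
    rw [hS, hp]
    field_simp
  have hvb : ∀ n, ‖v n‖ ≤ ‖v‖ := fun n => lp.norm_apply_le_norm (by simp) v n
  have hpρ : Summable fun k : ℕ+ => ‖p k‖ * ρ ^ (k : ℕ) := by
    refine Summable.of_nonneg_of_le (fun k => by positivity) (fun k => ?_) (hgeo.mul_left ‖v‖)
    rw [hp, norm_div, norm_pow, hnγ, div_pow, div_mul_eq_mul_div, ← mul_div_assoc]
    gcongr
    exact hvb k
  have hq : ∀ n, rowMul p (grunsky γ Ψ a) n = (γ : ℂ) ^ (n : ℕ) * (starRingEnd ℂ) (v n) :=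
    fun n => (hrow n).tsum_eq
  set V := K * ∑' k : ℕ+, ‖p k‖ * ρ ^ (k : ℕ) with hV
  have hdecay : ∀ n : ℕ+, ‖v n‖ ≤ V * (ρ / γ) ^ (n : ℕ) := by
    intro n
    have := h.norm_rowMul_le hpρ n
    rw [hq, norm_mul, norm_pow, hnγ, Complex.norm_conj] at this
    rw [div_pow, ← mul_div_assoc, le_div_iff₀ (by positivity), mul_comm]
    exact this
  have hpγ : Summable fun k : ℕ+ => ‖p k‖ * γ ^ (k : ℕ) := by
    refine Summable.of_nonneg_of_le (fun k => by positivity) (fun k => ?_) (hgeo.mul_left V)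
    rw [hp, norm_div, norm_pow, hnγ, div_mul_cancel₀ _ (by positivity)]
    exact hdecay k
  obtain ⟨B, hB⟩ := exists_norm_faber_le_closure hD h
  set f : ℂ → ℂ := fun z => ∑' k : ℕ+, p k * (faber a k).eval z with hf
  have hle : ∀ (k : ℕ+) (z : ℂ), z ∈ closure D →
      ‖p k * (faber a k).eval z‖ ≤ B * (‖p k‖ * γ ^ (k : ℕ)) := by
    intro k z hz
    rw [norm_mul]
    calc _ ≤ ‖p k‖ * (B * γ ^ (k : ℕ)) := by gcongr; exact hB k z hz
      _ = _ := by ring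
  have hfd : DiffContOnCl ℂ f D := by
    constructor
    · exact Complex.differentiableOn_tsum_of_summable_norm (hpγ.mul_left B)
        (fun k => ((faber a k).differentiable.const_mul (p k)).differentiableOn) hD.isOpen
        fun k z hz => hle k z (subset_closure hz)
    · exact continuousOn_tsum
        (fun k => ((faber a k).differentiable.const_mul (p k)).continuous.continuousOn)
        (hpγ.mul_left B) hle
  have hfw : ∀ r, ρ < r → r ≤ γ → LaurentSummable p (rowMul p (grunsky γ Ψ a)) r ∧
      ∀ w : ℂ, ‖w‖ = r → f (Ψ w) = laurent p (rowMul p (grunsky γ Ψ a)) w := by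
    intro r hr hr'
    have hpr : Summable fun k : ℕ+ => ‖p k‖ * r ^ (k : ℕ) := by
      have := h0.trans hr
      refine Summable.of_nonneg_of_le (fun k => by positivity) (fun k => ?_) hpγ
      gcongr
    refine ⟨h.laurentSummable_rowMul hr hpr, fun w hw => ?_⟩
    subst hw
    exact (h.hasSum_faber_comp hr hpr).tsum_eq
  have hreal : ∀ z ∈ closure D, (f z).im = 0 := by
    intro z hz
    refine im_eq_zero_of_frontier hD.isBounded hfd (fun ζ hζ => ?_) hz
    rw [← hD.image_circle] at hζ
    obtain ⟨w, hw, rfl⟩ := hζ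
    have hw : ‖w‖ = γ := hw
    have hw0 : w ≠ 0 := by rw [← norm_pos_iff, hw]; exact hγ
    have hcw : (starRingEnd ℂ) w = γ * γ / w := by
      rw [eq_div_iff hw0, mul_comm, Complex.mul_conj, Complex.normSq_eq_norm_sq, hw]
      push_cast; ring
    obtain ⟨hls, hfe⟩ := hfw γ hlt le_rfl
    have s := hls.hasSum hw
    rw [hfe w hw, ← Complex.conj_eq_iff_im]
    refine (Complex.hasSum_conj'.2 s).unique (s.congr_fun fun n => ?_)
    rw [hq, hp]
    simp only [map_add, map_mul, map_div₀, map_pow, Complex.conj_ofReal, hcw, Complex.conj_conj,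
      div_pow, mul_pow]
    field_simp
    ring
  obtain ⟨r, hr, hr'⟩ := exists_between hlt
  have hr0 : 0 < r := h0.trans hr
  obtain ⟨hls, hfe⟩ := hfw r hr hr'.le
  -- `-i f` has vanishing real part on the curve `Ψ({|w| = r})`
  have hls' : LaurentSummable (fun n => -Complex.I * p n)
      (fun n => -Complex.I * rowMul p (grunsky γ Ψ a) n) r := by
    constructor
    · simpa using hls.1
    · simpa using hls.2
  have hzero : ∀ w : ℂ, ‖w‖ = r → (laurent (fun n => -Complex.I * p n)
      (fun n => -Complex.I * rowMul p (grunsky γ Ψ a) n) w).re = 0 := by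
    intro w hw
    have e : laurent (fun n => -Complex.I * p n)
        (fun n => -Complex.I * rowMul p (grunsky γ Ψ a) n) w = -Complex.I * f (Ψ w) := by
      rw [hfe w hw]
      refine (hls'.hasSum hw).unique (((hls.hasSum hw).mul_left (-Complex.I)).congr_fun fun n => ?_)
      ring
    have him := hreal (Ψ w) (subset_closure (hD.mem_interior h (hw ▸ hr) (hw ▸ hr')))
    rw [e]
    simp [him]
  ext k
  have hm := moment_re_laurent hr0 hls' k
  have hm0 : moment (fun w => (laurent (fun n => -Complex.I * p n)
      (fun n => -Complex.I * rowMul p (grunsky γ Ψ a) n) w).re) r (k : ℤ) = 0 := by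
    rw [moment_congr hr0 (h' := fun _ => 0) hzero]
    simp [moment]
  rw [hm0, hq, hp] at hm
  have hpi : (Real.pi : ℂ) ≠ 0 := by exact_mod_cast Real.pi_ne_zero
  have hm := (mul_eq_zero.1 hm.symm).resolve_left hpi
  have hrc : (r : ℂ) ≠ 0 := by exact_mod_cast hr0.ne'
  simp only [map_mul, map_div₀, map_neg, map_pow, Complex.conj_ofReal, Complex.conj_I,
    Complex.conj_conj] at hm
  -- on the circle of radius `r` the two contributions of `v_k` no longer have equal weights
  have hm2 : Complex.I * v k * ((γ : ℂ) ^ (k : ℕ) * (γ : ℂ) ^ (k : ℕ) -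
      (r : ℂ) ^ (k : ℕ) * (r : ℂ) ^ (k : ℕ)) = 0 := by
    field_simp at hm
    linear_combination hm
  have hpow : r ^ (k : ℕ) < γ ^ (k : ℕ) := pow_lt_pow_left₀ hr' hr0.le k.ne_zero
  have hne : (γ : ℂ) ^ (k : ℕ) * (γ : ℂ) ^ (k : ℕ) - (r : ℂ) ^ (k : ℕ) * (r : ℂ) ^ (k : ℕ) ≠ 0 := by
    have : (0 : ℝ) < γ ^ (k : ℕ) * γ ^ (k : ℕ) - r ^ (k : ℕ) * r ^ (k : ℕ) := by
      have := mul_self_lt_mul_self (pow_nonneg hr0.le (k : ℕ)) hpow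
      linarith
    exact_mod_cast this.ne'
  have hm3 := (mul_eq_zero.1 hm2).resolve_right hne
  simpa using hm3

end Injective

/-! ### Normal derivatives on the boundary -/

section Gradient

variable {γ : ℝ} {Ψ : ℂ → ℂ} {a : ℕ → ℂ} {ρ K : ℝ}

namespace HasGrunskyExpansion

theorem hasStrictDerivAt (h : HasGrunskyExpansion γ Ψ a ρ K) {w : ℂ} (hw : ρ < ‖w‖) :
    HasStrictDerivAt Ψ (deriv Ψ w) w :=
  (h.diff.analyticAt ((IsConformalBeyond.isOpen_exterior ρ).mem_nhds hw)).hasStrictDerivAt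

theorem deriv_ne_zero (h : HasGrunskyExpansion γ Ψ a ρ K) {w : ℂ} (hw : ρ < ‖w‖) :
    deriv Ψ w ≠ 0 :=
  deriv_ne_zero_of_injOn (IsConformalBeyond.isOpen_exterior ρ) h.diff h.inj hw

theorem continuousAt (h : HasGrunskyExpansion γ Ψ a ρ K) {w : ℂ} (hw : ρ < ‖w‖) :
    ContinuousAt Ψ w := (h.hasStrictDerivAt hw).hasDerivAt.continuousAt

/-- The gradient of `u` in the coordinate `w`, when `u ∘ Ψ` is the real part of the holomorphic
function `G`. -/
theorem hasFDerivAt_of_comp (h : HasGrunskyExpansion γ Ψ a ρ K) {w : ℂ} (hw : ρ < ‖w‖)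
    {G : ℂ → ℂ} {G' : ℂ} (hG : HasDerivAt G G' w) {u : ℂ → ℝ}
    (hu : ∀ᶠ v in 𝓝 w, u (Ψ v) = (G v).re) :
    DifferentiableAt ℝ u (Ψ w) ∧
      ∀ ξ : ℂ, fderiv ℝ u (Ψ w) ξ = (G' / deriv Ψ w * ξ).re := by
  have hs := h.hasStrictDerivAt hw
  have hne := h.deriv_ne_zero hw
  set φ := hs.localInverse Ψ (deriv Ψ w) w hne with hφ
  have hφd : HasDerivAt φ (deriv Ψ w)⁻¹ (Ψ w) := (hs.to_localInverse hne).hasDerivAt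
  have hφw : φ (Ψ w) = w := (hs.eventually_left_inverse hne).self_of_nhds
  have hφc : Tendsto φ (𝓝 (Ψ w)) (𝓝 w) := by
    have := hφd.continuousAt.tendsto
    rwa [hφw] at this
  have hcomp : HasDerivAt (fun z => G (φ z)) (G' * (deriv Ψ w)⁻¹) (Ψ w) :=
    HasDerivAt.comp (Ψ w) (by rw [hφw]; exact hG) hφd
  have heq : u =ᶠ[𝓝 (Ψ w)] fun z => (G (φ z)).re := by
    filter_upwards [hφc.eventually hu, hs.eventually_right_inverse hne] with z h1 h2
    rw [← h1, h2]
  have hre : HasFDerivAt (fun z => (G (φ z)).re)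
      (Complex.reCLM.comp ((ContinuousLinearMap.toSpanSingleton ℂ
        (G' * (deriv Ψ w)⁻¹)).restrictScalars ℝ)) (Ψ w) :=
    Complex.reCLM.hasFDerivAt.comp (Ψ w) (hcomp.hasFDerivAt.restrictScalars ℝ)
  have hu' := hre.congr_of_eventuallyEq heq
  refine ⟨hu'.differentiableAt, fun ξ => ?_⟩
  rw [hu'.fderiv]
  simp only [ContinuousLinearMap.comp_apply, ContinuousLinearMap.coe_restrictScalars',
    ContinuousLinearMap.toSpanSingleton_apply, Complex.reCLM_apply, smul_eq_mul]
  congr 1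
  ring

end HasGrunskyExpansion

/-- One side `S` of the boundary curve: near the curve it is the image of the annulus
`a < |w| < b`, of which `{|w| = γ}` is a boundary component; `Z` is the closed side. -/
structure IsSide (γ : ℝ) (Ψ : ℂ → ℂ) (ρ : ℝ) (S Z : Set ℂ) (a b : ℝ) : Prop where
  lt_left : ρ < a
  lt : a < b
  mem : γ ∈ Icc a b
  subset : S ⊆ Z
  mem_closed : ∀ w : ℂ, ‖w‖ ∈ Icc a b → Ψ w ∈ Z
  mem_side : ∀ w : ℂ, ‖w‖ ∈ Ioo a b → Ψ w ∈ S
  near : ∀ w₀ : ℂ, ‖w₀‖ = γ → ∀ᶠ w in 𝓝 w₀, Ψ w ∈ S → ‖w‖ ∈ Ioo a b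

/-- The field `u` is, on one side, the real part of the Laurent series with coefficients `p`, `q` in
the coordinate `w`, and its gradient extends continuously to `E` up to the boundary. -/
structure IsSideField (Ψ : ℂ → ℂ) (S Z : Set ℂ) (a b : ℝ) (u : ℂ → ℝ)
    (p q : ℕ+ → ℂ) (E : ℂ → (ℂ →L[ℝ] ℝ)) : Prop where
  summable : ∀ r ∈ Ioo a b, LaurentSummable p q r
  eq : ∀ w : ℂ, ‖w‖ ∈ Ioo a b → u (Ψ w) = (laurent p q w).re
  cont : ContinuousOn E Z
  grad : ∀ z ∈ S, E z = fderiv ℝ u z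

/-- The boundary values of the derivative in the direction `w Ψ'(w)`, which is normal to the
boundary curve. -/
noncomputable def normalFlux (Ψ : ℂ → ℂ) (E : ℂ → (ℂ →L[ℝ] ℝ)) (w : ℂ) : ℝ :=
  E (Ψ w) (w * deriv Ψ w)

variable {S Z : Set ℂ} {b c : ℝ} {u : ℂ → ℝ} {p q : ℕ+ → ℂ} {E : ℂ → (ℂ →L[ℝ] ℝ)}

theorem IsSideField.fderiv_eq (h : HasGrunskyExpansion γ Ψ a ρ K) (hS : IsSide γ Ψ ρ S Z b c)
    (hu : IsSideField Ψ S Z b c u p q E) {w : ℂ} (hw : ‖w‖ ∈ Ioo b c) :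
    DifferentiableAt ℝ u (Ψ w) ∧ normalFlux Ψ E w =
      (laurent (fun n => (n : ℂ) * p n) (fun n => -((n : ℂ) * q n)) w).re := by
  have hb : 0 < b := h.pos.trans hS.lt_left
  have hwρ : ρ < ‖w‖ := hS.lt_left.trans hw.1
  have hd := hasDerivAt_laurent hb hu.summable hw
  have hev : ∀ᶠ v in 𝓝 w, u (Ψ v) = (laurent p q v).re := by
    filter_upwards [(isOpen_annulus b c).mem_nhds hw] with v hv using hu.eq v hv
  obtain ⟨h1, h2⟩ := h.hasFDerivAt_of_comp hwρ hd hev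
  refine ⟨h1, ?_⟩
  have hw0 : w ≠ 0 := norm_pos_iff.1 (h.pos.trans hwρ)
  have hne := h.deriv_ne_zero hwρ
  rw [normalFlux, hu.grad _ (hS.mem_side w hw), h2]
  congr 1
  field_simp

theorem IsSideField.continuousOn_normalFlux (h : HasGrunskyExpansion γ Ψ a ρ K)
    (hS : IsSide γ Ψ ρ S Z b c) (hu : IsSideField Ψ S Z b c u p q E) :
    ContinuousOn (normalFlux Ψ E) {w | ‖w‖ ∈ Icc b c} := by
  have hsub : {w : ℂ | ‖w‖ ∈ Icc b c} ⊆ {w | ρ < ‖w‖} := fun w hw => by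
    rw [mem_ofPred_eq] at hw ⊢
    exact hS.lt_left.trans_le hw.1
  have hΨ : ContinuousOn Ψ {w | ‖w‖ ∈ Icc b c} := h.diff.continuousOn.mono hsub
  have hΨ' : ContinuousOn (deriv Ψ) {w | ‖w‖ ∈ Icc b c} :=
    (h.diff.deriv (IsConformalBeyond.isOpen_exterior ρ)).continuousOn.mono hsub
  exact (hu.cont.comp hΨ fun w hw => hS.mem_closed w hw).clm_apply (continuousOn_id.mul hΨ')

theorem IsSide.sphere_subset (hS : IsSide γ Ψ ρ S Z b c) :
    sphere (0 : ℂ) γ ⊆ {w | ‖w‖ ∈ Icc b c} := fun w hw => by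
  rw [mem_sphere_zero_iff_norm] at hw
  rw [mem_ofPred_eq, hw]
  exact hS.mem

theorem IsSideField.moment_normalFlux (h : HasGrunskyExpansion γ Ψ a ρ K)
    (hS : IsSide γ Ψ ρ S Z b c) (hu : IsSideField Ψ S Z b c u p q E) :
    (∀ k : ℕ+, moment (normalFlux Ψ E) γ (k : ℤ) =
      Real.pi * k * (p k * γ ^ (k : ℕ) - (starRingEnd ℂ) (q k / γ ^ (k : ℕ)))) ∧
      moment (normalFlux Ψ E) γ 0 = 0 := by
  have hb : 0 < b := h.pos.trans hS.lt_left
  obtain ⟨h1, h2⟩ := moment_boundary hb hS.lt hS.mem (hu.continuousOn_normalFlux h hS)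
    (fun r hr => LaurentSummable.nat_mul hb hu.summable hr) fun w hw => (hu.fderiv_eq h hS hw).2
  refine ⟨fun k => ?_, h2⟩
  rw [h1]
  simp only [map_neg, map_mul, map_div₀, map_natCast, neg_div]
  ring

/-- The Fourier coefficients of the normal derivative, a continuous function, are bounded; the
factor `k` gained by the differentiation gives the decay of the coefficients of the field itself. -/
theorem IsSideField.exists_coeff_bound (h : HasGrunskyExpansion γ Ψ a ρ K)
    (hS : IsSide γ Ψ ρ S Z b c) (hu : IsSideField Ψ S Z b c u p q E) :
    ∃ B : ℝ, 0 ≤ B ∧ ∀ k : ℕ+,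
      ‖p k * γ ^ (k : ℕ) - (starRingEnd ℂ) (q k / γ ^ (k : ℕ))‖ ≤ B / (k : ℕ) := by
  have hγ := h.radius_pos
  obtain ⟨B, hB⟩ := (isCompact_sphere (0 : ℂ) γ).exists_bound_of_continuousOn
    ((hu.continuousOn_normalFlux h hS).mono hS.sphere_subset)
  refine ⟨max B 0 * 2, by positivity, fun k => ?_⟩
  have h1 := norm_moment_le hγ (B := max B 0)
    (fun w hw => (hB w (by simpa using hw)).trans (le_max_left _ _)) (k : ℤ)
  rw [(hu.moment_normalFlux h hS).1 k, norm_mul, norm_mul, Complex.norm_real, Complex.norm_natCast,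
    Real.norm_of_nonneg Real.pi_pos.le] at h1
  have hk : (0 : ℝ) < (k : ℕ) := by exact_mod_cast k.pos
  rw [le_div_iff₀ hk]
  refine le_of_mul_le_mul_left ?_ Real.pi_pos
  linarith

theorem IsSide.nhdsWithin_neBot (h : HasGrunskyExpansion γ Ψ a ρ K) (hS : IsSide γ Ψ ρ S Z b c)
    {w₀ : ℂ} (hw : ‖w₀‖ = γ) : (𝓝[S] (Ψ w₀)).NeBot := by
  have hγ := h.radius_pos
  have hγc : (γ : ℂ) ≠ 0 := by exact_mod_cast hγ.ne'
  have hbpos : 0 < b := h.pos.trans hS.lt_left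
  rw [← mem_closure_iff_nhdsWithin_neBot]
  have h1 : γ ∈ closure (Ioo b c) := by rw [closure_Ioo hS.lt.ne]; exact hS.mem
  have hc : ContinuousAt (fun r : ℝ => Ψ (r * (w₀ / γ))) γ := by
    have e : ((γ : ℝ) : ℂ) * (w₀ / γ) = w₀ := by field_simp
    have : ContinuousAt Ψ (((γ : ℝ) : ℂ) * (w₀ / γ)) := by
      rw [e]; exact h.continuousAt (hw ▸ h.lt)
    exact ContinuousAt.comp (f := fun r : ℝ => (r : ℂ) * (w₀ / γ)) this (by fun_prop)
  have h2 := hc.continuousWithinAt (s := Ioo b c) |>.mem_closure_image h1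
  have e : ((γ : ℝ) : ℂ) * (w₀ / γ) = w₀ := by field_simp
  rw [e] at h2
  refine closure_mono ?_ h2
  rintro _ ⟨r, hr, rfl⟩
  refine hS.mem_side _ ?_
  rw [norm_mul, norm_div, hw, Complex.norm_real, Complex.norm_real, Real.norm_of_nonneg hγ.le,
    div_self hγ.ne', mul_one, Real.norm_of_nonneg (hbpos.trans hr.1).le]
  exact hr

/-- The one-sided normal derivative of a finite superposition of fields. Its gradient is the sum of
the gradients near the boundary, where the fields are known to be differentiable. -/
theorem hasNormalTrace_sum (h : HasGrunskyExpansion γ Ψ a ρ K) (hS : IsSide γ Ψ ρ S Z b c)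
    {ι : Type*} (J : Finset ι) {u : ι → ℂ → ℝ} {p q : ι → ℕ+ → ℂ} {E : ι → ℂ → (ℂ →L[ℝ] ℝ)}
    (hu : ∀ i, IsSideField Ψ S Z b c (u i) (p i) (q i) (E i)) {w₀ : ℂ} (hw : ‖w₀‖ = γ) (ν : ℂ) :
    HasNormalTrace S (fun z => ∑ i ∈ J, u i z) (Ψ w₀) ν (∑ i ∈ J, E i (Ψ w₀) ν) := by
  have hwρ : ρ < ‖w₀‖ := hw ▸ h.lt
  have hmap : map Ψ (𝓝 w₀) = 𝓝 (Ψ w₀) :=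
    (h.hasStrictDerivAt hwρ).map_nhds_eq (h.deriv_ne_zero hwρ)
  have hev : ∀ᶠ z in 𝓝[S] (Ψ w₀), fderiv ℝ (fun z => ∑ i ∈ J, u i z) z ν = ∑ i ∈ J, E i z ν := by
    rw [eventually_nhdsWithin_iff, ← hmap, eventually_map]
    filter_upwards [hS.near w₀ hw] with w hw1 hwS
    have hwI := hw1 hwS
    rw [fderiv_fun_sum fun i _ => ((hu i).fderiv_eq h hS hwI).1, sum_apply]
    refine Finset.sum_congr rfl fun i _ => ?_
    rw [(hu i).grad _ hwS]
  have hZ : Ψ w₀ ∈ Z := hS.mem_closed w₀ (hw ▸ hS.mem)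
  have hlim : Tendsto (fun z => ∑ i ∈ J, E i z ν) (𝓝[S] (Ψ w₀)) (𝓝 (∑ i ∈ J, E i (Ψ w₀) ν)) := by
    refine tendsto_finsetSum _ fun i _ => ?_
    have hc : ContinuousWithinAt (fun z => E i z ν) Z (Ψ w₀) :=
      ((hu i).cont _ hZ).clm_apply continuousWithinAt_const
    exact (hc.mono hS.subset).tendsto
  exact hlim.congr' (hev.mono fun z hz => hz.symm)

theorem normalFlux_eq (E : ℂ → (ℂ →L[ℝ] ℝ)) (w : ℂ) :
    E (Ψ w) (outwardNormal Ψ w) = ‖w * deriv Ψ w‖⁻¹ * normalFlux Ψ E w := by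
  have : outwardNormal Ψ w = ‖w * deriv Ψ w‖⁻¹ • (w * deriv Ψ w) := by
    rw [outwardNormal, Complex.real_smul, div_eq_inv_mul]
    push_cast
    rfl
  rw [this, map_smul, smul_eq_mul, normalFlux]

variable {D : Set ℂ} {S₁ Z₁ S₂ Z₂ : Set ℂ} {b₁ c₁ b₂ c₂ σm σc : ℝ}

/-- The flux condition, compared through the Fourier coefficients of both sides. -/
theorem fluxContinuous_sum_iff (h : HasGrunskyExpansion γ Ψ a ρ K)
    (hS₁ : IsSide γ Ψ ρ (closure D)ᶜ Z₁ b₁ c₁) (hS₂ : IsSide γ Ψ ρ D Z₂ b₂ c₂)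
    {ι : Type*} (J : Finset ι) {u : ι → ℂ → ℝ} {p₁ q₁ p₂ q₂ : ι → ℕ+ → ℂ}
    {E₁ E₂ : ι → ℂ → (ℂ →L[ℝ] ℝ)}
    (hu₁ : ∀ i, IsSideField Ψ (closure D)ᶜ Z₁ b₁ c₁ (u i) (p₁ i) (q₁ i) (E₁ i))
    (hu₂ : ∀ i, IsSideField Ψ D Z₂ b₂ c₂ (u i) (p₂ i) (q₂ i) (E₂ i)) :
    FluxContinuous σm σc D γ Ψ (fun z => ∑ i ∈ J, u i z) ↔
      ∀ k : ℕ+,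
        σm * ∑ i ∈ J, (p₁ i k * γ ^ (k : ℕ) - (starRingEnd ℂ) (q₁ i k / γ ^ (k : ℕ))) =
        σc * ∑ i ∈ J, (p₂ i k * γ ^ (k : ℕ) - (starRingEnd ℂ) (q₂ i k / γ ^ (k : ℕ))) := by
  have hγ := h.radius_pos
  set g : ℂ → ℝ := fun w => σm * ∑ i ∈ J, normalFlux Ψ (E₁ i) w -
    σc * ∑ i ∈ J, normalFlux Ψ (E₂ i) w with hg
  have hc₁ : ∀ i, ContinuousOn (normalFlux Ψ (E₁ i)) (sphere 0 γ) := fun i =>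
    ((hu₁ i).continuousOn_normalFlux h hS₁).mono hS₁.sphere_subset
  have hc₂ : ∀ i, ContinuousOn (normalFlux Ψ (E₂ i)) (sphere 0 γ) := fun i =>
    ((hu₂ i).continuousOn_normalFlux h hS₂).mono hS₂.sphere_subset
  have hcs₁ : ContinuousOn (fun w => ∑ i ∈ J, normalFlux Ψ (E₁ i) w) (sphere 0 γ) :=
    continuousOn_finsetSum _ fun i _ => hc₁ i
  have hcs₂ : ContinuousOn (fun w => ∑ i ∈ J, normalFlux Ψ (E₂ i) w) (sphere 0 γ) :=
    continuousOn_finsetSum _ fun i _ => hc₂ i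
  have hgc : ContinuousOn g (sphere 0 γ) :=
    (continuousOn_const.mul hcs₁).sub (continuousOn_const.mul hcs₂)
  have hmom : ∀ j, moment g γ j = σm * ∑ i ∈ J, moment (normalFlux Ψ (E₁ i)) γ j -
      σc * ∑ i ∈ J, moment (normalFlux Ψ (E₂ i)) γ j := by
    intro j
    rw [hg, moment_const_mul_sub hγ hcs₁ hcs₂, moment_sum J hγ fun i _ => hc₁ i,
      moment_sum J hγ fun i _ => hc₂ i]
  have hmk : ∀ k : ℕ+, moment g γ (k : ℤ) = Real.pi * k *
      (σm * ∑ i ∈ J, (p₁ i k * γ ^ (k : ℕ) - (starRingEnd ℂ) (q₁ i k / γ ^ (k : ℕ))) -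
        σc * ∑ i ∈ J, (p₂ i k * γ ^ (k : ℕ) - (starRingEnd ℂ) (q₂ i k / γ ^ (k : ℕ)))) := by
    intro k
    rw [hmom, Finset.sum_congr rfl fun i _ => ((hu₁ i).moment_normalFlux h hS₁).1 k,
      Finset.sum_congr rfl fun i _ => ((hu₂ i).moment_normalFlux h hS₂).1 k,
      ← Finset.mul_sum, ← Finset.mul_sum]
    ring
  have hflux : FluxContinuous σm σc D γ Ψ (fun z => ∑ i ∈ J, u i z) ↔
      ∀ w : ℂ, ‖w‖ = γ → g w = 0 := by
    refine forall₂_congr fun w hw => ?_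
    have t₁ := hasNormalTrace_sum h hS₁ J hu₁ hw (outwardNormal Ψ w)
    have t₂ := hasNormalTrace_sum h hS₂ J hu₂ hw (outwardNormal Ψ w)
    simp only [normalFlux_eq, ← Finset.mul_sum] at t₁ t₂
    have hn : ‖w * deriv Ψ w‖ ≠ 0 := by
      have hwρ : ρ < ‖w‖ := hw ▸ h.lt
      exact norm_ne_zero_iff.2 (mul_ne_zero (norm_pos_iff.1 (h.pos.trans hwρ))
        (h.deriv_ne_zero hwρ))
    have e : g w = 0 ↔ σm * (‖w * deriv Ψ w‖⁻¹ * ∑ i ∈ J, normalFlux Ψ (E₁ i) w) =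
        σc * (‖w * deriv Ψ w‖⁻¹ * ∑ i ∈ J, normalFlux Ψ (E₂ i) w) := by
      simp only [hg]
      rw [sub_eq_zero, mul_left_comm σm, mul_left_comm σc, mul_right_inj' (inv_ne_zero hn)]
    rw [e]
    constructor
    · rintro ⟨gp, gm, hp, hm, heq⟩
      have := hS₁.nhdsWithin_neBot h hw
      have := hS₂.nhdsWithin_neBot h hw
      rw [tendsto_nhds_unique t₁ hp, tendsto_nhds_unique t₂ hm]
      exact heq
    · exact fun heq => ⟨_, _, t₁, t₂, heq⟩
  rw [hflux]
  constructor
  · intro h0 k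
    have h1 : moment g γ (k : ℤ) = 0 := by
      rw [moment_congr hγ (h' := fun _ => 0) h0]
      simp [moment]
    rw [hmk] at h1
    have hpk : (Real.pi * k : ℂ) ≠ 0 := by
      refine mul_ne_zero (by exact_mod_cast Real.pi_ne_zero) ?_
      exact_mod_cast k.ne_zero
    exact sub_eq_zero.1 ((mul_eq_zero.1 h1).resolve_left hpk)
  · intro hk w hw
    have hpos : ∀ k : ℕ+, moment g γ (k : ℤ) = 0 := fun k => by
      rw [hmk, hk k, sub_self, mul_zero]
    refine eq_zero_of_moment_eq_zero hγ hgc (fun j => ?_) hw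
    rcases lt_trichotomy j 0 with hj | rfl | hj
    · obtain ⟨n, rfl⟩ : ∃ n : ℕ, j = -(n : ℤ) := ⟨j.natAbs, by omega⟩
      have hn : 0 < n := by omega
      have := hpos ⟨n, hn⟩
      rw [moment_neg]
      simp only [PNat.mk_coe] at this
      rw [this, map_zero]
    · rw [hmom, Finset.sum_congr rfl fun i _ => ((hu₁ i).moment_normalFlux h hS₁).2,
        Finset.sum_congr rfl fun i _ => ((hu₂ i).moment_normalFlux h hS₂).2]
      simp
    · obtain ⟨n, rfl⟩ : ∃ n : ℕ, j = (n : ℤ) := ⟨j.natAbs, by omega⟩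
      have hn : 0 < n := by omega
      exact hpos ⟨n, hn⟩

end Gradient

/-! ### The two sides of the boundary and the mode expansions -/

section Modes

variable {D : Set ℂ} {γ : ℝ} {Ψ : ℂ → ℂ} {a : ℕ → ℂ} {ρ K : ℝ}

theorem IsExteriorMap.isSide_interior (hD : IsExteriorMap D γ Ψ a)
    (h : HasGrunskyExpansion γ Ψ a ρ K) {b : ℝ} (hb : ρ < b) (hbγ : b < γ) :
    IsSide γ Ψ ρ D (closure D) b γ where
  lt_left := hb
  lt := hbγ
  mem := ⟨hbγ.le, le_rfl⟩
  subset := subset_closure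
  mem_closed w hw := by
    rcases hw.2.eq_or_lt with h1 | h1
    · exact frontier_subset_closure (hD.mem_frontier h1)
    · exact subset_closure (hD.mem_interior h (hb.trans_le hw.1) h1)
  mem_side w hw := hD.mem_interior h (hb.trans hw.1) hw.2
  near w₀ hw₀ := by
    have h1 : ∀ᶠ w in 𝓝 w₀, b < ‖w‖ :=
      (isOpen_lt continuous_const continuous_norm).mem_nhds (by rw [mem_ofPred_eq, hw₀]; exact hbγ)
    filter_upwards [h1] with w hw hwD
    refine ⟨hw, lt_of_not_ge fun hge => ?_⟩
    rcases hge.eq_or_lt with h2 | h2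
    · have := hD.mem_frontier h2.symm
      rw [hD.isOpen.frontier_eq] at this
      exact this.2 hwD
    · exact hD.mem_exterior h2 (subset_closure hwD)

theorem IsExteriorMap.isSide_exterior (hD : IsExteriorMap D γ Ψ a)
    (h : HasGrunskyExpansion γ Ψ a ρ K) :
    IsSide γ Ψ ρ (closure D)ᶜ Dᶜ γ (γ + 1) where
  lt_left := h.lt
  lt := by linarith
  mem := ⟨le_rfl, by linarith⟩
  subset := compl_subset_compl.2 subset_closure
  mem_closed w hw := by
    rcases hw.1.eq_or_lt with h1 | h1
    · have := hD.mem_frontier h1.symm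
      rw [hD.isOpen.frontier_eq] at this
      exact this.2
    · exact fun hc => hD.mem_exterior h1 (subset_closure hc)
  mem_side w hw := hD.mem_exterior hw.1
  near w₀ hw₀ := by
    have h1 : ∀ᶠ w in 𝓝 w₀, ρ < ‖w‖ ∧ ‖w‖ < γ + 1 :=
      (isOpen_annulus ρ (γ + 1)).mem_nhds ⟨hw₀ ▸ h.lt, by rw [hw₀]; linarith⟩
    filter_upwards [h1] with w hw hwD
    refine ⟨lt_of_not_ge fun hge => ?_, hw.2⟩
    rcases hge.eq_or_lt with h2 | h2
    · exact hwD (frontier_subset_closure (hD.mem_frontier h2))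
    · exact hwD (subset_closure (hD.mem_interior h hw.1 h2))

/-- Since `F_k(Ψ(v)) = v ^ k + O(ρ ^ k)`, convergence of a Faber series at the points `Ψ v` bounds
its coefficients as in the case of a power series. -/
theorem HasGrunskyExpansion.summable_of_summable_faber (h : HasGrunskyExpansion γ Ψ a ρ K)
    {β : ℕ+ → ℂ} {v : ℂ} (hv : ρ < ‖v‖)
    (hs : Summable fun k : ℕ+ => β k * (faber a k).eval (Ψ v)) :
    Summable fun k : ℕ+ => ‖β k‖ * ‖v‖ ^ (k : ℕ) := by
  have h0 := h.pos
  have hv0 : 0 < ‖v‖ := h0.trans hv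
  have hK := h.nonneg
  have hgeo := summable_geometric_pnat (x := ρ / ‖v‖) (by positivity) ((div_lt_one hv0).2 hv)
  set G := ∑' n : ℕ+, (ρ / ‖v‖) ^ (n : ℕ) with hG
  have hb : ∀ m : ℕ+, ‖(faber a m).eval (Ψ v) - v ^ (m : ℕ)‖ ≤ K * ρ ^ (m : ℕ) * G := by
    intro m
    rw [← (h.hasSum m v hv).tsum_eq]
    refine tsum_of_norm_bounded (hgeo.hasSum.mul_left (K * ρ ^ (m : ℕ))) fun n => ?_
    rw [norm_div, norm_pow, div_pow, mul_div_assoc']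
    gcongr
    exact h.bound m n
  have hev : ∀ᶠ k : ℕ+ in cofinite, K * G * (ρ / ‖v‖) ^ (k : ℕ) < 1 / 2 := by
    have : Tendsto (fun k : ℕ+ => K * G * (ρ / ‖v‖) ^ (k : ℕ)) cofinite (𝓝 (K * G * 0)) :=
      hgeo.tendsto_cofinite_zero.const_mul _
    rw [mul_zero] at this
    exact this.eventually (gt_mem_nhds (by norm_num))
  refine Summable.of_norm_bounded_eventually (hs.norm.mul_left 2) ?_
  filter_upwards [hev] with k hk
  have h1 : K * ρ ^ (k : ℕ) * G ≤ ‖v‖ ^ (k : ℕ) / 2 := by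
    rw [div_pow, mul_div_assoc', div_lt_iff₀ (by positivity)] at hk
    linarith
  have h2 : ‖v‖ ^ (k : ℕ) / 2 ≤ ‖(faber a k).eval (Ψ v)‖ := by
    have h3 := norm_sub_norm_le (v ^ (k : ℕ)) ((faber a k).eval (Ψ v))
    rw [norm_sub_rev, norm_pow] at h3
    have h4 := hb k
    linarith
  rw [norm_mul, norm_norm, norm_mul, norm_pow, norm_norm]
  have := mul_le_mul_of_nonneg_left h2 (norm_nonneg (β k))
  linarith

theorem norm_ofReal_of_pos {r : ℝ} (hr : 0 < r) : ‖(r : ℂ)‖ = r := by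
  rw [Complex.norm_real, Real.norm_of_nonneg hr.le]

theorem HasModeExpansion.summable_int_coeff (hD : IsExteriorMap D γ Ψ a)
    (h : HasGrunskyExpansion γ Ψ a ρ K) {m : ℕ+} {αm : ℂ} {β s : ℕ+ → ℂ} {u : ℂ → ℝ}
    (hu : HasModeExpansion D γ Ψ a m αm β s u) {r : ℝ} (hr : r ∈ Ioo ρ γ) :
    Summable fun k : ℕ+ => ‖β k‖ * r ^ (k : ℕ) := by
  have hn := norm_ofReal_of_pos (h.pos.trans hr.1)
  have := h.summable_of_summable_faber (v := r) (hn.symm ▸ hr.1)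
    (hu.summable_int _ (hD.mem_interior h (hn.symm ▸ hr.1) (hn.symm ▸ hr.2)))
  rwa [hn] at this

theorem HasModeExpansion.isSideField_interior (hD : IsExteriorMap D γ Ψ a)
    (h : HasGrunskyExpansion γ Ψ a ρ K) {b : ℝ} (hb : ρ < b)
    {m : ℕ+} {αm : ℂ} {β s : ℕ+ → ℂ} {u : ℂ → ℝ} (hu : HasModeExpansion D γ Ψ a m αm β s u)
    {E : ℂ → (ℂ →L[ℝ] ℝ)} (hE : ContinuousOn E (closure D)) (hE' : ∀ z ∈ D, E z = fderiv ℝ u z) :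
    IsSideField Ψ D (closure D) b γ u β (rowMul β (grunsky γ Ψ a)) E where
  summable r hr := h.laurentSummable_rowMul (hb.trans hr.1)
    (hu.summable_int_coeff hD h ⟨hb.trans hr.1, hr.2⟩)
  eq w hw := by
    rw [hu.eq_int _ (hD.mem_interior h (hb.trans hw.1) hw.2),
      (h.hasSum_faber_comp (hb.trans hw.1)
        (hu.summable_int_coeff hD h ⟨hb.trans hw.1, hw.2⟩)).tsum_eq]
  cont := hE
  grad := hE'

theorem HasModeExpansion.isSideField_exterior
    (h : HasGrunskyExpansion γ Ψ a ρ K) {m : ℕ+} {αm : ℂ} {β s : ℕ+ → ℂ} {u : ℂ → ℝ}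
    (hu : HasModeExpansion D γ Ψ a m αm β s u)
    {E : ℂ → (ℂ →L[ℝ] ℝ)} (hE : ContinuousOn E Dᶜ) (hE' : ∀ z ∈ (closure D)ᶜ, E z = fderiv ℝ u z) :
    IsSideField Ψ (closure D)ᶜ Dᶜ γ (γ + 1) u (Pi.single m αm)
      (fun n => αm * grunsky γ Ψ a m n + s n) E where
  summable r hr := by
    have hr0 : 0 < r := h.radius_pos.trans hr.1
    have hn := norm_ofReal_of_pos hr0
    constructor
    · refine summable_of_ne_finset_zero (s := {m}) fun i hi => ?_
      rw [Pi.single_eq_of_ne (by simpa using hi)]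
      simp
    · have s1 := ((h.hasSum m r (hn.symm ▸ h.lt.trans hr.1)).summable.mul_left αm).add
        (hu.summable_ext r (hn.symm ▸ hr.1))
      refine s1.norm.congr fun n => ?_
      rw [← mul_div_assoc, ← add_div, norm_div, norm_pow, hn]
  eq w hw := by
    have s1 := (h.hasSum m w (h.lt.trans hw.1)).mul_left αm
    have s2 := (hu.summable_ext w hw.1).hasSum
    have s3 : HasSum (fun n : ℕ+ => (Pi.single m αm : ℕ+ → ℂ) n * w ^ (n : ℕ))
        (αm * w ^ (m : ℕ)) := by
      refine (hasSum_ite_eq m (αm * w ^ (m : ℕ))).congr_fun fun n => ?_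
      by_cases hn : n = m
      · subst hn; simp
      · simp [hn]
    have s4 : HasSum (fun n : ℕ+ => (αm * grunsky γ Ψ a m n + s n) / w ^ (n : ℕ))
        (αm * ((faber a m).eval (Ψ w) - w ^ (m : ℕ)) + ∑' n : ℕ+, s n / w ^ (n : ℕ)) := by
      refine (s1.add s2).congr_fun fun n => ?_
      ring
    rw [hu.eq_ext w hw.1, laurent, (s3.add s4).tsum_eq, ← Complex.add_re]
    congr 1
    ring
  cont := hE
  grad := hE'

/-! ### The coefficients as elements of `ℓ²` -/

theorem memℓp_two_of_norm_le {f : ℕ+ → ℂ} {B V x : ℝ} (hx : 0 ≤ x) (hx1 : x < 1)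
    (hf : ∀ k : ℕ+, ‖f k‖ ≤ B / (k : ℕ) + V * x ^ (k : ℕ)) : Memℓp f 2 := by
  refine memℓp_gen ?_
  have hB : Summable fun k : ℕ+ => 2 * B ^ 2 * (1 / ((k : ℕ) : ℝ) ^ 2) :=
    (((Real.summable_one_div_nat_pow (p := 2)).2 one_lt_two).comp_injective
      PNat.coe_injective).mul_left _
  have hV : Summable fun k : ℕ+ => 2 * V ^ 2 * (x ^ 2) ^ (k : ℕ) :=
    (summable_geometric_pnat (by positivity) (by nlinarith)).mul_left _
  refine Summable.of_nonneg_of_le (fun k => by positivity) (fun k => ?_) (hB.add hV)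
  have h2 : (2 : ENNReal).toReal = (2 : ℕ) := by simp
  rw [h2, Real.rpow_natCast]
  have h1 := pow_le_pow_left₀ (norm_nonneg _) (hf k) 2
  have h3 : (B / (k : ℕ) + V * x ^ (k : ℕ)) ^ 2 ≤
      2 * (B / (k : ℕ)) ^ 2 + 2 * (V * x ^ (k : ℕ)) ^ 2 := by
    nlinarith [sq_nonneg (B / (k : ℕ) - V * x ^ (k : ℕ))]
  refine (h1.trans h3).trans (le_of_eq ?_)
  rw [div_pow, mul_pow, ← pow_mul, mul_comm (k : ℕ) 2, pow_mul]
  ring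

theorem norm_single_mul_pow_le (hγ : 0 < γ) (m : ℕ+) (αm : ℂ) :
    ∀ k : ℕ+, ‖(Pi.single m αm : ℕ+ → ℂ) k * (γ : ℂ) ^ (k : ℕ)‖ ≤
      ‖αm‖ * γ ^ (m : ℕ) * (m : ℕ) / (k : ℕ) := by
  intro k
  by_cases hk : k = m
  · subst hk
    have : (0 : ℝ) < (k : ℕ) := by exact_mod_cast k.pos
    rw [Pi.single_eq_same, norm_mul, norm_pow, norm_ofReal_of_pos hγ,
      mul_div_cancel_right₀ _ this.ne']
  · rw [Pi.single_eq_of_ne hk]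
    simp only [zero_mul, norm_zero]
    positivity

/-- The row `s γ ^ (-𝒩)` of a field that is continuously differentiable up to the boundary belongs
to `ℓ²`. -/
theorem exists_ext_coeff (h : HasGrunskyExpansion γ Ψ a ρ K) {S Z : Set ℂ} {b c : ℝ}
    (hS : IsSide γ Ψ ρ S Z b c) {m : ℕ+} {αm : ℂ} {s : ℕ+ → ℂ} {u : ℂ → ℝ} {E : ℂ → (ℂ →L[ℝ] ℝ)}
    (hu : IsSideField Ψ S Z b c u (Pi.single m αm) (fun n => αm * grunsky γ Ψ a m n + s n) E) :
    ∃ σ : EllTwo, ∀ k : ℕ+, σ k = s k / (γ : ℂ) ^ (k : ℕ) := by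
  have h0 := h.pos
  have hγ := h.radius_pos
  have hnγ := norm_ofReal_of_pos hγ
  obtain ⟨B, hB0, hB⟩ := hu.exists_coeff_bound h hS
  refine ⟨⟨fun k => s k / (γ : ℂ) ^ (k : ℕ), memℓp_two_of_norm_le
    (B := ‖αm‖ * γ ^ (m : ℕ) * (m : ℕ) + B) (V := ‖αm‖ * (K * ρ ^ (m : ℕ))) (x := ρ / γ)
    (by positivity) ((div_lt_one hγ).2 h.lt) fun k => ?_⟩, fun k => rfl⟩
  have h1 := hB k
  have h2 := norm_single_mul_pow_le hγ m αm k
  have h3 : ‖αm * grunsky γ Ψ a m k / (γ : ℂ) ^ (k : ℕ)‖ ≤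
      ‖αm‖ * (K * ρ ^ (m : ℕ)) * (ρ / γ) ^ (k : ℕ) := by
    rw [norm_div, norm_mul, norm_pow, hnγ, div_pow, ← mul_div_assoc, mul_assoc]
    gcongr
    exact h.bound m k
  set x := (Pi.single m αm : ℕ+ → ℂ) k * (γ : ℂ) ^ (k : ℕ) with hx
  set y := (αm * grunsky γ Ψ a m k + s k) / (γ : ℂ) ^ (k : ℕ) with hy
  have e : s k / (γ : ℂ) ^ (k : ℕ) = y - αm * grunsky γ Ψ a m k / (γ : ℂ) ^ (k : ℕ) := by
    rw [hy]; ring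
  have h4 : ‖y‖ ≤ ‖x‖ + B / (k : ℕ) := by
    have := norm_sub_norm_le ((starRingEnd ℂ) y) x
    rw [norm_sub_rev, Complex.norm_conj] at this
    linarith
  rw [e, add_div]
  refine (norm_sub_le _ _).trans ?_
  linarith

/-- The row `(β - κ α) γ ^ 𝒩` of a field that is continuously differentiable up to the boundary
belongs to `ℓ²`, where `α` has the single entry `αm` at `m`. -/
theorem exists_int_coeff (h : HasGrunskyExpansion γ Ψ a ρ K) {S Z : Set ℂ} {b c : ℝ}
    (hS : IsSide γ Ψ ρ S Z b c) {β : ℕ+ → ℂ} {u : ℂ → ℝ} {E : ℂ → (ℂ →L[ℝ] ℝ)}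
    (hβ : Summable fun k : ℕ+ => ‖β k‖ * ρ ^ (k : ℕ))
    (hu : IsSideField Ψ S Z b c u β (rowMul β (grunsky γ Ψ a)) E) (κ : ℝ) (m : ℕ+) (αm : ℂ) :
    ∃ y : EllTwo, ∀ k : ℕ+,
      y k = (β k - κ * (Pi.single m αm : ℕ+ → ℂ) k) * (γ : ℂ) ^ (k : ℕ) := by
  have h0 := h.pos
  have hγ := h.radius_pos
  have hnγ := norm_ofReal_of_pos hγ
  obtain ⟨B, hB0, hB⟩ := hu.exists_coeff_bound h hS
  set V := K * ∑' k : ℕ+, ‖β k‖ * ρ ^ (k : ℕ) with hV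
  refine ⟨⟨fun k => (β k - κ * (Pi.single m αm : ℕ+ → ℂ) k) * (γ : ℂ) ^ (k : ℕ),
    memℓp_two_of_norm_le (B := |κ| * (‖αm‖ * γ ^ (m : ℕ) * (m : ℕ)) + B) (V := V) (x := ρ / γ)
    (by positivity) ((div_lt_one hγ).2 h.lt) fun k => ?_⟩, fun k => rfl⟩
  have h1 := hB k
  have h2 := norm_single_mul_pow_le hγ m αm k
  have h3 : ‖rowMul β (grunsky γ Ψ a) k / (γ : ℂ) ^ (k : ℕ)‖ ≤ V * (ρ / γ) ^ (k : ℕ) := by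
    rw [norm_div, norm_pow, hnγ, div_pow, ← mul_div_assoc]
    gcongr
    exact h.norm_rowMul_le hβ k
  set x := (Pi.single m αm : ℕ+ → ℂ) k * (γ : ℂ) ^ (k : ℕ) with hx
  set z := rowMul β (grunsky γ Ψ a) k / (γ : ℂ) ^ (k : ℕ) with hz
  have h4 : ‖β k * (γ : ℂ) ^ (k : ℕ)‖ ≤ B / (k : ℕ) + ‖z‖ := by
    have := norm_sub_norm_le (β k * (γ : ℂ) ^ (k : ℕ)) ((starRingEnd ℂ) z)
    rw [Complex.norm_conj] at this
    linarith
  have e : (β k - κ * (Pi.single m αm : ℕ+ → ℂ) k) * (γ : ℂ) ^ (k : ℕ) =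
      β k * (γ : ℂ) ^ (k : ℕ) - κ * x := by rw [hx]; ring
  rw [e, add_div, mul_div_assoc]
  refine (norm_sub_le _ _).trans ?_
  rw [norm_mul (κ : ℂ) x, Complex.norm_real, Real.norm_eq_abs]
  have h5 := mul_le_mul_of_nonneg_left h2 (abs_nonneg κ)
  linarith

end Modes

/-! ### The matrix identity -/

theorem rowAct_sum (T : EllTwo →L[ℂ] EllTwo) {ι : Type*} (J : Finset ι) (y : ι → EllTwo) :
    rowAct T (∑ i ∈ J, y i) = ∑ i ∈ J, rowAct T (y i) :=
  map_sum (AddMonoidHom.mk' (rowAct T) (rowAct_add T)) y J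

section Formula

variable {γ : ℝ} {Ψ : ℂ → ℂ} {a : ℕ → ℂ} {ρ K : ℝ} {S S' T : EllTwo →L[ℂ] EllTwo}
  {M s : Matrix ℕ+ ℕ+ ℂ} {σ : ℕ+ → EllTwo}

theorem hasSum_source (hγ : 0 < γ)
    (hS : ∀ m n, S (basisVec n) m =
        grunsky γ Ψ a m n / ((γ : ℂ) ^ (m : ℕ) * (γ : ℂ) ^ (n : ℕ)))
    (hSS' : IsConjOf S S') (hσ : ∀ m k : ℕ+, σ m k = s m k / (γ : ℂ) ^ (k : ℕ)) (m n : ℕ+) :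
    HasSum (fun k => (s ⊙ gammaPow γ (-2)) m k * conjMat (grunsky γ Ψ a) k n)
      ((γ : ℂ) ^ (n : ℕ) * rowAct S' (σ m) n) := by
  have hγc : (γ : ℂ) ≠ 0 := by exact_mod_cast hγ.ne'
  refine ((hasSum_rowAct S' (σ m) n).mul_left ((γ : ℂ) ^ (n : ℕ))).congr_fun fun k => ?_
  rw [infMul_gammaPow hγ, hSS', hS, hσ, conjMat]
  simp only [map_div₀, map_mul, map_pow, Complex.conj_ofReal]
  field_simp

theorem sourceMat_apply (hγ : 0 < γ)
    (hS : ∀ m n, S (basisVec n) m =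
        grunsky γ Ψ a m n / ((γ : ℂ) ^ (m : ℕ) * (γ : ℂ) ^ (n : ℕ)))
    (hSS' : IsConjOf S S') (hσ : ∀ m k : ℕ+, σ m k = s m k / (γ : ℂ) ^ (k : ℕ)) (m n : ℕ+) :
    sourceMat γ (grunsky γ Ψ a) s m n =
      (γ : ℂ) ^ (n : ℕ) * (star (σ m) + rowAct S' (σ m)) n := by
  have hγc : (γ : ℂ) ≠ 0 := by exact_mod_cast hγ.ne'
  have e : ((s ⊙ gammaPow γ (-2)) ⊙ conjMat (grunsky γ Ψ a)) m n =
      (γ : ℂ) ^ (n : ℕ) * rowAct S' (σ m) n := (hasSum_source hγ hS hSS' hσ m n).tsum_eq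
  have e2 : star (σ m n) = (starRingEnd ℂ) (s m n) / (γ : ℂ) ^ (n : ℕ) := by
    rw [hσ, ← starRingEnd_apply]
    simp only [map_div₀, map_pow, Complex.conj_ofReal]
  rw [sourceMat, Matrix.add_apply, e, lp.coeFn_add, Pi.add_apply, lp.star_apply, e2, conjMat]
  field_simp

theorem hasSum_sourceMat_mul (hγ : 0 < γ)
    (hS : ∀ m n, S (basisVec n) m =
        grunsky γ Ψ a m n / ((γ : ℂ) ^ (m : ℕ) * (γ : ℂ) ^ (n : ℕ)))
    (hSS' : IsConjOf S S') (hσ : ∀ m k : ℕ+, σ m k = s m k / (γ : ℂ) ^ (k : ℕ))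
    (hT : Represents γ T M) (m n : ℕ+) :
    HasSum (fun k => sourceMat γ (grunsky γ Ψ a) s m k * M k n)
      ((γ : ℂ) ^ (n : ℕ) * rowAct T (star (σ m) + rowAct S' (σ m)) n) := by
  have hγc : (γ : ℂ) ≠ 0 := by exact_mod_cast hγ.ne'
  refine ((hasSum_rowAct T (star (σ m) + rowAct S' (σ m)) n).mul_left
    ((γ : ℂ) ^ (n : ℕ))).congr_fun fun k => ?_
  rw [sourceMat_apply hγ hS hSS' hσ, hT.apply_eq hγ]
  field_simp

/-- The right-hand side of the identity, in the coordinates of `ℓ²`. -/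
theorem betaFormula_apply (hγ : 0 < γ)
    (hS : ∀ m n, S (basisVec n) m =
        grunsky γ Ψ a m n / ((γ : ℂ) ^ (m : ℕ) * (γ : ℂ) ^ (n : ℕ)))
    (hSS' : IsConjOf S S') (hσ : ∀ m k : ℕ+, σ m k = s m k / (γ : ℂ) ^ (k : ℕ))
    (hT : Represents γ T M) (σm σc : ℝ) (α : ℕ+ → ℂ) (m n : ℕ+) :
    betaFormula σm σc γ (grunsky γ Ψ a) M α s m n =
      ((σm / σc : ℝ) : ℂ) * (Pi.single m (α m) : ℕ+ → ℂ) n -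
        ((σm / σc : ℝ) : ℂ) *
          (rowAct T (star (σ m) + rowAct S' (σ m)) n / (γ : ℂ) ^ (n : ℕ)) := by
  have hγc : (γ : ℂ) ≠ 0 := by exact_mod_cast hγ.ne'
  have e : (sourceMat γ (grunsky γ Ψ a) s ⊙ M) m n =
      (γ : ℂ) ^ (n : ℕ) * rowAct T (star (σ m) + rowAct S' (σ m)) n :=
    (hasSum_sourceMat_mul hγ hS hSS' hσ hT m n).tsum_eq
  have e2 : Matrix.diagonal α m n = (Pi.single m (α m) : ℕ+ → ℂ) n := by
    by_cases h : n = m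
    · subst h; simp
    · rw [Matrix.diagonal_apply_ne _ (Ne.symm h), Pi.single_eq_of_ne h]
  rw [betaFormula, Matrix.sub_apply, Matrix.smul_apply, Matrix.smul_apply, infMul_gammaPow hγ, e,
    e2, smul_eq_mul, smul_eq_mul]
  field_simp

/-- The difference of the boundary coefficients of the two sides, in the coordinates of `ℓ²`. -/
theorem sub_rowAct_star_apply (h : HasGrunskyExpansion γ Ψ a ρ K)
    (hS : ∀ m n, S (basisVec n) m =
        grunsky γ Ψ a m n / ((γ : ℂ) ^ (m : ℕ) * (γ : ℂ) ^ (n : ℕ)))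
    (hSS' : IsConjOf S S') {m : ℕ+} {αm : ℂ} {β sm : ℕ+ → ℂ} {κ : ℝ} {y τ : EllTwo}
    (hβ : Summable fun k : ℕ+ => ‖β k‖ * ρ ^ (k : ℕ))
    (hy : ∀ k : ℕ+, y k = (β k - κ * (Pi.single m αm : ℕ+ → ℂ) k) * (γ : ℂ) ^ (k : ℕ))
    (hτ : ∀ k : ℕ+, τ k = sm k / (γ : ℂ) ^ (k : ℕ)) (k : ℕ+) :
    (y - rowAct S' (star y) + (κ : ℂ) • star τ) k =
      (β k * γ ^ (k : ℕ) - (starRingEnd ℂ) (rowMul β (grunsky γ Ψ a) k / γ ^ (k : ℕ))) -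
        κ * ((Pi.single m αm : ℕ+ → ℂ) k * γ ^ (k : ℕ) -
          (starRingEnd ℂ) ((αm * grunsky γ Ψ a m k + sm k) / γ ^ (k : ℕ))) := by
  have hγ := h.radius_pos
  have hγc : (γ : ℂ) ≠ 0 := by exact_mod_cast hγ.ne'
  have hrow : rowAct S y k =
      (rowMul β (grunsky γ Ψ a) k - κ * (αm * grunsky γ Ψ a m k)) / (γ : ℂ) ^ (k : ℕ) := by
    refine (hasSum_rowAct S y k).unique ?_
    have s1 : HasSum (fun j => (Pi.single m αm : ℕ+ → ℂ) j * grunsky γ Ψ a j k)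
        (αm * grunsky γ Ψ a m k) := by
      refine (hasSum_ite_eq m (αm * grunsky γ Ψ a m k)).congr_fun fun j => ?_
      by_cases hj : j = m
      · subst hj; simp
      · simp [hj]
    have s2 : HasSum (fun j => β j * grunsky γ Ψ a j k) (rowMul β (grunsky γ Ψ a) k) :=
      (h.summable_rowMul hβ k).hasSum
    refine ((s2.sub (s1.mul_left (κ : ℂ))).div_const ((γ : ℂ) ^ (k : ℕ))).congr_fun fun j => ?_
    rw [hy, hS]
    field_simp
  rw [hSS'.rowAct_star, lp.coeFn_add, lp.coeFn_sub, Pi.add_apply, Pi.sub_apply, lp.coeFn_smul,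
    Pi.smul_apply, lp.star_apply, lp.star_apply, hrow, hy, hτ, smul_eq_mul, ← starRingEnd_apply,
    ← starRingEnd_apply]
  simp only [map_div₀, map_mul, map_sub, map_add, map_pow, Complex.conj_ofReal]
  ring

end Formula

end FaberFlux

theorem mainTheorem5 {D : Set ℂ} {γ : ℝ} {Ψ : ℂ → ℂ} {a : ℕ → ℂ}
    (hD : FaberFlux.IsExteriorMap D γ Ψ a)
    {C : Matrix ℕ+ ℕ+ ℂ} (hC : C = FaberFlux.grunsky γ Ψ a)
    {σm σc : ℝ} (hσm : 0 < σm) (hσc : 0 < σc) :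
    -- the matrix `I - γ^{-2𝒩} C γ^{-2𝒩} C̄` is well defined and invertible
    FaberFlux.MulSummable (FaberFlux.infMul (FaberFlux.gammaPow γ (-2)) C)
      (FaberFlux.infMul (FaberFlux.gammaPow γ (-2)) (FaberFlux.conjMat C)) ∧
    (∃! M : Matrix ℕ+ ℕ+ ℂ, FaberFlux.IsInfInverse γ (1 - FaberFlux.grunskySquare γ C) M) ∧
    ∀ M : Matrix ℕ+ ℕ+ ℂ, FaberFlux.IsInfInverse γ (1 - FaberFlux.grunskySquare γ C) M →
      ∀ (α : ℕ+ → ℂ) (β s : Matrix ℕ+ ℕ+ ℂ) (u : ℕ+ → ℂ → ℝ),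
        (∀ m, FaberFlux.HasModeExpansion D γ Ψ a m (α m) (β m) (s m) (u m)) →
        (∀ m, FaberFlux.IsC1UpToBoundary D (u m)) →
        -- the series in the formula converge
        FaberFlux.MulSummable (FaberFlux.infMul s (FaberFlux.gammaPow γ (-2)))
          (FaberFlux.conjMat C) ∧
        FaberFlux.MulSummable (FaberFlux.sourceMat γ C s) M ∧
        -- the flux condition for all modes is the matrix identity
        ((∀ m, FaberFlux.FluxContinuous σm σc D γ Ψ (u m)) ↔
          β = FaberFlux.betaFormula σm σc γ C M α s) ∧
        -- the flux condition for a superposition of modes is the sum of the rows of the identity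
        (∀ J : Finset ℕ+,
          FaberFlux.FluxContinuous σm σc D γ Ψ (fun z => ∑ m ∈ J, u m z) ↔
            ∀ n, ∑ m ∈ J, β m n =
              ∑ m ∈ J, FaberFlux.betaFormula σm σc γ C M α s m n) := by
  open FaberFlux in
  subst hC
  obtain ⟨ρ, K, h⟩ := hD.exists_hasGrunskyExpansion
  have hγ := h.radius_pos
  have hγc : (γ : ℂ) ≠ 0 := by exact_mod_cast hγ.ne'
  obtain ⟨S, S', hS, hrS, hrS', hSS', hcomp⟩ := h.exists_op
  have hL : Represents γ (1 - S * S') (1 - grunskySquare γ (grunsky γ Ψ a)) :=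
    (represents_one hγ).sub (hrS.mul hγ hrS')
  refine ⟨hrS.mulSummable hγ hrS', existsUnique_isInfInverse hγ hL
    (isUnit_one_sub_mul hSS' hcomp fun v hv => eq_zero_of_rowAct_eq_star hD h hS hv), ?_⟩
  intro M hM α β s u hu hC1
  -- the inverse matrix is that of the inverse operator
  obtain ⟨T, hT, hLT, hTL⟩ := hM.exists_op hγ hL
  obtain ⟨b, hb, hbγ⟩ := exists_between h.lt
  have hside₁ := hD.isSide_exterior h
  have hside₂ := hD.isSide_interior h hb hbγ
  choose E₂ hE₂ hE₂' using fun m => (hC1 m).1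
  choose E₁ hE₁ hE₁' using fun m => (hC1 m).2
  have hu₁ := fun m => (hu m).isSideField_exterior h (hE₁ m) (hE₁' m)
  have hu₂ := fun m => (hu m).isSideField_interior hD h hb (hE₂ m) (hE₂' m)
  have hβ : ∀ m, Summable fun k : ℕ+ => ‖β m k‖ * ρ ^ (k : ℕ) := fun m =>
    h.summable_mul_pow_of_le hb.le ((hu m).summable_int_coeff hD h ⟨hb, hbγ⟩)
  -- the boundary coefficients `σ = s γ ^ (-𝒩)` and `y = (β - κ α) γ ^ 𝒩` are rows in `ℓ²`
  choose σ hσ using fun m => exists_ext_coeff h hside₁ (hu₁ m)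
  choose y hy using fun m => exists_int_coeff h hside₂ (hβ m) (hu₂ m) (σm / σc) m (α m)
  have hσcc : (σc : ℂ) ≠ 0 := by exact_mod_cast hσc.ne'
  -- the flux condition and the formula, for the sum over `J`, are two equations in `ℓ²`
  have hJ : ∀ J : Finset ℕ+, FluxContinuous σm σc D γ Ψ (fun z => ∑ m ∈ J, u m z) ↔
      ∀ n, ∑ m ∈ J, β m n =
        ∑ m ∈ J, betaFormula σm σc γ (grunsky γ Ψ a) M α s m n := by
    intro J
    have key := sub_rowAct_eq_zero_iff hSS' hLT hTL (∑ m ∈ J, y m) (∑ m ∈ J, σ m) (σm / σc)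
    have e1 : (∑ m ∈ J, y m) - rowAct S' (star (∑ m ∈ J, y m)) +
        ((σm / σc : ℝ) : ℂ) • star (∑ m ∈ J, σ m) =
        ∑ m ∈ J, (y m - rowAct S' (star (y m)) + ((σm / σc : ℝ) : ℂ) • star (σ m)) := by
      rw [star_sum, star_sum, rowAct_sum, Finset.smul_sum, Finset.sum_add_distrib,
        Finset.sum_sub_distrib]
    have e2 : (∑ m ∈ J, y m) + ((σm / σc : ℝ) : ℂ) •
        rowAct T (star (∑ m ∈ J, σ m) + rowAct S' (∑ m ∈ J, σ m)) =
        ∑ m ∈ J, (y m + ((σm / σc : ℝ) : ℂ) • rowAct T (star (σ m) + rowAct S' (σ m))) := by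
      rw [star_sum, rowAct_sum S', ← Finset.sum_add_distrib, rowAct_sum, Finset.smul_sum,
        Finset.sum_add_distrib]
    rw [e1, ← sub_eq_zero (a := ∑ m ∈ J, y m), sub_neg_eq_add, e2] at key
    have hzero : ∀ f : ℕ+ → EllTwo, ∑ m ∈ J, f m = 0 ↔ ∀ k, ∑ m ∈ J, f m k = 0 := by
      intro f
      have hap : ∀ k, (∑ m ∈ J, f m : EllTwo) k = ∑ m ∈ J, f m k := fun k => by
        rw [lp.coeFn_sum, Finset.sum_apply]
      constructor
      · intro hf k
        rw [← hap, hf]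
        rfl
      · intro hf
        ext k
        rw [hap, hf k]
        rfl
    rw [hzero, hzero] at key
    -- the flux condition is the equation `y - ȳ S̄ + κ σ̄ = 0`
    have l1 : FluxContinuous σm σc D γ Ψ (fun z => ∑ m ∈ J, u m z) ↔ ∀ k, ∑ m ∈ J,
        (y m - rowAct S' (star (y m)) + ((σm / σc : ℝ) : ℂ) • star (σ m)) k = 0 := by
      rw [fluxContinuous_sum_iff h hside₁ hside₂ J hu₁ hu₂]
      refine forall_congr' fun k => ?_
      have e4 : ∑ m ∈ J,
          (y m - rowAct S' (star (y m)) + ((σm / σc : ℝ) : ℂ) • star (σ m)) k =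
          ∑ m ∈ J, (β m k * γ ^ (k : ℕ) -
            (starRingEnd ℂ) (rowMul (β m) (grunsky γ Ψ a) k / γ ^ (k : ℕ))) -
          ((σm / σc : ℝ) : ℂ) * ∑ m ∈ J, ((Pi.single m (α m) : ℕ+ → ℂ) k * γ ^ (k : ℕ) -
            (starRingEnd ℂ) ((α m * grunsky γ Ψ a m k + s m k) / γ ^ (k : ℕ))) := by
        rw [Finset.mul_sum, ← Finset.sum_sub_distrib]
        exact Finset.sum_congr rfl fun m _ =>
          sub_rowAct_star_apply h hS hSS' (hβ m) (hy m) (hσ m) k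
      rw [e4, sub_eq_zero, eq_comm (a := ∑ m ∈ J, (β m k * γ ^ (k : ℕ) -
            (starRingEnd ℂ) (rowMul (β m) (grunsky γ Ψ a) k / γ ^ (k : ℕ))))]
      push_cast
      rw [div_mul_eq_mul_div, div_eq_iff hσcc, mul_comm _ (σc : ℂ)]
    -- the formula is the equation `y = -κ (σ̄ + σ S̄) (1 - S S̄)⁻¹`
    have l2 : (∀ n, ∑ m ∈ J, β m n =
        ∑ m ∈ J, betaFormula σm σc γ (grunsky γ Ψ a) M α s m n) ↔ ∀ k, ∑ m ∈ J,
        (y m + ((σm / σc : ℝ) : ℂ) • rowAct T (star (σ m) + rowAct S' (σ m))) k = 0 := by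
      refine forall_congr' fun k => ?_
      have hpow : (γ : ℂ) ^ (k : ℕ) ≠ 0 := pow_ne_zero _ hγc
      have e3 : ∀ m, (y m + ((σm / σc : ℝ) : ℂ) • rowAct T (star (σ m) + rowAct S' (σ m))) k =
          (β m k - betaFormula σm σc γ (grunsky γ Ψ a) M α s m k) * (γ : ℂ) ^ (k : ℕ) := by
        intro m
        rw [betaFormula_apply hγ hS hSS' hσ hT, lp.coeFn_add, Pi.add_apply, lp.coeFn_smul,
          Pi.smul_apply, hy, smul_eq_mul]
        field_simp
        ring
      rw [Finset.sum_congr rfl fun m _ => e3 m, ← Finset.sum_mul, mul_eq_zero_iff_right hpow,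
        Finset.sum_sub_distrib, sub_eq_zero]
    rw [l1, l2, key]
  refine ⟨fun m n => (hasSum_source hγ hS hSS' hσ m n).summable,
    fun m n => (hasSum_sourceMat_mul hγ hS hSS' hσ hT m n).summable, ?_, hJ⟩
  constructor
  · intro hall
    ext m n
    simpa using (hJ {m}).1 (by simpa using hall m) n
  · intro hβeq m
    simpa using (hJ {m}).2 fun n => by simpa using congrFun (congrFun hβeq m) n
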